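/- Let $R$ be a commutative artinian ring. An artin $R$-algebra is an $R$-algebra that is finitely generated as an $R$-module; modules are finitely generated left modules, and $n(A)$ is the number of isomorphism classes of simple $A$-modules. $A$ is connected if it is nonzero and not a direct sum of two proper ideals; it is Nakayama if all indecomposable projective and all indecomposable injective $A$-modules are uniserial (have a unique composition series); it is self-injective if the regular module ${}_AA$ is injective. A simple $A$-module $S$ is localizable if $\operatorname{proj.dim}_A S\le 1$ and $\operatorname{Ext}^1_A(S,S)=0$. For such $S$ let $S^\perp$ be the full subcategory of the modules $X$ with $\operatorname{Hom}_A(S,X)=0=\operatorname{Ext}^1_A(S,X)$, and let $\eta_A\colon A\to L(A)$ be the universal morphism of left $A$-modules from $A$ to $S^\perp$. With the product $x\star y=g_y(x)$, where $g_y\colon L(A)\to L(A)$ is the unique $A$-linear map with $g_y(\eta_A(a))=a\cdot y$ for all $a\in A$, $L(A)$ is an algebra and $\eta_A$ is an algebra homomorphism, called the left retraction associated to $S$ (it is determined up to isomorphism of algebras under $A$). Let $A$ be a connected Nakayama artin $R$-algebra and $n=n(A)$. Representatives $S_1,\dots,S_n$ of the simple $A$-modules can be ordered so that the quiver of $A$,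 which has an arrow $S_j\to S_k$ whenever $\operatorname{Ext}^1_A(S_j,S_k)\neq0$, is either $S_1\to S_2\to\cdots\to S_n$ or the oriented cycle $S_1\to S_2\to\cdots\to S_n\to S_1$. Let $c_j$ be the composition length of the projective cover of $S_j$, let $\theta\colon\{1,\dots,n\}\to\{1,\dots,n\}$ be the map with $\theta(j)\equiv j+c_j \pmod n$, and let $d(A)$ be the least $d\ge 0$ with $\operatorname{Im}\theta^{d}=\operatorname{Im}\theta^{d+1}$; this number does not depend on the ordering. Theorem. There is a sequence of homomorphisms between connected Nakayama algebras $$A=A_0\xrightarrow{\eta_0}A_1\xrightarrow{\eta_1}\cdots\xrightarrow{\eta_{r-1}}A_r$$ in which each $\eta_i$ is (up to isomorphism under $A_i$) the left retraction associated to some localizable $A_i$-module, and $A_r$ is self-injective, such that $d(A)\le r\le n(A)-1$. Moreover, every such sequence with $A_r$ self-injective satisfies $d(A)\le r\le n(A)-1$ and the following: (1) the algebra $A_r$ is simple if and only if $\operatorname{gl.dim}A<\infty$, and in this case $r=n(A)-1$; (2) if $\operatorname{gl.dim}A=\infty$, then $r$ is the number of isomorphism classes of simple $A$-modules of finite projective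 dimension, and the composite $\eta_{r-1}\circ\cdots\circ\eta_0\colon A\to A_r$ is uniquely determined by $A$: for any other such sequence $A=A'_0\to\cdots\to A'_{r'}$ with $A'_{r'}$ self-injective, there is an isomorphism of $R$-algebras $\psi\colon A_r\to A'_{r'}$ that carries the composite $A\to A_r$ to the composite $A\to A'_{r'}$. -/

import Mathlib

open CategoryTheory

universe u v

namespace NakayamaRetraction

noncomputable section

/-! ### Modules -/

/-- An indecomposable module: nonzero, and not the direct sum of two nonzero submodules. -/
def IsIndecomposableModule (A : Type v) [Ring A] (M : Type v) [AddCommGroup M] [Module A M] :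
    Prop :=
  Nontrivial M ∧ ∀ N K : Submodule A M, IsCompl N K → N = ⊥ ∨ K = ⊥

/-- A uniserial module: a module with a unique composition series (a maximal chain of
submodules from `0` to `M`). -/
def IsUniserial (A : Type v) [Ring A] (M : Type v) [AddCommGroup M] [Module A M] : Prop :=
  ∃! s : CompositionSeries (Submodule A M), s.head = ⊥ ∧ s.last = ⊤

/-- `f : P → M` is a projective cover of `M`, with `P` finitely generated: `P` is projective,
`f` is surjective, and the kernel of `f` is superfluous in `P`. -/
structure IsProjectiveCover {A : Type v} [Ring A] {P M : Type v} [AddCommGroup P] [Module A P]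
    [AddCommGroup M] [Module A M] (f : P →ₗ[A] M) : Prop where
  finite : Module.Finite A P
  projective : Module.Projective A P
  surjective : Function.Surjective f
  superfluous : ∀ N : Submodule A P, N ⊔ LinearMap.ker f = ⊤ → N = ⊤

/-! ### Invariants of an algebra -/

/-- The isomorphism classes of simple (left) `A`-modules. -/
def simpleClasses (A : Type v) [Ring A] : Set (Quotient (isIsomorphicSetoid (ModuleCat.{v} A))) :=
  {c | ∃ S : ModuleCat.{v} A, IsSimpleModule A S ∧ Quotient.mk _ S = c}

/-- `n(A)`: the number of pairwise non-isomorphic simple `A`-modules. -/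
def numSimples (A : Type v) [Ring A] : ℕ := (simpleClasses A).ncard

/-- The number of pairwise non-isomorphic simple `A`-modules of finite projective dimension. -/
def numSimplesFiniteProjDim (A : Type v) [Ring A] : ℕ :=
  {c : Quotient (isIsomorphicSetoid (ModuleCat.{v} A)) | ∃ S : ModuleCat.{v} A,
    (IsSimpleModule A S ∧ projectiveDimension S < ⊤) ∧ Quotient.mk _ S = c}.ncard

/-- The global dimension: the supremum of the projective dimensions of the finitely generated
left modules. -/
def globalDim (A : Type v) [Ring A] : WithBot ℕ∞ :=
  ⨆ M : {M : ModuleCat.{v} A // Module.Finite A M}, projectiveDimension M.1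

/-- A self-injective algebra: the regular module is injective. -/
def IsSelfInjective (A : Type v) [Ring A] : Prop := Module.Injective A A

/-! ### Connected Nakayama algebras -/

/-- A connected algebra: a nonzero algebra that is not a direct sum of two proper ideals. -/
def IsConnectedAlgebra (A : Type v) [Ring A] : Prop :=
  Nontrivial A ∧ ¬ ∃ I J : TwoSidedIdeal A, I ≠ ⊤ ∧ J ≠ ⊤ ∧ IsCompl I J

/-- A connected Nakayama artin algebra over `R` (where `R` is a commutative artinian ring):
`A` is a finitely generated `R`-module, it is connected, and all (finitely generated)
indecomposable projective and indecomposable injective left modules are uniserial. -/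
structure IsConnectedNakayama (R : Type u) [CommRing R] (A : Type v) [Ring A] [Algebra R A] :
    Prop where
  finite : Module.Finite R A
  connected : IsConnectedAlgebra A
  projective_uniserial : ∀ M : ModuleCat.{v} A, Module.Finite A M → Module.Projective A M →
    IsIndecomposableModule A M → IsUniserial A M
  injective_uniserial : ∀ M : ModuleCat.{v} A, Module.Finite A M → Module.Injective A M →
    IsIndecomposableModule A M → IsUniserial A M

/-! ### The invariant `d(A)` -/

/-- An ordering `S_0, …, S_{n-1}` of representatives of the simple modules along the quiver of
`A` (with an arrow from `S_j` to `S_k` when `Ext¹(S_j, S_k) ≠ 0`), which is required to be the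
linear quiver `S_0 → S_1 → ⋯ → S_{n-1}` or the oriented cycle
`S_0 → S_1 → ⋯ → S_{n-1} → S_0`; together with projective covers `P_j → S_j`. -/
structure SimpleOrdering (A : Type v) [Ring A] where
  S : Fin (numSimples A) → ModuleCat.{v} A
  isSimple : ∀ j, IsSimpleModule A (S j)
  eq_of_iso : ∀ j k, Nonempty (S j ≅ S k) → j = k
  complete : ∀ T : ModuleCat.{v} A, IsSimpleModule A T → ∃ j, Nonempty (T ≅ S j)
  quiver :
    (∀ j k, Nontrivial (Abelian.Ext (S j) (S k) 1) ↔ (k : ℕ) = j + 1) ∨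
    (∀ j k, Nontrivial (Abelian.Ext (S j) (S k) 1) ↔ (k : ℕ) = (j + 1) % numSimples A)
  P : Fin (numSimples A) → ModuleCat.{v} A
  cover : ∀ j, P j →ₗ[A] S j
  isCover : ∀ j, IsProjectiveCover (cover j)

namespace SimpleOrdering

variable {A : Type v} [Ring A] (O : SimpleOrdering A)

/-- The admissible sequence `c_j = l(P_j)`. -/
def c (j : Fin (numSimples A)) : ℕ := (Module.length A (O.P j)).toNat

/-- The map `θ(j) = j + c_j`, modulo `n(A)`. -/
def theta (j : Fin (numSimples A)) : Fin (numSimples A) :=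
  ⟨(j + O.c j) % numSimples A, Nat.mod_lt _ j.pos⟩

/-- The least `m` such that `Im θ^m = Im θ^{m+1}`. -/
def depth : ℕ := sInf {m : ℕ | Set.range O.theta^[m] = Set.range O.theta^[m + 1]}

end SimpleOrdering

/-- `d(A) = d`: orderings of the simple modules along the quiver exist, and each of them yields
the value `d`. -/
def HasDepth (A : Type v) [Ring A] (d : ℕ) : Prop :=
  Nonempty (SimpleOrdering A) ∧ ∀ O : SimpleOrdering A, O.depth = d

/-! ### Left retractions -/

section

variable {A : Type v} [Ring A]

/-- A localizable module: a simple module `S` with `proj.dim S ≤ 1` and `Ext¹(S, S) = 0`. -/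
structure IsLocalizable (S : ModuleCat.{v} A) : Prop where
  simple : IsSimpleModule A S
  projDim_le : projectiveDimension S ≤ 1
  ext_self : Subsingleton (Abelian.Ext S S 1)

/-- The perpendicular subcategory `S^⊥` of the category of finitely generated `A`-modules. -/
structure Perp (S X : ModuleCat.{v} A) : Prop where
  finite : Module.Finite A X
  hom : Subsingleton (S ⟶ X)
  ext : Subsingleton (Abelian.Ext S X 1)

/-- `h : X ⟶ Y` is the universal morphism from `X` to `S^⊥`, that is, `h` is the unit at `X` of
the adjunction between the left adjoint of the inclusion of `S^⊥` and the inclusion. -/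
structure IsUniversalToPerp (S : ModuleCat.{v} A) {X Y : ModuleCat.{v} A} (h : X ⟶ Y) :
    Prop where
  perp : Perp S Y
  existsUnique_lift : ∀ Z : ModuleCat.{v} A, Perp S Z → ∀ f : X ⟶ Z, ∃! g : Y ⟶ Z, h ≫ g = f

variable {R : Type u} [CommRing R] [Algebra R A] {B : Type v} [Ring B] [Algebra R B]

/-- `B` as a left `A`-module through a homomorphism `η : A → B`. -/
abbrev restrictedModule (η : A →ₐ[R] B) : ModuleCat.{v} A :=
  (ModuleCat.restrictScalars (η : A →+* B)).obj (ModuleCat.of B B)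

/-- The morphism of left `A`-modules `A → B`, `a ↦ η(a) y`, that takes `1` to `y`. -/
def rightMul (η : A →ₐ[R] B) (y : B) : ModuleCat.of A A ⟶ restrictedModule η :=
  ModuleCat.ofHom (Y := restrictedModule η)
    (LinearMap.toSpanSingleton A (restrictedModule η) y)

/-- `η : A → B` is (isomorphic under `A` to) the left retraction `η_A : A → L(A)` associated to
the localizable module `S`: the morphism `η` of left `A`-modules is the universal morphism from
`A` to `S^⊥`, and the product of `B` is `x ⋆ y = g(x)`, where `g : B → B` is the unique morphism
of left `A`-modules with `g(η(a)) = a • y` for `a` in `A`. -/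
structure IsLeftRetraction (S : ModuleCat.{v} A) (η : A →ₐ[R] B) : Prop where
  localizable : IsLocalizable S
  universal : IsUniversalToPerp S (rightMul η 1)
  mul_eq : ∀ (x y : B) (g : restrictedModule η ⟶ restrictedModule η),
    rightMul η 1 ≫ g = rightMul η y → x * y = g.hom x

end

/-- `IsLeftRetractionSequence R A r B f`: there is a sequence
`A = A_0 → A_1 → ⋯ → A_r = B` of connected Nakayama `R`-algebras, in which each homomorphism is
the left retraction associated to some localizable module, and whose composite is `f`. -/
inductive IsLeftRetractionSequence (R : Type u) [CommRing R] (A : Type v) [Ring A] [Algebra R A] :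
    (r : ℕ) → (B : Type v) → [Ring B] → [Algebra R B] → (A →ₐ[R] B) → Prop
  | refl : IsConnectedNakayama R A → IsLeftRetractionSequence R A 0 A (AlgHom.id R A)
  | step {r : ℕ} {B C : Type v} [Ring B] [Algebra R B] [Ring C] [Algebra R C]
      {f : A →ₐ[R] B} (η : B →ₐ[R] C) (S : ModuleCat.{v} B) :
      IsLeftRetractionSequence R A r B f → IsConnectedNakayama R C → IsLeftRetraction S η →
      IsLeftRetractionSequence R A (r + 1) C (η.comp f)

end

end NakayamaRetraction

/-! A retraction `A → B` at `S` is controlled by an idempotent `e` of `A` that kills `S` and is the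
identity on the other simple modules. Modules of finite length killed by `e` are filtered by copies
of `S`. The retraction is characterised by two facts: `B` lies in `S^⊥`, and the kernel and cokernel
of `A → B` are killed by `e` (`IsRetraction`). A model is `A → End_{eAe}(eA)ᵒᵖ`
(`isRetraction_cornerEnd`).

Because `S` has projective dimension at most one, finitely generated `B`-modules lie in `S^⊥`,
`A`-linear maps between them are `B`-linear, and finite projective dimension means the same over `A`
and over `B` (`IsRetraction.finPD_iff`). A simple `B`-module has a simple `A`-socle, and the rest is
filtered by `S`; this matches the simple `B`-modules with the simple `A`-modules other than `S`. So
each step lowers by one the number of simples and the number of simples of finite projective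
dimension, and preserves finiteness of the global dimension.

Over a self-injective algebra, finite projective dimension means projective. A simple module of that
kind is also injective, hence isolated in the quiver, and connectedness makes the algebra simple. So
at the end of a sequence either the algebra is simple with one simple module, or no simple module
has finite projective dimension. Counting back gives (1) and the value of `r` in (2).

For `d ≤ r`: the second syzygy of the uniserial module with factors `i, …, i+l-1` has factors `θ i,
…, θ(i+l)-1`, where `θ` is lifted to a monotone map of the integers. If `θ^m` merges `i` and `i+1`,
then `S_i` has finite projective dimension. Hence `Im θ^m` has at least as many elements as there
are simples of infinite projective dimension, while the images shrink strictly up to stage `d`.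

Existence: if `A` is not self-injective, the lengths `c_j` are not constant, so `c_i = c_{i+1} + 1`
for some `i`. On a cycle this makes `rad P_i` isomorphic to `P_{i+1}` and `S_i` localizable; on a
line the simple projective sink is localizable. Removing it leaves the quiver connected, and the
retraction is again connected Nakayama.

Uniqueness: let `e` be the idempotent for the simples of infinite projective dimension. The
composite `f : A → A_r` keeps restricting to a bijection from `eA` to `f(e)A_r`. At a self-injective
end of infinite global dimension `f(e)` kills no simple module, so `A_r` is `End_{eAe}(eA)ᵒᵖ`, which
depends on `A` alone. -/

namespace NakayamaRetraction
noncomputable section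

/-! ### Vanishing of Ext and finite projective dimension along exact sequences -/

section Homological

variable {A : Type v} [Ring A]

/-- The group `Extⁿ(M, N)` vanishes. -/
def ExtZero (A : Type v) [Ring A] (M N : Type v) [AddCommGroup M] [Module A M]
    [AddCommGroup N] [Module A N] (n : ℕ) : Prop :=
  Subsingleton (Abelian.Ext (ModuleCat.of A M) (ModuleCat.of A N) n)

/-- The module `M` has finite projective dimension. -/
def FinPD (A : Type v) [Ring A] (M : Type v) [AddCommGroup M] [Module A M] : Prop :=
  ∃ n, HasProjectiveDimensionLT (ModuleCat.of A M) n

variable {M N K Y : Type v} [AddCommGroup M] [Module A M] [AddCommGroup N] [Module A N]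
  [AddCommGroup K] [Module A K] [AddCommGroup Y] [Module A Y]

theorem shortExact_of_exact {f : M →ₗ[A] N} {g : N →ₗ[A] K} (hf : Function.Injective f)
    (hg : Function.Surjective g) (h : Function.Exact f g) :
    (ShortComplex.mk (ModuleCat.ofHom f) (ModuleCat.ofHom g)
      (by ext x; exact h.apply_apply_eq_zero x)).ShortExact where
  exact := (ShortComplex.ShortExact.moduleCat_exact_iff_function_exact _).2 h
  mono_f := (ModuleCat.mono_iff_injective _).2 hf
  epi_g := (ModuleCat.epi_iff_surjective _).2 hg

theorem ExtZero.congr {M' N' : Type v} [AddCommGroup M'] [Module A M']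
    [AddCommGroup N'] [Module A N'] {n : ℕ} (e : M ≃ₗ[A] M') (e' : N ≃ₗ[A] N')
    (h : ExtZero A M N n) : ExtZero A M' N' n := by
  refine ⟨fun x y => ?_⟩
  have key : ∀ z : Abelian.Ext (ModuleCat.of A M') (ModuleCat.of A N') n, z = 0 := by
    intro z
    have h1 : (Abelian.Ext.mk₀ e.toModuleIso.hom).comp
        (z.comp (Abelian.Ext.mk₀ e'.toModuleIso.inv) (add_zero n)) (zero_add n) = 0 :=
      h.elim _ _
    have h2 := congrArg (fun w => (Abelian.Ext.mk₀ e.toModuleIso.inv).comp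
        (w.comp (Abelian.Ext.mk₀ e'.toModuleIso.hom) (add_zero n)) (zero_add n)) h1
    simpa only [Abelian.Ext.comp_assoc_of_third_deg_zero, Abelian.Ext.mk₀_comp_mk₀_assoc,
      Abelian.Ext.mk₀_comp_mk₀, Iso.inv_hom_id, Abelian.Ext.mk₀_id_comp, Abelian.Ext.comp_mk₀_id,
      Abelian.Ext.zero_comp, Abelian.Ext.comp_zero] using h2
  rw [key x, key y]

theorem extZero_zero_iff : ExtZero A M N 0 ↔ ∀ f : M →ₗ[A] N, f = 0 := by
  unfold ExtZero
  rw [Abelian.Ext.homEquiv₀.subsingleton_congr, ModuleCat.homEquiv.subsingleton_congr]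
  exact ⟨fun h f => h.elim _ _, fun h => ⟨fun f g => by rw [h f, h g]⟩⟩

section Exact

variable {f : M →ₗ[A] N} {g : N →ₗ[A] K} (hf : Function.Injective f)
    (hg : Function.Surjective g) (h : Function.Exact f g) {n : ℕ}
include hf hg h

theorem ExtZero.contra_mid (h₁ : ExtZero A M Y n) (h₃ : ExtZero A K Y n) : ExtZero A N Y n := by
  have key : ∀ z : Abelian.Ext (ModuleCat.of A N) (ModuleCat.of A Y) n, z = 0 := fun z => by
    obtain ⟨x, rfl⟩ := Abelian.Ext.contravariant_sequence_exact₂ (shortExact_of_exact hf hg h) _ z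
      (h₁.elim _ _)
    rw [h₃.elim x 0, Abelian.Ext.comp_zero]
  exact ⟨fun x y => by rw [key x, key y]⟩

theorem ExtZero.contra_left (h₂ : ExtZero A N Y n) (h₃ : ExtZero A K Y (n + 1)) :
    ExtZero A M Y n := by
  have key : ∀ z : Abelian.Ext (ModuleCat.of A M) (ModuleCat.of A Y) n, z = 0 := fun z => by
    obtain ⟨x, rfl⟩ := Abelian.Ext.contravariant_sequence_exact₁ (shortExact_of_exact hf hg h) _ z
      (add_comm 1 n) (h₃.elim _ _)
    rw [h₂.elim x 0, Abelian.Ext.comp_zero]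
  exact ⟨fun x y => by rw [key x, key y]⟩

theorem ExtZero.contra_right (h₁ : ExtZero A M Y n) (h₂ : ExtZero A N Y (n + 1)) :
    ExtZero A K Y (n + 1) := by
  have key : ∀ z : Abelian.Ext (ModuleCat.of A K) (ModuleCat.of A Y) (n + 1), z = 0 := fun z => by
    obtain ⟨x, rfl⟩ := Abelian.Ext.contravariant_sequence_exact₃ (shortExact_of_exact hf hg h) _ z
      (h₂.elim _ _) (add_comm 1 n)
    rw [h₁.elim x 0, Abelian.Ext.comp_zero]
  exact ⟨fun x y => by rw [key x, key y]⟩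

theorem ExtZero.cov_right (h₂ : ExtZero A Y N n) (h₁ : ExtZero A Y M (n + 1)) :
    ExtZero A Y K n := by
  have key : ∀ z : Abelian.Ext (ModuleCat.of A Y) (ModuleCat.of A K) n, z = 0 := fun z => by
    obtain ⟨x, rfl⟩ := Abelian.Ext.covariant_sequence_exact₃ _ (shortExact_of_exact hf hg h) z
      rfl (h₁.elim _ _)
    rw [h₂.elim x 0, Abelian.Ext.zero_comp]
  exact ⟨fun x y => by rw [key x, key y]⟩

theorem ExtZero.cov_left (h₃ : ExtZero A Y K n) (h₂ : ExtZero A Y N (n + 1)) :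
    ExtZero A Y M (n + 1) := by
  have key : ∀ z : Abelian.Ext (ModuleCat.of A Y) (ModuleCat.of A M) (n + 1), z = 0 := fun z => by
    obtain ⟨x, rfl⟩ := Abelian.Ext.covariant_sequence_exact₁ _ (shortExact_of_exact hf hg h) z
      (h₂.elim _ _) rfl
    rw [h₃.elim x 0, Abelian.Ext.zero_comp]
  exact ⟨fun x y => by rw [key x, key y]⟩

theorem ExtZero.exists_extend (h₃ : ExtZero A K Y 1) (p : M →ₗ[A] Y) :
    ∃ q : N →ₗ[A] Y, q ∘ₗ f = p := by
  obtain ⟨x, hx⟩ := Abelian.Ext.contravariant_sequence_exact₁ (shortExact_of_exact hf hg h) _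
      (Abelian.Ext.mk₀ (ModuleCat.ofHom p)) (add_zero 1) (h₃.elim _ _)
  obtain ⟨q, rfl⟩ := Abelian.Ext.homEquiv₀.symm.surjective x
  refine ⟨q.hom, ?_⟩
  have := (Abelian.Ext.mk₀_bijective _ _).1
    (by simpa using hx : Abelian.Ext.mk₀ (ModuleCat.ofHom f ≫ q) = Abelian.Ext.mk₀ (ModuleCat.ofHom p))
  simpa using congrArg ModuleCat.Hom.hom this

/-- As `N` is projective, every class in `Ext¹(K, Y)` is the connecting image of a map `M → Y`, and
this image vanishes when the map extends to `N`. -/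
theorem ExtZero.of_exists_extend (hN : Module.Projective A N)
    (hex : ∀ p : M →ₗ[A] Y, ∃ q : N →ₗ[A] Y, q ∘ₗ f = p) : ExtZero A K Y 1 := by
  have : Projective (ModuleCat.of A N) := (IsProjective.iff_projective (R := A) N).1 hN
  have key : ∀ z : Abelian.Ext (ModuleCat.of A K) (ModuleCat.of A Y) 1, z = 0 := fun z => by
    obtain ⟨x, rfl⟩ := Abelian.Ext.contravariant_sequence_exact₃ (shortExact_of_exact hf hg h) _ z
      (Abelian.Ext.eq_zero_of_projective _) (add_zero 1)
    obtain ⟨p, rfl⟩ := Abelian.Ext.homEquiv₀.symm.surjective x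
    obtain ⟨q, hq⟩ := hex p.hom
    have : p = ModuleCat.ofHom f ≫ ModuleCat.ofHom q := by
      ext x; exact (LinearMap.congr_fun hq x).symm
    subst this
    rw [Abelian.Ext.homEquiv₀_symm_apply, ← Abelian.Ext.mk₀_comp_mk₀]
    exact (shortExact_of_exact hf hg h).extClass_comp_assoc _
  exact ⟨fun x y => by rw [key x, key y]⟩

theorem FinPD.mid (h₁ : FinPD A M) (h₃ : FinPD A K) : FinPD A N := by
  obtain ⟨a, ha⟩ := h₁
  obtain ⟨b, hb⟩ := h₃
  exact ⟨a + b, (shortExact_of_exact hf hg h).hasProjectiveDimensionLT_X₂ (a + b)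
    (hasProjectiveDimensionLT_of_ge _ a _ (by lia)) (hasProjectiveDimensionLT_of_ge _ b _ (by lia))⟩

theorem FinPD.left (h₂ : FinPD A N) (h₃ : FinPD A K) : FinPD A M := by
  obtain ⟨a, ha⟩ := h₂
  obtain ⟨b, hb⟩ := h₃
  exact ⟨a + b, (shortExact_of_exact hf hg h).hasProjectiveDimensionLT_X₁ (a + b)
    (hasProjectiveDimensionLT_of_ge _ a _ (by lia)) (hasProjectiveDimensionLT_of_ge _ b _ (by lia))⟩

theorem FinPD.right (h₁ : FinPD A M) (h₂ : FinPD A N) : FinPD A K := by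
  obtain ⟨a, ha⟩ := h₁
  obtain ⟨b, hb⟩ := h₂
  exact ⟨a + b + 1, (shortExact_of_exact hf hg h).hasProjectiveDimensionLT_X₃ (a + b)
    (hasProjectiveDimensionLT_of_ge _ a _ (by lia)) (hasProjectiveDimensionLT_of_ge _ b _ (by lia))⟩

end Exact

theorem FinPD.congr (e : M ≃ₗ[A] N) (h : FinPD A M) : FinPD A N := by
  obtain ⟨n, hn⟩ := h
  exact ⟨n, hasProjectiveDimensionLT_of_iso e.toModuleIso n⟩

theorem FinPD.of_projective [Module.Projective A M] : FinPD A M :=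
  have : Projective (ModuleCat.of A M) := (IsProjective.iff_projective (R := A) M).1 inferInstance
  ⟨1, inferInstance⟩

theorem FinPD.of_subsingleton [Subsingleton M] : FinPD A M :=
  ⟨0, (ModuleCat.isZero_of_subsingleton _).hasProjectiveDimensionLT_zero⟩

theorem FinPD.of_retract (h : FinPD A N) (f : M →ₗ[A] N) (g : N →ₗ[A] M)
    (hgf : g ∘ₗ f = LinearMap.id) : FinPD A M := by
  obtain ⟨n, hn⟩ := h
  have r : Retract (ModuleCat.of A M) (ModuleCat.of A N) :=
    ⟨ModuleCat.ofHom f, ModuleCat.ofHom g, by ext x; exact LinearMap.congr_fun hgf x⟩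
  exact ⟨n, r.hasProjectiveDimensionLT n⟩

theorem ExtZero.of_subsingleton [Subsingleton M] {n : ℕ} : ExtZero A M N n := by
  have := (ModuleCat.isZero_of_subsingleton (ModuleCat.of A M)).hasProjectiveDimensionLT_zero
  exact HasProjectiveDimensionLT.subsingleton _ 0 n (Nat.zero_le n) _

theorem ExtZero.of_projective [Module.Projective A M] {n : ℕ} : ExtZero A M N (n + 1) := by
  have : Projective (ModuleCat.of A M) := (IsProjective.iff_projective (R := A) M).1 inferInstance
  exact HasProjectiveDimensionLT.subsingleton _ 1 _ (by lia) _

theorem projectiveDimension_lt_top_iff (M : ModuleCat.{v} A) :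
    projectiveDimension M < ⊤ ↔ FinPD A M := by
  rw [lt_top_iff_ne_top, projectiveDimension_ne_top_iff]
  exact ⟨fun ⟨n, hn⟩ => ⟨n + 1, hn⟩, fun ⟨n, hn⟩ =>
    ⟨n, hasProjectiveDimensionLT_of_ge _ n _ (by lia)⟩⟩

end Homological

/-! ### Uniserial modules and chains of submodules -/

section Uniserial

/-- A module whose submodules form a chain. -/
def IsChainModule (A : Type v) [Ring A] (M : Type v) [AddCommGroup M] [Module A M] : Prop :=
  ∀ N K : Submodule A M, N ≤ K ∨ K ≤ N

variable {A : Type v} [Ring A] {M N : Type v} [AddCommGroup M] [Module A M]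
  [AddCommGroup N] [Module A N]

theorem exists_compositionSeries_extend [IsArtinian A M] [IsNoetherian A M]
    (b c : Submodule A M) (hcb : c ≤ b) (s : CompositionSeries (Submodule A M))
    (hs : s.last = c) :
    ∃ s' : CompositionSeries (Submodule A M), s'.head = s.head ∧ s'.last = b ∧ ∀ x ∈ s, x ∈ s' := by
  induction c using WellFoundedGT.induction generalizing s with
  | ind c ih =>
    rcases hcb.eq_or_lt with rfl | hlt
    · exact ⟨s, rfl, hs, fun _ hx => hx⟩
    · obtain ⟨d, hcd, hdb⟩ := exists_covBy_le_of_lt hlt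
      have hm : JordanHolderLattice.IsMaximal s.last d := by rw [hs]; exact hcd
      obtain ⟨s', h1, h2, h3⟩ := ih d hcd.lt hdb (s.snoc d hm) (RelSeries.last_snoc ..)
      exact ⟨s', h1.trans (RelSeries.head_snoc ..), h2,
        fun x hx => h3 x (RelSeries.mem_snoc.2 (Or.inl hx))⟩

/-- Some composition series passes through any given submodule. Uniqueness makes all submodules
terms of one and the same series. -/
theorem IsUniserial.isChainModule [IsArtinian A M] [IsNoetherian A M] (h : IsUniserial A M) :
    IsChainModule A M := by
  obtain ⟨s, -, hs⟩ := h
  have key : ∀ N : Submodule A M, N ∈ s := fun N => by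
    obtain ⟨t, ht1, ht2, -⟩ := exists_compositionSeries_extend N ⊥ bot_le
      (RelSeries.singleton _ ⊥) rfl
    obtain ⟨t', h1, h2, h3⟩ := exists_compositionSeries_extend ⊤ N le_top t ht2
    rw [← hs t' ⟨h1.trans ht1, h2⟩]
    exact h3 N (ht2 ▸ RelSeries.last_mem t)
  exact fun N K => CompositionSeries.total (key N) (key K)

theorem IsChainModule.mem_compositionSeries (h : IsChainModule A M)
    (s : CompositionSeries (Submodule A M)) (h₁ : s.head = ⊥) (h₂ : s.last = ⊤)
    (N : Submodule A M) : N ∈ s := by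
  by_contra hN
  -- If `N` is missing from the series, each term stays strictly below `N`, since a step of the
  -- series is a covering and cannot jump over `N`. The last term `⊤` gives the contradiction.
  have key : ∀ i : ℕ, ∀ hi : i < s.length + 1, s ⟨i, hi⟩ < N := by
    intro i
    induction i with
    | zero =>
      intro hi
      have h0 : s ⟨0, hi⟩ = ⊥ := h₁
      rw [h0, bot_lt_iff_ne_bot]
      rintro rfl
      exact hN (h₁ ▸ RelSeries.head_mem s)
    | succ i ih =>
      intro hi
      have hcov : s ⟨i, by lia⟩ ⋖ s ⟨i + 1, hi⟩ := s.step ⟨i, by lia⟩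
      have hne : s ⟨i + 1, hi⟩ ≠ N := fun hne => hN ⟨_, hne⟩
      rcases h (s ⟨i + 1, hi⟩) N with hle | hle
      · exact lt_of_le_of_ne hle hne
      · exact absurd (lt_of_le_of_ne hle hne.symm) (hcov.2 (ih (by lia)))
  have := key s.length (by lia)
  have hl : s ⟨s.length, by lia⟩ = ⊤ := h₂
  rw [hl] at this
  exact not_top_lt this

theorem IsChainModule.isUniserial [IsArtinian A M] [IsNoetherian A M] (h : IsChainModule A M) :
    IsUniserial A M := by
  obtain ⟨s, h1, h2⟩ := exists_compositionSeries_of_isNoetherian_isArtinian A M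
  refine ⟨s, ⟨h1, h2⟩, fun t ht => CompositionSeries.ext fun x => ?_⟩
  exact iff_of_true (h.mem_compositionSeries t ht.1 ht.2 x) (h.mem_compositionSeries s h1 h2 x)

theorem IsChainModule.of_injective (h : IsChainModule A N) (f : M →ₗ[A] N)
    (hf : Function.Injective f) : IsChainModule A M := fun U W => by
  rcases h (U.map f) (W.map f) with h | h
  · exact Or.inl ((Submodule.map_le_map_iff_of_injective hf _ _).1 h)
  · exact Or.inr ((Submodule.map_le_map_iff_of_injective hf _ _).1 h)

theorem IsChainModule.of_surjective (h : IsChainModule A M) (f : M →ₗ[A] N)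
    (hf : Function.Surjective f) : IsChainModule A N := fun U W => by
  rcases h (U.comap f) (W.comap f) with h | h
  · exact Or.inl ((Submodule.comap_le_comap_iff_of_surjective hf).1 h)
  · exact Or.inr ((Submodule.comap_le_comap_iff_of_surjective hf).1 h)

end Uniserial

section Simple

variable {A : Type v} [Ring A]

theorem exists_isSimpleModule_le (M : Type v) [AddCommGroup M] [Module A M] [IsArtinian A M]
    [Nontrivial M] : ∃ T : Submodule A M, IsSimpleModule A T := by
  obtain h | ⟨T, hT, -⟩ := eq_bot_or_exists_atom_le (⊤ : Submodule A M)
  · exact absurd h top_ne_bot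
  · exact ⟨T, isSimpleModule_iff_isAtom.2 hT⟩

theorem exists_le_isSimpleModule_quotient {M : Type v} [AddCommGroup M] [Module A M]
    [Module.Finite A M] {N : Submodule A M} (hN : N ≠ ⊤) :
    ∃ K : Submodule A M, N ≤ K ∧ IsSimpleModule A (M ⧸ K) := by
  obtain h | ⟨K, hK, hNK⟩ := eq_top_or_exists_le_coatom N
  · exact absurd h hN
  · exact ⟨K, hNK, isSimpleModule_iff_isCoatom.2 hK⟩

end Simple

/-! ### Projective covers -/

section ProjectiveCover

variable {A : Type v} [Ring A]

theorem exists_isCompl_ker_pow_range_pow {M : Type v} [AddCommGroup M] [Module A M]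
    [IsArtinian A M] [IsNoetherian A M] (φ : Module.End A M) :
    ∃ k, IsCompl (LinearMap.ker (φ ^ (k + 1))) (LinearMap.range (φ ^ (k + 1))) := by
  obtain ⟨k, hk⟩ := Filter.eventually_atTop.1 φ.eventually_isCompl_ker_pow_range_pow
  exact ⟨k, hk (k + 1) (Nat.le_succ k)⟩

theorem exists_retraction_of_isCompl {M : Type v} [AddCommGroup M] [Module A M]
    {N K : Submodule A M} (h : IsCompl N K) :
    ∃ r : M →ₗ[A] N, r ∘ₗ N.subtype = LinearMap.id :=
  ⟨N.projectionOnto K h, by ext x; simp⟩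

theorem projective_of_isCompl {M : Type v} [AddCommGroup M] [Module A M] [Module.Projective A M]
    {N K : Submodule A M} (h : IsCompl N K) : Module.Projective A N := by
  obtain ⟨r, hr⟩ := exists_retraction_of_isCompl h
  exact Module.Projective.of_split N.subtype r hr

theorem injective_of_retract {M N : Type v} [AddCommGroup M] [Module A M] [AddCommGroup N]
    [Module A N] (hM : Module.Injective A M) (i : N →ₗ[A] M) (r : M →ₗ[A] N)
    (hr : r ∘ₗ i = LinearMap.id) : Module.Injective A N where
  out X Y _ _ _ _ f hf g := by
    obtain ⟨h, hh⟩ := hM.out f hf (i ∘ₗ g)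
    exact ⟨r ∘ₗ h, fun x => by
      rw [LinearMap.comp_apply, hh]; exact LinearMap.congr_fun hr (g x)⟩

/-- An epimorphism with superfluous kernel. -/
structure IsEssentialEpi {M N : Type v} [AddCommGroup M] [Module A M] [AddCommGroup N]
    [Module A N] (f : M →ₗ[A] N) : Prop where
  surjective : Function.Surjective f
  superfluous : ∀ U : Submodule A M, U ⊔ LinearMap.ker f = ⊤ → U = ⊤

theorem IsProjectiveCover.isEssentialEpi {P M : Type v} [AddCommGroup P]
    [Module A P] [AddCommGroup M] [Module A M] {f : P →ₗ[A] M} (hf : IsProjectiveCover f) :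
    IsEssentialEpi f :=
  ⟨hf.surjective, hf.superfluous⟩

section

variable {P M S : Type v} [AddCommGroup P] [Module A P] [AddCommGroup M] [Module A M]
  [AddCommGroup S] [Module A S]

theorem IsEssentialEpi.le_ker [IsSimpleModule A S] {g : M →ₗ[A] S} (hg : IsEssentialEpi g)
    {U : Submodule A M} (hU : U ≠ ⊤) : U ≤ LinearMap.ker g := by
  by_contra h
  have hc : IsCoatom (LinearMap.ker g) := LinearMap.isCoatom_ker_of_surjective hg.surjective
  exact hU (hg.superfluous U (hc.2 _ (lt_of_le_of_ne le_sup_right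
    (fun he => h (he ▸ le_sup_left)))))

theorem isEssentialEpi_of_forall_le_ker {g : M →ₗ[A] S} (hg : Function.Surjective g)
    (hS : Nontrivial S) (h : ∀ U : Submodule A M, U ≠ ⊤ → U ≤ LinearMap.ker g) :
    IsEssentialEpi g := by
  refine ⟨hg, fun U hU => ?_⟩
  by_contra hne
  rw [sup_eq_right.2 (h U hne), LinearMap.ker_eq_top] at hU
  obtain ⟨s, hs⟩ := exists_ne (0 : S)
  obtain ⟨m, rfl⟩ := hg s
  exact hs (by simp [hU])

theorem IsEssentialEpi.surjective_of_comp {g : M →ₗ[A] S} (hg : IsEssentialEpi g)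
    {h : P →ₗ[A] M} (hs : Function.Surjective (g ∘ₗ h)) : Function.Surjective h := by
  rw [← LinearMap.range_eq_top]
  apply hg.superfluous
  rw [eq_top_iff]
  intro m _
  obtain ⟨p, hp⟩ := hs (g m)
  have h1 : m = h p + (m - h p) := by abel
  rw [h1]
  refine Submodule.add_mem_sup ⟨p, rfl⟩ ?_
  rw [LinearMap.mem_ker, map_sub, ← hp]
  exact sub_self _

theorem IsEssentialEpi.exists_surjective_lift [Module.Projective A P] {g : M →ₗ[A] S}
    (hg : IsEssentialEpi g) {f : P →ₗ[A] S} (hf : Function.Surjective f) :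
    ∃ h : P →ₗ[A] M, g ∘ₗ h = f ∧ Function.Surjective h := by
  obtain ⟨h, hh⟩ := Module.projective_lifting_property g f hg.surjective
  exact ⟨h, hh, hg.surjective_of_comp (by rwa [hh])⟩

/-- The projection of a nonzero chain module onto its simple top is an essential epimorphism. -/
theorem IsChainModule.isEssentialEpi (h : IsChainModule A M) [IsSimpleModule A S] {g : M →ₗ[A] S}
    (hg : Function.Surjective g) : IsEssentialEpi g := by
  have hS : Nontrivial S := IsSimpleModule.nontrivial A S
  refine isEssentialEpi_of_forall_le_ker hg hS fun U hU => ?_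
  have hc : IsCoatom (LinearMap.ker g) := LinearMap.isCoatom_ker_of_surjective hg
  rcases h U (LinearMap.ker g) with h1 | h1
  · exact h1
  · rcases h1.lt_or_eq with h2 | h2
    · exact absurd (hc.2 _ h2) hU
    · exact h2.ge

theorem IsProjectiveCover.isIndecomposableModule [IsSimpleModule A S] {f : P →ₗ[A] S}
    (hf : IsProjectiveCover f) : IsIndecomposableModule A P := by
  have hS : Nontrivial S := IsSimpleModule.nontrivial A S
  refine ⟨hf.surjective.nontrivial, fun N K hNK => ?_⟩
  by_cases hN : N = ⊤
  · exact Or.inr (by simpa [hN] using hNK.disjoint)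
  · by_cases hK : K = ⊤
    · exact Or.inl (by simpa [hK] using hNK.disjoint)
    · exfalso
      have h1 := sup_le (hf.isEssentialEpi.le_ker hN) (hf.isEssentialEpi.le_ker hK)
      rw [hNK.sup_eq_top, top_le_iff, LinearMap.ker_eq_top] at h1
      obtain ⟨s, hs⟩ := exists_ne (0 : S)
      obtain ⟨m, rfl⟩ := hf.surjective s
      exact hs (by simp [h1])

end

/-- A projective module of minimal length mapping onto `S` is a cover. A proper `N` with `N ⊔ ker f
= ⊤` would, by Fitting's lemma, contain a smaller projective module still mapping onto `S`. -/
theorem exists_isProjectiveCover [IsArtinianRing A] (S : Type v) [AddCommGroup S] [Module A S]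
    [Module.Finite A S] :
    ∃ (P : Type v) (_ : AddCommGroup P) (_ : Module A P) (f : P →ₗ[A] S), IsProjectiveCover f := by
  classical
  have hex : ∃ n : ℕ, ∃ (P : Type v) (_ : AddCommGroup P) (_ : Module A P) (f : P →ₗ[A] S),
      Module.Finite A P ∧ Module.Projective A P ∧ Function.Surjective f ∧
        Module.length A P = n := by
    obtain ⟨m, f, hf⟩ := Module.Finite.exists_fin' A S
    have : Module.length A (Fin m → A) ≠ ⊤ := Module.length_ne_top
    exact ⟨_, _, _, _, f, inferInstance, inferInstance, hf, (ENat.natCast_toNat this).symm⟩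
  obtain ⟨P, _, _, f, h1, h2, h3, h4⟩ := Nat.find_spec hex
  refine ⟨P, _, _, f, h1, h2, h3, fun N hN => ?_⟩
  by_contra hne
  have hs : Function.Surjective (f ∘ₗ N.subtype) := by
    intro s
    obtain ⟨p, rfl⟩ := h3 s
    have hp : p ∈ N ⊔ LinearMap.ker f := hN ▸ Submodule.mem_top
    obtain ⟨a, ha, b, hb, rfl⟩ := Submodule.mem_sup.1 hp
    exact ⟨⟨a, ha⟩, by simp [LinearMap.mem_ker.1 hb]⟩
  obtain ⟨g, hg⟩ := Module.projective_lifting_property (f ∘ₗ N.subtype) f hs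
  -- `φ` has image in `N` and commutes with `f`. The image of a high power of `φ` is a direct
  -- summand of `P`, so it is projective.
  set φ : Module.End A P := N.subtype ∘ₗ g with hφ
  have hfφ : f ∘ₗ φ = f := by rw [hφ, ← LinearMap.comp_assoc, hg]
  have hfk : ∀ k, f ∘ₗ (φ ^ k) = f := by
    intro k
    induction k with
    | zero => rfl
    | succ k ih => rw [pow_succ, Module.End.mul_eq_comp, ← LinearMap.comp_assoc, ih, hfφ]
  obtain ⟨k, hk⟩ := exists_isCompl_ker_pow_range_pow φ
  set Q := LinearMap.range (φ ^ (k + 1)) with hQ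
  have hQN : Q ≤ N := by
    rintro _ ⟨x, rfl⟩
    rw [pow_succ', Module.End.mul_apply]
    exact (g _).2
  have hlt : Module.length A Q < Module.length A P :=
    Submodule.length_lt (fun h => hne (top_le_iff.1 (h ▸ hQN)))
  have hQl : Module.length A Q ≠ ⊤ := Module.length_ne_top
  have hle : Nat.find hex ≤ (Module.length A Q).toNat := by
    refine Nat.find_min' hex ⟨Q, _, _, f ∘ₗ Q.subtype, inferInstance, projective_of_isCompl hk.symm,
      fun s => ?_, (ENat.natCast_toNat hQl).symm⟩
    obtain ⟨p, rfl⟩ := h3 s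
    exact ⟨⟨(φ ^ (k + 1)) p, ⟨p, rfl⟩⟩, LinearMap.congr_fun (hfk (k + 1)) p⟩
  rw [h4, ← ENat.natCast_toNat hQl, Nat.cast_lt] at hlt
  lia

end ProjectiveCover

/-! ### Idempotents cutting out classes of simple modules -/

section Idempotent

variable {A : Type v} [Ring A] [IsArtinianRing A]

/-- Every isomorphism-invariant class `V` of simple modules is cut out by an idempotent, which
acts as the identity on the members of `V` and as zero on the other simple modules. -/
theorem exists_idempotent_of_simple_class (V : ModuleCat.{v} A → Prop)
    (hV : ∀ T T' : ModuleCat.{v} A, V T → Nonempty (T ≃ₗ[A] T') → V T') :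
    ∃ e : A, IsIdempotentElem e ∧ ∀ T : ModuleCat.{v} A, IsSimpleModule A T →
      (V T → ∀ t : T, e • t = t) ∧ (¬ V T → ∀ t : T, e • t = 0) := by
  obtain ⟨J, hJ⟩ : ∃ J, J = Ring.jacobson A := ⟨_, rfl⟩
  have hJ2 : J.IsTwoSided := hJ ▸ inferInstance
  have hss : IsSemisimpleModule A (A ⧸ J) :=
    (IsArtinian.isSemisimpleModule_iff_jacobson A (A ⧸ J)).2 (by
      rw [hJ]; exact Module.jacobson_quotient_jacobson A A)
  -- The part of the semisimple module `A ⧸ J` spanned by its simple submodules in `W`. The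
  -- component of `1` in `U V` acts as the identity on simples in `V` and as zero on the others.
  let U (W : ModuleCat.{v} A → Prop) : Submodule A (A ⧸ J) :=
    sSup {m | IsSimpleModule A m ∧ W (ModuleCat.of A m)}
  have hU : ∀ (W : ModuleCat.{v} A → Prop) (m : Submodule A (A ⧸ J)), IsSimpleModule A m →
      W (ModuleCat.of A m) → m ≤ U W := fun W m h1 h2 => le_sSup ⟨h1, h2⟩
  have htop : U V ⊔ U (fun T => ¬ V T) = ⊤ := by
    rw [eq_top_iff, ← IsSemisimpleModule.sSup_simples_eq_top A (A ⧸ J)]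
    refine sSup_le fun m hm => ?_
    by_cases h : V (ModuleCat.of A m)
    · exact (hU V m hm h).trans le_sup_left
    · exact (hU (fun T => ¬ V T) m hm h).trans le_sup_right
  have hmem : J.mkQ 1 ∈ U V ⊔ U (fun T => ¬ V T) := by rw [htop]; exact Submodule.mem_top
  obtain ⟨x, hx, y, hy, hxy⟩ := Submodule.mem_sup.1 hmem
  obtain ⟨a, rfl⟩ := J.mkQ_surjective x
  have hker : ∀ T : ModuleCat.{v} A, IsSimpleModule A T → ∀ W : ModuleCat.{v} A → Prop,
      (∀ T', W T' → ¬ Nonempty (T' ≃ₗ[A] T)) → ∀ h : (A ⧸ J) →ₗ[A] T, U W ≤ LinearMap.ker h := by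
    intro T hT W hW h
    refine sSup_le fun m hm => ?_
    obtain ⟨hm1, hm2⟩ := hm
    rcases LinearMap.bijective_or_eq_zero (h ∘ₗ m.subtype) with h1 | h1
    · exact absurd ⟨LinearEquiv.ofBijective _ h1⟩ (hW _ hm2)
    · intro z hz
      exact LinearMap.congr_fun h1 ⟨z, hz⟩
  have hact : ∀ T : ModuleCat.{v} A, IsSimpleModule A T →
      (V T → ∀ t : T, a • t = t) ∧ (¬ V T → ∀ t : T, a • t = 0) := by
    intro T hT
    have hJT : ∀ t : T, J ≤ LinearMap.ker (LinearMap.toSpanSingleton A T t) := fun t j hj => by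
      rw [LinearMap.mem_ker, LinearMap.toSpanSingleton_apply]
      exact Module.mem_annihilator.1 (IsSemisimpleModule.jacobson_le_annihilator A T (hJ ▸ hj)) t
    have hmk : ∀ (t : T) (b : A), J.liftQ (LinearMap.toSpanSingleton A T t) (hJT t)
        (J.mkQ b) = b • t := fun t b => rfl
    constructor
    · intro hVT t
      have h1 := hker T hT (fun T => ¬ V T)
        (fun T' h' ⟨e⟩ => h' (hV T T' hVT ⟨e.symm⟩)) (J.liftQ _ (hJT t)) hy
      have h2 := congrArg (J.liftQ _ (hJT t)) hxy
      rw [map_add, LinearMap.mem_ker.1 h1, add_zero, hmk, hmk, one_smul] at h2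
      exact h2
    · intro hVT t
      have h1 := hker T hT V (fun T' h' he => hVT (hV T' T h' he)) (J.liftQ _ (hJT t)) hx
      exact h1
  -- On every simple module `a` acts as `0` or as `1`, so `a * a - a` lies in every maximal left
  -- ideal. The resulting idempotent of `A ⧸ J` lifts because `J` is nilpotent.
  have hidem : IsIdempotentElem (Ideal.Quotient.mk J a) := by
    rw [IsIdempotentElem, ← map_mul, Ideal.Quotient.eq, hJ, Ring.jacobson_eq_sInf_isMaximal,
      Submodule.mem_sInf]
    intro I hI
    have hI' : IsSimpleModule A (A ⧸ I) := isSimpleModule_iff_isCoatom.2 (Ideal.isMaximal_def.1 hI)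
    have h0 : (a * a - a) • (Submodule.Quotient.mk 1 : A ⧸ I) = 0 := by
      obtain ⟨h1, h2⟩ := hact (ModuleCat.of A (A ⧸ I)) hI'
      by_cases hv : V (ModuleCat.of A (A ⧸ I))
      · rw [sub_smul, mul_smul, h1 hv (Submodule.Quotient.mk 1), h1 hv (Submodule.Quotient.mk 1),
          sub_self]
      · rw [sub_smul, mul_smul, h2 hv (Submodule.Quotient.mk 1), smul_zero, sub_zero]
    rw [← Submodule.Quotient.mk_smul, Submodule.Quotient.mk_eq_zero] at h0
    simpa using h0
  obtain ⟨n, hn⟩ := IsSemiprimaryRing.isNilpotent (R := A)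
  obtain ⟨e, he, hea⟩ := exists_isIdempotentElem_eq_of_ker_isNilpotent (Ideal.Quotient.mk J)
    (fun z hz => ⟨n, by
      have h1 := Ideal.pow_mem_pow (Ideal.Quotient.eq_zero_iff_mem.1 hz) n
      rw [hJ, hn] at h1
      exact h1⟩) _ ⟨a, rfl⟩ hidem
  refine ⟨e, he, fun T hT => ?_⟩
  have hsame : ∀ t : T, e • t = a • t := fun t => by
    rw [← sub_eq_zero, ← sub_smul]
    exact Module.mem_annihilator.1 (IsSemisimpleModule.jacobson_le_annihilator A T
      (hJ ▸ Ideal.Quotient.eq.1 hea)) t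
  simpa only [hsame] using hact T hT

end Idempotent

/-! ### Finiteness of the set of simple modules -/

section SimpleClasses

variable {A : Type v} [Ring A]

/-- The isomorphism class of a module. -/
abbrev isoClass (T : ModuleCat.{v} A) : Quotient (isIsomorphicSetoid (ModuleCat.{v} A)) :=
  Quotient.mk _ T

theorem isoClass_eq_iff {T T' : ModuleCat.{v} A} :
    isoClass T = isoClass T' ↔ Nonempty (T ≃ₗ[A] T') := by
  rw [Quotient.eq]
  exact ⟨fun ⟨i⟩ => ⟨i.toLinearEquiv⟩, fun ⟨i⟩ => ⟨i.toModuleIso⟩⟩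

/-- Induction on length bounds the simples that are quotients of submodules of `M`: a nonzero `U →
T` is either nonzero on `U ⊓ N`, or it identifies `T` with the simple module `M ⧸ N`. For `M = A`
all simples occur. -/
theorem finite_simpleClasses [IsArtinianRing A] : (simpleClasses A).Finite := by
  have key : ∀ (M : Type v) [AddCommGroup M] [Module A M], IsFiniteLength A M →
      {c | ∃ T : ModuleCat.{v} A, (IsSimpleModule A T ∧ ∃ (U : Submodule A M) (f : U →ₗ[A] T),
        f ≠ 0) ∧ isoClass T = c}.Finite := by
    intro M _ _ h
    induction h with
    | of_subsingleton =>
      refine Set.Finite.subset Set.finite_empty ?_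
      rintro c ⟨T, ⟨-, U, f, hf⟩, -⟩
      exact hf (Subsingleton.elim _ _)
    | @of_simple_quotient M _ _ N hN _ ih =>
      refine (ih.insert (isoClass (ModuleCat.of A (M ⧸ N)))).subset ?_
      rintro c ⟨T, ⟨hT, U, f, hf⟩, rfl⟩
      by_cases h0 : f ∘ₗ (N.subtype.restrict (p := N.comap N.subtype ⊓ U.comap N.subtype) (q := U)
          (fun x hx => hx.2)) = 0
      · left
        have hle : LinearMap.ker (N.mkQ ∘ₗ U.subtype) ≤ LinearMap.ker f := by
          intro x hx
          have hx' : (x : M) ∈ N := by simpa using hx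
          exact LinearMap.congr_fun h0 ⟨⟨x, hx'⟩, hx', x.2⟩
        have hs := LinearMap.surjective_of_ne_zero hf
        have hne : N.mkQ ∘ₗ U.subtype ≠ 0 := by
          intro h1
          rw [h1, LinearMap.ker_zero, top_le_iff, LinearMap.ker_eq_top] at hle
          exact hf hle
        have hs' := LinearMap.surjective_of_ne_zero hne
        have hk : LinearMap.ker (N.mkQ ∘ₗ U.subtype) = LinearMap.ker f := by
          have hc := LinearMap.isCoatom_ker_of_surjective hs'
          rcases hle.lt_or_eq with h1 | h1
          · exact absurd (LinearMap.ker_eq_top.1 (hc.2 _ h1)) hf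
          · exact h1
        rw [isoClass_eq_iff]
        exact ⟨((LinearMap.quotKerEquivOfSurjective f hs).symm.trans
          (Submodule.quotEquivOfEq _ _ hk.symm)).trans
            (LinearMap.quotKerEquivOfSurjective _ hs')⟩
      · exact Or.inr ⟨T, ⟨hT, _, _, h0⟩, rfl⟩
  have hA : IsFiniteLength A A := isFiniteLength_iff_isNoetherian_isArtinian.2
    ⟨inferInstance, inferInstance⟩
  refine (key A hA).subset ?_
  rintro c ⟨T, hT, rfl⟩
  have := IsSimpleModule.nontrivial A T
  obtain ⟨t, ht⟩ := exists_ne (0 : T)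
  refine ⟨T, ⟨hT, ⊤, LinearMap.toSpanSingleton A T t ∘ₗ (⊤ : Submodule A A).subtype, fun h => ?_⟩, rfl⟩
  exact ht (by simpa using LinearMap.congr_fun h ⟨1, Submodule.mem_top⟩)

end SimpleClasses

/-! ### Finitely generated injective hulls of simple modules -/

section Hull

/-- The submodule `T` is essential and contained in every nonzero submodule. -/
def IsLeastNonzero {A : Type v} [Ring A] {M : Type v} [AddCommGroup M] [Module A M]
    (T : Submodule A M) : Prop :=
  IsSimpleModule A T ∧ ∀ U : Submodule A M, U ≠ ⊥ → T ≤ U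

variable {A : Type v} [Ring A]

theorem exists_maximal_disjoint {M : Type v} [AddCommGroup M] [Module A M]
    (E : Submodule A M) :
    ∃ N : Submodule A M, Disjoint N E ∧ ∀ K, N < K → ∃ x ∈ K, x ∈ E ∧ x ≠ 0 := by
  obtain ⟨N, -, hN⟩ := zorn_le_nonempty₀ {N : Submodule A M | Disjoint N E} (by
    intro c hc hch y hy
    refine ⟨sSup c, ?_, fun z hz => le_sSup hz⟩
    rw [Set.mem_ofPred_eq, Submodule.disjoint_def]
    intro x hx hxE
    obtain ⟨N, hN, hxN⟩ := (Submodule.mem_sSup_of_directed ⟨y, hy⟩ hch.directedOn).1 hx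
    exact Submodule.disjoint_def.1 (hc hN) x hxN hxE) ⊥ disjoint_bot_left
  refine ⟨N, hN.1, fun K hK => ?_⟩
  by_contra! h
  exact hK.not_ge (hN.2 (Submodule.disjoint_def.2 h) hK.le)

/-- A maximal essential extension `E` of `T` inside the injective `J` is a direct summand. With `N`
maximal disjoint from `E`, the inclusion of `E` extends along `E → J ⧸ N` to a map `J ⧸ N → J`. Its
image is again essential over `T`, so it equals `E`. -/
theorem exists_injective_essential {J : Type v} [AddCommGroup J] [Module A J]
    (hJ : Module.Injective A J) (T : Submodule A J) [IsSimpleModule A T] :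
    ∃ E : Submodule A J, Module.Injective A E ∧ IsLeastNonzero (T.comap E.subtype) ∧ T ≤ E := by
  obtain ⟨E, hTE, hE⟩ := zorn_le_nonempty₀
    {U : Submodule A J | T ≤ U ∧ ∀ x ∈ U, x ≠ 0 → T ≤ A ∙ x} (by
      intro c hc hch y hy
      refine ⟨sSup c, ⟨(hc hy).1.trans (le_sSup hy), fun x hx hx0 => ?_⟩, fun z hz => le_sSup hz⟩
      obtain ⟨U, hU, hxU⟩ := (Submodule.mem_sSup_of_directed ⟨y, hy⟩ hch.directedOn).1 hx
      exact (hc hU).2 x hxU hx0) T ⟨le_rfl, fun x hx hx0 => by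
        have h1 : IsAtom T := isSimpleModule_iff_isAtom.1 inferInstance
        have h2 : A ∙ x ≤ T := (Submodule.span_singleton_le_iff_mem x T).2 hx
        rcases h2.lt_or_eq with h3 | h3
        · exact absurd (Submodule.span_singleton_eq_bot.1 (h1.2 _ h3)) hx0
        · exact h3.ge⟩
  obtain ⟨N, hNE, hN⟩ := exists_maximal_disjoint E
  have hinj : Function.Injective (N.mkQ ∘ₗ E.subtype) := by
    rw [injective_iff_map_eq_zero]
    intro x hx
    have hx' : (x : J) ∈ N := by simpa using hx
    exact Subtype.ext (Submodule.disjoint_def.1 hNE x hx' x.2)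
  obtain ⟨g, hg⟩ := hJ.out (N.mkQ ∘ₗ E.subtype) hinj E.subtype
  have hgE : ∀ x (hx : x ∈ E), g (N.mkQ x) = x := fun x hx => hg ⟨x, hx⟩
  have hrange : LinearMap.range g = E := by
    have hle : E ≤ LinearMap.range g := fun x hx => ⟨_, hgE x hx⟩
    refine le_antisymm (hE.2 ⟨hTE.trans hle, ?_⟩ hle) hle
    rintro _ ⟨q, rfl⟩ hq
    obtain ⟨y, rfl⟩ := N.mkQ_surjective q
    have hlt : N < N ⊔ A ∙ y := by
      refine lt_of_le_of_ne le_sup_left fun h => hq ?_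
      have : y ∈ N := h ▸ Submodule.mem_sup_right (Submodule.mem_span_singleton_self y)
      simp [(Submodule.Quotient.mk_eq_zero N).2 this]
    obtain ⟨x, hx, hxE, hx0⟩ := hN _ hlt
    obtain ⟨n, hn, z, hz, rfl⟩ := Submodule.mem_sup.1 hx
    obtain ⟨a, rfl⟩ := Submodule.mem_span_singleton.1 hz
    refine (hE.1.2 _ hxE hx0).trans ?_
    rw [Submodule.span_singleton_le_iff_mem, Submodule.mem_span_singleton]
    refine ⟨a, ?_⟩
    rw [← map_smul, ← map_smul, ← hgE _ hxE, map_add, map_add]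
    simp [(Submodule.Quotient.mk_eq_zero N).2 hn]
  refine ⟨E, injective_of_retract hJ E.subtype
    ((g ∘ₗ N.mkQ).codRestrict E fun x => hrange ▸ ⟨_, rfl⟩) ?_, ⟨?_, ?_⟩, hTE⟩
  · ext x
    exact hgE x x.2
  · exact IsSimpleModule.congr (Submodule.comapSubtypeEquivOfLe hTE)
  · intro U hU x hx
    obtain ⟨y, hy, hy0⟩ := (Submodule.ne_bot_iff U).1 hU
    have h1 := hE.1.2 y y.2 (fun h => hy0 (Subtype.ext h)) hx
    obtain ⟨a, ha⟩ := Submodule.mem_span_singleton.1 h1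
    have : x = a • y := Subtype.ext ha.symm
    exact this ▸ U.smul_mem a hy

/-- `Hom_A(M, E)` is noetherian over `R` by induction on the length of `M`, and `M = A` gives `E`.
For simple `M`, evaluation at a nonzero element embeds this module in the simple submodule `T`,
which is finite over `R`. -/
theorem finite_of_isLeastNonzero {R : Type u} [CommRing R] [IsArtinianRing R] [Algebra R A]
    [Module.Finite R A] {E : Type v} [AddCommGroup E] [Module A E] {T : Submodule A E}
    (hT : IsLeastNonzero T) : Module.Finite A E := by
  let : Module R E := Module.compHom E (algebraMap R A)
  have : IsScalarTower R A E := ⟨fun r a x => by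
    rw [Algebra.smul_def, mul_smul]; rfl⟩
  have : SMulCommClass A R E := ⟨fun a r x => by
    change a • (algebraMap R A r • x) = algebraMap R A r • (a • x)
    rw [← mul_smul, ← mul_smul, Algebra.commutes]⟩
  have : IsArtinianRing A := IsArtinianRing.of_finite R A
  have := hT.1
  have hTA : Module.Finite A T := inferInstance
  have hTR : Module.Finite R T := Module.Finite.trans A T
  have key : ∀ (M : Type v) [AddCommGroup M] [Module A M], IsFiniteLength A M →
      IsNoetherian R (M →ₗ[A] E) := by
    intro M _ _ h
    induction h with
    | of_subsingleton => infer_instance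
    | @of_simple_quotient M _ _ N hN _ ih =>
      have h1 : IsNoetherian R ((M ⧸ N) →ₗ[A] E) := by
        have := IsSimpleModule.nontrivial A (M ⧸ N)
        obtain ⟨q, hq⟩ := exists_ne (0 : M ⧸ N)
        have hmem : ∀ f : (M ⧸ N) →ₗ[A] E, f q ∈ T := by
          intro f
          rcases LinearMap.injective_or_eq_zero f with hf | rfl
          · have hne : LinearMap.range f ≠ ⊥ := by
              rw [Ne, LinearMap.range_eq_bot]
              rintro rfl
              exact hq (hf (by simp))
            have h2 : IsAtom (LinearMap.range f) := by
              rw [← isSimpleModule_iff_isAtom]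
              exact IsSimpleModule.congr (LinearEquiv.ofInjective f hf).symm
            have h3 := hT.2 _ hne
            rcases h3.lt_or_eq with h4 | h4
            · exact absurd (h2.2 _ h4) (isSimpleModule_iff_isAtom.1 hT.1).1
            · exact h4 ▸ ⟨q, rfl⟩
          · simp
        let ev : ((M ⧸ N) →ₗ[A] E) →ₗ[R] T :=
          { toFun := fun f => ⟨f q, hmem f⟩
            map_add' := fun _ _ => rfl
            map_smul' := fun _ _ => rfl }
        refine isNoetherian_of_injective ev ?_
        rw [injective_iff_map_eq_zero]
        intro f hf
        have hf' : f q = 0 := congrArg Subtype.val hf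
        rcases LinearMap.injective_or_eq_zero f with h | h
        · exact absurd (h (hf'.trans (map_zero f).symm)) hq
        · exact h
      let F : ((M ⧸ N) →ₗ[A] E) →ₗ[R] (M →ₗ[A] E) :=
        { toFun := fun f => f ∘ₗ N.mkQ, map_add' := fun _ _ => rfl, map_smul' := fun _ _ => rfl }
      let G : (M →ₗ[A] E) →ₗ[R] (N →ₗ[A] E) :=
        { toFun := fun f => f ∘ₗ N.subtype, map_add' := fun _ _ => rfl, map_smul' := fun _ _ => rfl }
      refine isNoetherian_of_range_eq_ker F G ?_
      ext f
      constructor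
      · rintro ⟨g, rfl⟩
        ext x
        change g (N.mkQ x) = 0
        rw [Submodule.mkQ_apply, (Submodule.Quotient.mk_eq_zero N).2 x.2, map_zero]
      · intro hf
        refine ⟨N.liftQ f fun x hx => LinearMap.congr_fun (show f ∘ₗ N.subtype = 0 from hf) ⟨x, hx⟩, ?_⟩
        ext x
        rfl
  have h := key A (isFiniteLength_iff_isNoetherian_isArtinian.2 ⟨inferInstance, inferInstance⟩)
  let ev : (A →ₗ[A] E) →ₗ[R] E :=
    { toFun := fun f => f 1, map_add' := fun _ _ => rfl, map_smul' := fun _ _ => rfl }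
  have h2 : Module.Finite R E := Module.Finite.of_surjective ev fun x =>
    ⟨LinearMap.toSpanSingleton A E x, by simp [ev]⟩
  exact Module.Finite.of_restrictScalars_finite R A E

theorem exists_injective_hull (R : Type u) [CommRing R] [IsArtinianRing R] [Algebra R A]
    [Module.Finite R A] (T : Type v) [AddCommGroup T] [Module A T] [IsSimpleModule A T] :
    ∃ (I : Type v) (_ : AddCommGroup I) (_ : Module A I) (i : T →ₗ[A] I), Module.Finite A I ∧
      Module.Injective A I ∧ Function.Injective i ∧ IsLeastNonzero (LinearMap.range i) := by
  let J := Injective.under (ModuleCat.of A T)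
  have hJ : Module.Injective A J := (Module.injective_iff_injective_object A J).2
    (Injective.injective_under (ModuleCat.of A T))
  let ι : T →ₗ[A] J := (Injective.ι (ModuleCat.of A T)).hom
  have hι : Function.Injective ι := (ModuleCat.mono_iff_injective _).1 inferInstance
  have : IsSimpleModule A (LinearMap.range ι) :=
    IsSimpleModule.congr (LinearEquiv.ofInjective ι hι).symm
  obtain ⟨E, h1, h2, h3⟩ := exists_injective_essential hJ (LinearMap.range ι)
  have hr : LinearMap.range (ι.codRestrict E fun x => h3 ⟨x, rfl⟩) =
      (LinearMap.range ι).comap E.subtype := LinearMap.range_codRestrict _ _ _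
  refine ⟨E, inferInstance, inferInstance, ι.codRestrict E fun x => h3 ⟨x, rfl⟩,
    finite_of_isLeastNonzero (R := R) h2, h1, fun x y hxy => hι (congrArg Subtype.val hxy), ?_⟩
  rw [hr]
  exact h2

variable {M N : Type v} [AddCommGroup M] [Module A M] [AddCommGroup N] [Module A N]

theorem IsLeastNonzero.injective_of_ne_zero {T : Submodule A M} (hT : IsLeastNonzero T)
    {f : M →ₗ[A] N} (hf : f ∘ₗ T.subtype ≠ 0) : Function.Injective f := by
  rw [← LinearMap.ker_eq_bot]
  by_contra h
  apply hf
  ext x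
  exact hT.2 _ h x.2

theorem IsChainModule.isLeastNonzero (h : IsChainModule A M) {T : Submodule A M}
    (hT : IsSimpleModule A T) : IsLeastNonzero T := by
  refine ⟨hT, fun U hU => ?_⟩
  rcases h T U with h1 | h1
  · exact h1
  · rcases h1.lt_or_eq with h2 | h2
    · exact absurd ((isSimpleModule_iff_isAtom.1 hT).2 _ h2) hU
    · exact h2.ge

/-- A module with a least nonzero submodule is indecomposable. -/
theorem IsLeastNonzero.isIndecomposableModule {T : Submodule A M} (hT : IsLeastNonzero T) :
    IsIndecomposableModule A M := by
  have h1 := (isSimpleModule_iff_isAtom.1 hT.1).1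
  obtain ⟨x, hx, hx0⟩ := (Submodule.ne_bot_iff T).1 h1
  refine ⟨⟨x, 0, hx0⟩, fun N K hNK => ?_⟩
  by_contra! h
  exact h1 (eq_bot_iff.2 (hNK.disjoint (hT.2 _ h.1) (hT.2 _ h.2)))

end Hull

theorem ExtZero.of_injective {A : Type v} [Ring A] {M I : Type v} [AddCommGroup M] [Module A M]
    [AddCommGroup I] [Module A I] (hI : Module.Injective A I) {n : ℕ} :
    ExtZero A M I (n + 1) := by
  have : Injective (ModuleCat.of A I) := (Module.injective_iff_injective_object A I).1 hI
  exact ⟨fun x y => (Abelian.Ext.eq_zero_of_injective x).trans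
    (Abelian.Ext.eq_zero_of_injective y).symm⟩

/-! ### At most one arrow into and out of each simple module -/

section Nakayama

variable {R : Type u} [CommRing R] [IsArtinianRing R] {A : Type v} [Ring A] [Algebra R A]
  (hA : IsConnectedNakayama R A)

include hA

theorem IsConnectedNakayama.isArtinianRing : IsArtinianRing A :=
  have := hA.finite
  IsArtinianRing.of_finite R A

variable {P S M T T' : Type v} [AddCommGroup P] [Module A P] [AddCommGroup S] [Module A S]
  [AddCommGroup M] [Module A M] [AddCommGroup T] [Module A T] [AddCommGroup T'] [Module A T']

theorem IsConnectedNakayama.isChainModule_of_cover [IsSimpleModule A S] {f : P →ₗ[A] S}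
    (hf : IsProjectiveCover f) : IsChainModule A P := by
  have := hA.isArtinianRing
  have := hf.finite
  exact (hA.projective_uniserial (ModuleCat.of A P) hf.finite hf.projective
    hf.isIndecomposableModule).isChainModule

/-- Such an `M` embeds into the injective hull of `T`, which is indecomposable and hence uniserial.
-/
theorem IsConnectedNakayama.isChainModule_of_isLeastNonzero [Module.Finite A M]
    {T : Submodule A M} (hT : IsLeastNonzero T) : IsChainModule A M := by
  have := hA.isArtinianRing
  have := hA.finite
  have := hT.1
  obtain ⟨I, _, _, i, h1, h2, h3, h4⟩ := exists_injective_hull (A := A) R T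
  have hc : IsChainModule A I := (hA.injective_uniserial (ModuleCat.of A I) h1 h2
    h4.isIndecomposableModule).isChainModule
  obtain ⟨g, hg⟩ := h2.out T.subtype T.injective_subtype i
  refine hc.of_injective g (hT.injective_of_ne_zero fun h0 => ?_)
  have := IsSimpleModule.nontrivial A T
  obtain ⟨t, ht⟩ := exists_ne (0 : T)
  have h5 : i t = 0 := (hg t).symm.trans (LinearMap.congr_fun h0 t)
  exact ht (h3 (by rw [h5, map_zero]))

/-- With `I` the injective hull of `S`, a nonzero `Ext¹(T, S)` yields a nonzero map `T → I/S`. The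
submodules of `I/S` form a chain, so it has only one simple submodule. -/
theorem IsConnectedNakayama.source_unique [IsSimpleModule A S] [IsSimpleModule A T]
    [IsSimpleModule A T'] (h : ¬ ExtZero A T S 1) (h' : ¬ ExtZero A T' S 1) :
    Nonempty (T ≃ₗ[A] T') := by
  have := hA.isArtinianRing
  have := hA.finite
  obtain ⟨I, _, _, i, h1, h2, h3, h4⟩ := exists_injective_hull (A := A) R S
  have hc : IsChainModule A (I ⧸ LinearMap.range i) :=
    (hA.isChainModule_of_isLeastNonzero h4).of_surjective _ (Submodule.mkQ_surjective _)
  have key : ∀ (X : Type v) [AddCommGroup X] [Module A X], ¬ ExtZero A X S 1 →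
      ∃ f : X →ₗ[A] I ⧸ LinearMap.range i, f ≠ 0 := by
    intro X _ _ hX
    by_contra! h0
    exact hX (ExtZero.cov_left h3 (Submodule.mkQ_surjective _) (LinearMap.exact_map_mkQ_range i)
      (extZero_zero_iff.2 h0) (ExtZero.of_injective h2))
  obtain ⟨f, hf⟩ := key T h
  obtain ⟨f', hf'⟩ := key T' h'
  have hi := LinearMap.injective_of_ne_zero hf
  have hi' := LinearMap.injective_of_ne_zero hf'
  have hs : IsSimpleModule A (LinearMap.range f) :=
    IsSimpleModule.congr (LinearEquiv.ofInjective f hi).symm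
  have hs' : IsSimpleModule A (LinearMap.range f') :=
    IsSimpleModule.congr (LinearEquiv.ofInjective f' hi').symm
  have heq : LinearMap.range f = LinearMap.range f' :=
    le_antisymm ((hc.isLeastNonzero hs).2 _ (isSimpleModule_iff_isAtom.1 hs').1)
      ((hc.isLeastNonzero hs').2 _ (isSimpleModule_iff_isAtom.1 hs).1)
  exact ⟨(LinearEquiv.ofInjective f hi).trans ((LinearEquiv.ofEq _ _ heq).trans
    (LinearEquiv.ofInjective f' hi').symm)⟩

omit hA [IsArtinianRing R] in
theorem IsChainModule.simple_quotient_unique (hM : IsChainModule A M) [IsSimpleModule A T]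
    [IsSimpleModule A T'] {f : M →ₗ[A] T} {f' : M →ₗ[A] T'} (hf : f ≠ 0) (hf' : f' ≠ 0) :
    Nonempty (T ≃ₗ[A] T') := by
  have hs := LinearMap.surjective_of_ne_zero hf
  have hs' := LinearMap.surjective_of_ne_zero hf'
  have hk := LinearMap.isCoatom_ker_of_surjective hs
  have hk' := LinearMap.isCoatom_ker_of_surjective hs'
  have heq : LinearMap.ker f = LinearMap.ker f' := by
    rcases hM (LinearMap.ker f) (LinearMap.ker f') with h | h
    · exact h.lt_or_eq.resolve_left fun h1 => hk'.1 (hk.2 _ h1)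
    · exact (h.lt_or_eq.resolve_left fun h1 => hk.1 (hk'.2 _ h1)).symm
  exact ⟨(LinearMap.quotKerEquivOfSurjective f hs).symm.trans
    ((Submodule.quotEquivOfEq _ _ heq).trans (LinearMap.quotKerEquivOfSurjective f' hs'))⟩

omit hA [IsArtinianRing R] in
/-- In a chain module, a composition factor has a nontrivial extension by the top of the submodule
below it. -/
theorem IsChainModule.not_extZero_of_covBy (hM : IsChainModule A M) {U U' : Submodule A M}
    (hcov : U ⋖ U') [IsSimpleModule A T] {g : U →ₗ[A] T} (hg : g ≠ 0) :
    ¬ ExtZero A (U' ⧸ U.comap U'.subtype) T 1 := by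
  intro h0
  have hex : Function.Exact (Submodule.inclusion hcov.le) (U.comap U'.subtype).mkQ := by
    rw [LinearMap.exact_iff, Submodule.ker_mkQ, Submodule.range_inclusion]
  obtain ⟨q, hq⟩ := ExtZero.exists_extend (Submodule.inclusion_injective hcov.le)
    (Submodule.mkQ_surjective _) hex h0 g
  have hq0 : q ≠ 0 := by
    rintro rfl
    exact hg hq.symm
  have hk := LinearMap.isCoatom_ker_of_surjective (LinearMap.surjective_of_ne_zero hq0)
  have hk' : IsCoatom (U.comap U'.subtype) :=
    isSimpleModule_iff_isCoatom.1 ((covBy_iff_quot_is_simple hcov.le).1 hcov)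
  -- The kernel of the extension `q` and `U` are both maximal in `U'`, whose submodules form a
  -- chain. They agree, so `q` kills `U`.
  have hle : U.comap U'.subtype ≤ LinearMap.ker q := by
    rcases (hM.of_injective _ U'.injective_subtype) (LinearMap.ker q) (U.comap U'.subtype) with h | h
    · exact (h.lt_or_eq.resolve_left fun h1 => hk'.1 (hk.2 _ h1)).ge
    · exact h
  apply hg
  rw [← hq]
  ext x
  exact hle (show ((Submodule.inclusion hcov.le x : U') : M) ∈ U from x.2)

omit hA [IsArtinianRing R] in
theorem exists_ne_zero_of_not_extZero [Module.Projective A P] {f : P →ₗ[A] S}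
    (hf : Function.Surjective f) (h : ¬ ExtZero A S T 1) :
    ∃ g : LinearMap.ker f →ₗ[A] T, g ≠ 0 := by
  by_contra! h0
  exact h (ExtZero.of_exists_extend (Submodule.injective_subtype _) hf
    (LinearMap.exact_subtype_ker_map f) inferInstance fun p => ⟨0, by simp [h0 p]⟩)

/-- A nonzero `Ext¹(S, T)` yields a nonzero map to `T` from the radical of the projective cover of
`S`, which has only one simple quotient. -/
theorem IsConnectedNakayama.target_unique [IsSimpleModule A S] [IsSimpleModule A T]
    [IsSimpleModule A T'] (h : ¬ ExtZero A S T 1) (h' : ¬ ExtZero A S T' 1) :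
    Nonempty (T ≃ₗ[A] T') := by
  have := hA.isArtinianRing
  obtain ⟨P, _, _, f, hf⟩ := exists_isProjectiveCover (A := A) S
  have := hf.projective
  obtain ⟨g, hg⟩ := exists_ne_zero_of_not_extZero hf.surjective h
  obtain ⟨g', hg'⟩ := exists_ne_zero_of_not_extZero hf.surjective h'
  exact ((hA.isChainModule_of_cover hf).of_injective _
    (LinearMap.ker f).injective_subtype).simple_quotient_unique hg hg'

end Nakayama

/-! ### Connectedness of the quiver -/

section Block

variable {R : Type u} [CommRing R] [IsArtinianRing R] {A : Type v} [Ring A] [Algebra R A]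
  (hA : IsConnectedNakayama R A)

include hA

/-- Let `N` be generated by `f P`. It is proper, as `f` kills the top of `P`. If it were nonzero,
its simple quotients would lie outside `W`, whereas the composition factor just above `N` is killed
by `f` and lies in `W`. Consecutive factors of a chain module have nonzero `Ext¹`, against the
closure of `W`. -/
theorem IsConnectedNakayama.idempotent_smul_cover_eq_zero {f : A} (hf : IsIdempotentElem f)
    (W : ModuleCat.{v} A → Prop)
    (hfW : ∀ T : ModuleCat.{v} A, IsSimpleModule A T →
      (W T → ∀ t : T, f • t = 0) ∧ (¬ W T → ∀ t : T, f • t = t))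
    (hext : ∀ T T' : ModuleCat.{v} A, IsSimpleModule A T → IsSimpleModule A T' →
      ¬ ExtZero A T T' 1 → (W T ↔ W T'))
    {P S : Type v} [AddCommGroup P] [Module A P] [AddCommGroup S] [Module A S]
    [IsSimpleModule A S] {π : P →ₗ[A] S} (hπ : IsProjectiveCover π)
    (hS : W (ModuleCat.of A S)) (p : P) : f • p = 0 := by
  have := hA.isArtinianRing
  have := hπ.finite
  have hc := hA.isChainModule_of_cover hπ
  set N : Submodule A P := Submodule.span A (Set.range fun p : P => f • p) with hN
  have hmem : ∀ p : P, f • p ∈ N := fun p => Submodule.subset_span ⟨p, rfl⟩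
  suffices N = ⊥ by
    have h1 := hmem p
    rwa [this, Submodule.mem_bot] at h1
  by_contra hbot
  have hNtop : N ≠ ⊤ := by
    intro htop
    have h1 : N ≤ LinearMap.ker π := by
      rw [hN, Submodule.span_le]
      rintro _ ⟨p, rfl⟩
      rw [SetLike.mem_coe, LinearMap.mem_ker, map_smul]
      exact (hfW (ModuleCat.of A S) inferInstance).1 hS (π p)
    rw [htop, top_le_iff, LinearMap.ker_eq_top] at h1
    have := IsSimpleModule.nontrivial A S
    obtain ⟨s, hs⟩ := exists_ne (0 : S)
    obtain ⟨p, rfl⟩ := hπ.surjective s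
    exact hs (by simp [h1])
  have : Nontrivial N := Submodule.nontrivial_iff_ne_bot.2 hbot
  obtain ⟨K, -, hK⟩ := exists_le_isSimpleModule_quotient (bot_ne_top : (⊥ : Submodule A N) ≠ ⊤)
  obtain ⟨N', hcov, -⟩ := exists_covBy_le_of_lt (lt_top_iff_ne_top.2 hNtop)
  have hT'' : IsSimpleModule A (N' ⧸ N.comap N'.subtype) :=
    (covBy_iff_quot_is_simple hcov.le).1 hcov
  have hWT : ¬ W (ModuleCat.of A (N ⧸ K)) := by
    intro hw
    have h1 := (hfW _ hK).1 hw
    have h2 : Submodule.map N.subtype K = N := by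
      refine le_antisymm (Submodule.map_subtype_le N K) ?_
      conv_lhs => rw [hN]
      rw [Submodule.span_le]
      rintro _ ⟨p, rfl⟩
      have h3 := h1 (Submodule.Quotient.mk (⟨f • p, hmem p⟩ : N))
      rw [← Submodule.Quotient.mk_smul, Submodule.Quotient.mk_eq_zero] at h3
      refine ⟨_, h3, ?_⟩
      change f • f • p = f • p
      rw [← mul_smul, hf.eq]
    have h3 : K = ⊤ := by
      rw [eq_top_iff]
      intro x _
      have hx : (x : P) ∈ Submodule.map N.subtype K := h2.symm ▸ x.2
      obtain ⟨y, hy, hyx⟩ := hx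
      rwa [← Subtype.ext hyx]
    exact (isSimpleModule_iff_isCoatom.1 hK).1 h3
  have hWT' : W (ModuleCat.of A (N' ⧸ N.comap N'.subtype)) := by
    by_contra hw
    have h1 := (hfW _ hT'').2 hw
    have := IsSimpleModule.nontrivial A (N' ⧸ N.comap N'.subtype)
    obtain ⟨q, hq⟩ := exists_ne (0 : N' ⧸ N.comap N'.subtype)
    obtain ⟨x, rfl⟩ := Submodule.Quotient.mk_surjective _ q
    apply hq
    have h2 := h1 (Submodule.Quotient.mk x)
    rw [← h2, ← Submodule.Quotient.mk_smul, Submodule.Quotient.mk_eq_zero]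
    exact hmem (x : P)
  refine hWT ((hext _ _ hT'' hK (hc.not_extZero_of_covBy hcov (g := K.mkQ) fun h1 => ?_)).1 hWT')
  have h2 := K.ker_mkQ
  rw [h1, LinearMap.ker_zero] at h2
  exact (isSimpleModule_iff_isCoatom.1 hK).1 h2.symm

omit hA in
/-- The elements of `A` all of whose left multiples are annihilated by `f`. -/
def leftAnnihilatingIdeal (f : A) : TwoSidedIdeal A :=
  TwoSidedIdeal.mk' {a | ∀ b, f * (b * a) = 0} (by simp)
    (fun {x y} hx hy b => by rw [mul_add, mul_add, hx b, hy b, add_zero])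
    (fun {x} hx b => by rw [mul_neg, mul_neg, hx b, neg_zero])
    (fun {x y} hy b => by rw [← mul_assoc b]; exact hy (b * x))
    (fun {x y} hx b => by rw [← mul_assoc b, ← mul_assoc f, hx b, zero_mul])

omit hA in
theorem mem_leftAnnihilatingIdeal {f a : A} :
    a ∈ leftAnnihilatingIdeal f ↔ ∀ b, f * (b * a) = 0 := by
  rw [leftAnnihilatingIdeal, TwoSidedIdeal.mem_mk']
  rfl

/-- A class of simple modules that is closed under neighbours in the quiver of a connected algebra
is empty or contains all simple modules. -/
theorem IsConnectedNakayama.all_or_none (V : ModuleCat.{v} A → Prop)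
    (hV : ∀ T T' : ModuleCat.{v} A, V T → Nonempty (T ≃ₗ[A] T') → V T')
    (hext : ∀ T T' : ModuleCat.{v} A, IsSimpleModule A T → IsSimpleModule A T' →
      ¬ ExtZero A T T' 1 → (V T ↔ V T')) :
    (∀ T : ModuleCat.{v} A, IsSimpleModule A T → V T) ∨
      ∀ T : ModuleCat.{v} A, IsSimpleModule A T → ¬ V T := by
  have := hA.isArtinianRing
  obtain ⟨e, he, heV⟩ := exists_idempotent_of_simple_class V hV
  have key : ∀ (S : ModuleCat.{v} A), IsSimpleModule A S → ∀ π : A →ₗ[A] S,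
      (∀ a ∈ leftAnnihilatingIdeal (1 - e), π a = 0) → (∀ a ∈ leftAnnihilatingIdeal e, π a = 0) →
      π = 0 := by
    intro S hS π h1 h2
    by_contra hπ
    have hs := LinearMap.surjective_of_ne_zero hπ
    obtain ⟨P, _, _, g, hg⟩ := exists_isProjectiveCover (A := A) S
    have := hg.projective
    obtain ⟨h, hh⟩ := Module.projective_lifting_property π g hs
    have hg0 : ∀ f : A, (∀ p : P, f • p = 0) → (∀ a ∈ leftAnnihilatingIdeal f, π a = 0) →
        False := by
      intro f hf hfa
      have : g = 0 := by
        ext p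
        rw [← hh, LinearMap.comp_apply]
        refine hfa _ (mem_leftAnnihilatingIdeal.2 fun b => ?_)
        rw [← smul_eq_mul, ← smul_eq_mul, ← map_smul, ← map_smul, hf, map_zero]
      have := IsSimpleModule.nontrivial A S
      obtain ⟨s, hs⟩ := exists_ne (0 : S)
      obtain ⟨p, rfl⟩ := hg.surjective s
      exact hs (by simp [‹g = 0›])
    by_cases hv : V S
    · refine hg0 (1 - e) (hA.idempotent_smul_cover_eq_zero he.one_sub V (fun T hT => ?_) hext hg hv) h1
      exact ⟨fun hv t => by rw [sub_smul, one_smul, (heV T hT).1 hv, sub_self],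
        fun hv t => by rw [sub_smul, one_smul, (heV T hT).2 hv, sub_zero]⟩
    · refine hg0 e (hA.idempotent_smul_cover_eq_zero he (fun T => ¬ V T) (fun T hT => ?_)
        (fun T T' h1 h2 h3 => not_congr (hext T T' h1 h2 h3)) hg hv) h2
      exact ⟨(heV T hT).2, fun hv => (heV T hT).1 (not_not.1 hv)⟩
  -- The intersection is zero because `a = e a + (1 - e) a`. If the sum were proper, some simple
  -- quotient of `A` would vanish on both ideals; but the projective cover of that quotient is
  -- killed by `e` or by `1 - e`, so its lift to `A` lands in one of them.
  have hcompl : IsCompl (leftAnnihilatingIdeal (1 - e)) (leftAnnihilatingIdeal e) := by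
    constructor
    · rw [disjoint_iff, eq_bot_iff]
      intro a ha
      obtain ⟨h1, h2⟩ := (TwoSidedIdeal.mem_inf A).1 ha
      have h3 := mem_leftAnnihilatingIdeal.1 h1 1
      have h4 := mem_leftAnnihilatingIdeal.1 h2 1
      rw [one_mul] at h3 h4
      rw [sub_mul, one_mul, h4, sub_zero] at h3
      exact (TwoSidedIdeal.mem_bot A).2 h3
    · rw [codisjoint_iff, eq_top_iff]
      set L := leftAnnihilatingIdeal (1 - e) ⊔ leftAnnihilatingIdeal e with hL
      let K : Submodule A A :=
        { carrier := {a | a ∈ L}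
          add_mem' := fun ha hb => L.add_mem ha hb
          zero_mem' := L.zero_mem
          smul_mem' := fun c _ ha => L.mul_mem_left c _ ha }
      by_contra hne
      have hK : K ≠ ⊤ := fun h => hne fun a _ => show a ∈ K from h ▸ Submodule.mem_top
      obtain ⟨Q, hQ, hQs⟩ := exists_le_isSimpleModule_quotient hK
      have h0 := key (ModuleCat.of A (A ⧸ Q)) hQs Q.mkQ
        (fun a ha => (Submodule.Quotient.mk_eq_zero Q).2 (hQ
          (show a ∈ L from (le_sup_left : leftAnnihilatingIdeal (1 - e) ≤ L) ha)))
        (fun a ha => (Submodule.Quotient.mk_eq_zero Q).2 (hQ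
          (show a ∈ L from (le_sup_right : leftAnnihilatingIdeal e ≤ L) ha)))
      have h2 := Q.ker_mkQ
      rw [show Q.mkQ = 0 from h0, LinearMap.ker_zero] at h2
      exact (isSimpleModule_iff_isCoatom.1 hQs).1 h2.symm
  have hor : leftAnnihilatingIdeal (1 - e) = ⊤ ∨ leftAnnihilatingIdeal e = ⊤ := by
    by_contra! h
    exact hA.connected.2 ⟨_, _, h.1, h.2, hcompl⟩
  have hone : ∀ f : A, leftAnnihilatingIdeal f = ⊤ → f = 0 := fun f hf => by
    have h1 : (1 : A) ∈ leftAnnihilatingIdeal f := by rw [hf]; trivial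
    simpa using mem_leftAnnihilatingIdeal.1 h1 1
  rcases hor with h | h
  · left
    intro T hT
    by_contra hv
    have := IsSimpleModule.nontrivial A T
    obtain ⟨t, ht⟩ := exists_ne (0 : T)
    have h1 := (heV T hT).2 hv t
    rw [← sub_eq_zero.1 (hone _ h), one_smul] at h1
    exact ht h1
  · right
    intro T hT hv
    have := IsSimpleModule.nontrivial A T
    obtain ⟨t, ht⟩ := exists_ne (0 : T)
    have h1 := (heV T hT).1 hv t
    rw [hone _ h, zero_smul] at h1
    exact ht h1.symm

end Block

/-! ### Connected finite graphs with in- and out-degree at most one -/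

section PathEnumeration

variable {n : ℕ} (E : Fin n → Fin n → Prop)

/-- A path with `m` distinct vertices in the graph of `E`. -/
def IsGraphPath (m : ℕ) (x : ℕ → Fin n) : Prop :=
  Set.InjOn x (Set.Iio m) ∧ ∀ i, i + 1 < m → E (x i) (x (i + 1))

/-- A longest path meets every vertex: a neighbour off the path could be attached only at an end,
which would lengthen the path. The only edge that can remain leads from the last vertex to the
first. -/
theorem exists_perm_line_or_cycle (hn : 0 < n)
    (hout : ∀ j k k', E j k → E j k' → k = k') (hin : ∀ j j' k, E j k → E j' k → j = j')
    (hconn : ∀ p : Fin n → Prop, (∀ j k, E j k → (p j ↔ p k)) → (∀ j, p j) ∨ ∀ j, ¬ p j) :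
    ∃ σ : Equiv.Perm (Fin n), (∀ j k, E (σ j) (σ k) ↔ (k : ℕ) = j + 1) ∨
      ∀ j k, E (σ j) (σ k) ↔ (k : ℕ) = (j + 1) % n := by
  classical
  have hcard : ∀ m x, IsGraphPath E m x → m ≤ n := by
    intro m x hx
    have := Finset.card_le_card_of_injOn (s := Finset.range m) (t := Finset.univ) x
      (fun _ _ => Finset.mem_univ _) (by simpa using hx.1)
    simpa using this
  set m := Nat.findGreatest (fun m => ∃ x, IsGraphPath E m x) n with hm
  obtain ⟨x, hx⟩ : ∃ x, IsGraphPath E m x :=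
    Nat.findGreatest_spec (P := fun m => ∃ x, IsGraphPath E m x) (m := 0) (Nat.zero_le n)
      ⟨fun _ => ⟨0, hn⟩, by simp [IsGraphPath]⟩
  have hmax : ¬ ∃ y, IsGraphPath E (m + 1) y := by
    rintro ⟨y, hy⟩
    have := Nat.le_findGreatest (P := fun m => ∃ x, IsGraphPath E m x) (hcard _ _ hy) ⟨y, hy⟩
    lia
  have hm1 : 1 ≤ m := Nat.le_findGreatest (P := fun m => ∃ x, IsGraphPath E m x) hn
    ⟨fun _ => ⟨0, hn⟩, fun a ha b hb _ => by
      simp only [Set.mem_Iio] at ha hb; lia, fun i hi => by lia⟩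
  have hall : ∀ v, ∃ i < m, x i = v := by
    refine (hconn (fun v => ∃ i < m, x i = v) fun j k hjk => ⟨?_, ?_⟩).resolve_right
      fun h => h (x 0) ⟨0, hm1, rfl⟩
    · rintro ⟨i, hi, rfl⟩
      by_cases h1 : i + 1 < m
      · exact ⟨i + 1, h1, hout _ _ _ (hx.2 i h1) hjk⟩
      · by_contra! hk
        refine hmax ⟨fun a => if a < m then x a else k, fun a ha b hb hab => ?_, fun a ha => ?_⟩
        · simp only [Set.mem_Iio] at ha hb
          dsimp only at hab
          split_ifs at hab with h2 h3 h3
          · exact hx.1 h2 h3 hab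
          · exact absurd hab (hk a h2)
          · exact absurd hab.symm (hk b h3)
          · lia
        · by_cases h2 : a + 1 < m
          · simpa [h2, show a < m by lia] using hx.2 a h2
          · obtain rfl : a = i := by lia
            simpa [h2, hi] using hjk
    · rintro ⟨i, hi, rfl⟩
      cases i with
      | succ i => exact ⟨i, by lia, hin _ _ _ (hx.2 i hi) hjk⟩
      | zero =>
        by_contra! hk
        refine hmax ⟨fun a => if a = 0 then j else x (a - 1), fun a ha b hb hab => ?_,
          fun a ha => ?_⟩
        · simp only [Set.mem_Iio] at ha hb
          dsimp only at hab
          split_ifs at hab with h2 h3 h3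
          · lia
          · exact absurd hab.symm (hk (b - 1) (by lia))
          · exact absurd hab (hk (a - 1) (by lia))
          · have := hx.1 (show a - 1 < m by lia) (show b - 1 < m by lia) hab
            lia
        · cases a with
          | zero => simpa using hjk
          | succ a => simpa using hx.2 a (by lia)
  have hmn : m = n := by
    refine le_antisymm (hcard _ _ hx) ?_
    have := Finset.card_le_card_of_surjOn (s := Finset.range m) (t := Finset.univ) x
      (fun v _ => by obtain ⟨i, hi, rfl⟩ := hall v; exact ⟨i, by simpa using hi, rfl⟩)
    simpa using this
  have hbij : Function.Bijective (fun i : Fin n => x i) := by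
    constructor
    · intro a b hab
      exact Fin.ext (hx.1 (by simp [hmn]) (by simp [hmn]) hab)
    · intro v
      obtain ⟨i, hi, rfl⟩ := hall v
      exact ⟨⟨i, hmn ▸ hi⟩, rfl⟩
  have hinj : ∀ a b, a < n → b < n → x a = x b → a = b := fun a b ha hb h =>
    hx.1 (show a < m by lia) (show b < m by lia) h
  have hstep : ∀ i, i + 1 < n → E (x i) (x (i + 1)) := fun i hi => hx.2 i (by lia)
  have hE : ∀ j k, j + 1 < n → k < n → (E (x j) (x k) ↔ k = j + 1) := by
    intro j k hj hk
    refine ⟨fun h => hinj _ _ hk hj (hout _ _ _ h (hstep j hj)), ?_⟩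
    rintro rfl
    exact hstep j hj
  have hlast : ∀ k, k < n → E (x (n - 1)) (x k) → k = 0 := by
    intro k hk h
    by_contra h0
    obtain ⟨k, rfl⟩ := Nat.exists_eq_succ_of_ne_zero h0
    have := hinj _ _ (by lia) (by lia) (hin _ _ _ h (hstep k hk))
    lia
  refine ⟨Equiv.ofBijective _ hbij, ?_⟩
  by_cases hcyc : E (x (n - 1)) (x 0)
  · right
    intro j k
    change E (x j) (x k) ↔ _
    by_cases hj : (j : ℕ) + 1 < n
    · rw [Nat.mod_eq_of_lt hj]
      exact hE j k hj k.2
    · have hj' : (j : ℕ) = n - 1 := by lia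
      rw [hj', Nat.sub_add_cancel hn, Nat.mod_self]
      refine ⟨hlast k k.2, fun h => ?_⟩
      rw [h]
      exact hcyc
  · left
    intro j k
    change E (x j) (x k) ↔ _
    by_cases hj : (j : ℕ) + 1 < n
    · exact hE j k hj k.2
    · have hj' : (j : ℕ) = n - 1 := by lia
      refine ⟨fun h => ?_, fun h => by lia⟩
      rw [hj'] at h
      rw [hlast k k.2 h] at h
      exact absurd h hcyc

end PathEnumeration

/-! ### Ordering the simple modules along the quiver -/

section Ordering

variable {R : Type u} [CommRing R] [IsArtinianRing R] {A : Type v} [Ring A] [Algebra R A]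
  (hA : IsConnectedNakayama R A)

include hA

theorem IsConnectedNakayama.numSimples_pos : 0 < numSimples A := by
  have := hA.isArtinianRing
  have := hA.connected.1
  rw [numSimples, Set.ncard_pos finite_simpleClasses]
  obtain ⟨T, hT⟩ := exists_isSimpleModule_le (A := A) A
  exact ⟨isoClass (ModuleCat.of A T), ModuleCat.of A T, hT, rfl⟩

theorem IsConnectedNakayama.nonempty_simpleOrdering : Nonempty (SimpleOrdering A) := by
  have := hA.isArtinianRing
  have hfin : Finite (simpleClasses A) := finite_simpleClasses (A := A)
  have hcard : Nat.card (simpleClasses A) = numSimples A := rfl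
  let ε := Finite.equivFinOfCardEq hcard
  choose S hS hSc using fun i => (ε.symm i).2
  have hSc' : ∀ j, isoClass (S j) = ε.symm j := hSc
  have hinj : ∀ j k, Nonempty (S j ≃ₗ[A] S k) → j = k := by
    intro j k h
    have h1 := isoClass_eq_iff.2 h
    rw [hSc', hSc'] at h1
    exact ε.symm.injective (Subtype.ext h1)
  have hsurj : ∀ T : ModuleCat.{v} A, IsSimpleModule A T → ∃ j, Nonempty (T ≃ₗ[A] S j) := by
    intro T hT
    refine ⟨ε ⟨isoClass T, T, hT, rfl⟩, isoClass_eq_iff.1 ?_⟩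
    rw [hSc', ε.symm_apply_apply]
  obtain ⟨σ, hσ⟩ := exists_perm_line_or_cycle (fun j k => ¬ ExtZero A (S j) (S k) 1)
    hA.numSimples_pos (fun j k k' h h' => by
      have := hS j; have := hS k; have := hS k'
      exact hinj _ _ (hA.target_unique h h')) (fun j j' k h h' => by
      have := hS j; have := hS j'; have := hS k
      exact hinj _ _ (hA.source_unique h h')) (fun p hp => by
      have hV : ∀ T T' : ModuleCat.{v} A, (∃ j, p j ∧ Nonempty (T ≃ₗ[A] S j)) →
          Nonempty (T ≃ₗ[A] T') → ∃ j, p j ∧ Nonempty (T' ≃ₗ[A] S j) :=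
        fun T T' ⟨j, hj, ⟨i⟩⟩ ⟨i'⟩ => ⟨j, hj, ⟨i'.symm.trans i⟩⟩
      have hpV : ∀ (T : ModuleCat.{v} A) j, Nonempty (T ≃ₗ[A] S j) → ((∃ j, p j ∧ Nonempty (T ≃ₗ[A] S j)) ↔ p j) := by
        rintro T j ⟨i⟩
        refine ⟨?_, fun h => ⟨j, h, ⟨i⟩⟩⟩
        rintro ⟨k, hk, ⟨i'⟩⟩
        rwa [hinj j k ⟨i.symm.trans i'⟩]
      rcases hA.all_or_none (fun T => ∃ j, p j ∧ Nonempty (T ≃ₗ[A] S j)) hV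
        (fun T T' hT hT' h => by
          obtain ⟨j, ⟨i⟩⟩ := hsurj T hT
          obtain ⟨k, ⟨i'⟩⟩ := hsurj T' hT'
          rw [hpV T j ⟨i⟩, hpV T' k ⟨i'⟩]
          exact hp j k fun h0 => h (h0.congr i.symm i'.symm)) with h | h
      · exact Or.inl fun j => (hpV (S j) j ⟨LinearEquiv.refl A _⟩).1 (h (S j) (hS j))
      · exact Or.inr fun j hj => h (S j) (hS j) ⟨j, hj, ⟨LinearEquiv.refl A _⟩⟩)
  have hcov : ∀ j, ∃ (P : ModuleCat.{v} A) (f : P →ₗ[A] S (σ j)), IsProjectiveCover f := by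
    intro j
    have := hS (σ j)
    obtain ⟨P, _, _, f, hf⟩ := exists_isProjectiveCover (A := A) (S (σ j))
    exact ⟨ModuleCat.of A P, f, hf⟩
  choose P f hf using hcov
  exact ⟨{
    S := fun j => S (σ j)
    isSimple := fun j => hS _
    eq_of_iso := fun j k ⟨i⟩ => σ.injective (hinj _ _ ⟨i.toLinearEquiv⟩)
    complete := fun T hT => by
      obtain ⟨j, ⟨i⟩⟩ := hsurj T hT
      exact ⟨σ.symm j, ⟨i.toModuleIso ≪≫ eqToIso (congrArg S (σ.apply_symm_apply j).symm)⟩⟩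
    quiver := by
      simp only [← not_subsingleton_iff_nontrivial]
      exact hσ
    P := P
    cover := f
    isCover := hf }⟩

end Ordering

/-! ### Lengths of covers -/

section Length

variable {A : Type v} [Ring A] {M : Type v} [AddCommGroup M] [Module A M]

theorem length_eq_of_covBy {U U' : Submodule A M} (hcov : U ⋖ U') :
    Module.length A U' = Module.length A U + 1 := by
  have hs := (covBy_iff_quot_is_simple hcov.le).1 hcov
  have hex : Function.Exact (Submodule.inclusion hcov.le) (U.comap U'.subtype).mkQ := by
    rw [LinearMap.exact_iff, Submodule.ker_mkQ, Submodule.range_inclusion]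
  rw [Module.length_eq_add_of_exact _ _ (Submodule.inclusion_injective hcov.le)
    (Submodule.mkQ_surjective _) hex, Module.length_eq_one_iff.2 hs]

theorem IsProjectiveCover.length_eq {P P' S : Type v} [AddCommGroup P] [Module A P]
    [AddCommGroup P'] [Module A P'] [AddCommGroup S] [Module A S] {f : P →ₗ[A] S}
    {f' : P' →ₗ[A] S} (hf : IsProjectiveCover f) (hf' : IsProjectiveCover f') :
    Module.length A P = Module.length A P' := by
  have := hf.projective
  have := hf'.projective
  obtain ⟨h, -, hs⟩ := hf'.isEssentialEpi.exists_surjective_lift hf.surjective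
  obtain ⟨h', -, hs'⟩ := hf.isEssentialEpi.exists_surjective_lift hf'.surjective
  exact le_antisymm (Module.length_le_of_surjective h' hs') (Module.length_le_of_surjective h hs)

theorem IsProjectiveCover.comp_linearEquiv {P S S' : Type v} [AddCommGroup P] [Module A P]
    [AddCommGroup S] [Module A S] [AddCommGroup S'] [Module A S'] {f : P →ₗ[A] S}
    (hf : IsProjectiveCover f) (i : S ≃ₗ[A] S') : IsProjectiveCover (i.toLinearMap ∘ₗ f) where
  finite := hf.finite
  projective := hf.projective
  surjective := i.surjective.comp hf.surjective
  superfluous N hN := hf.superfluous N (by rwa [LinearEquiv.ker_comp] at hN)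

end Length

/-! ### Submodules of projective covers, syzygies and `θ` -/

namespace SimpleOrdering

variable {A : Type v} [Ring A] (O : SimpleOrdering A)

theorem ext_iff (j k : Fin (numSimples A)) :
    Nontrivial (Abelian.Ext (O.S j) (O.S k) 1) ↔ ¬ ExtZero A (O.S j) (O.S k) 1 :=
  not_subsingleton_iff_nontrivial.symm

theorem eq_succ_mod {j k : Fin (numSimples A)} (h : ¬ ExtZero A (O.S j) (O.S k) 1) :
    (k : ℕ) = (j + 1) % numSimples A := by
  rw [← O.ext_iff] at h
  rcases O.quiver with hq | hq
  · have := (hq j k).1 h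
    rw [← this, Nat.mod_eq_of_lt k.2]
  · exact (hq j k).1 h

section

variable (hn : 0 < numSimples A)

/-- The residue of `i` modulo the number of simple modules. -/
def idx (i : ℕ) : Fin (numSimples A) := ⟨i % numSimples A, Nat.mod_lt _ hn⟩

/-- The lift of `θ` to the natural numbers. -/
def thetaLift (i : ℕ) : ℕ := i + O.c (idx hn i)

theorem idx_val (j : Fin (numSimples A)) : idx hn j = j := Fin.ext (Nat.mod_eq_of_lt j.2)

theorem idx_thetaLift (i : ℕ) : idx hn (O.thetaLift hn i) = O.theta (idx hn i) := by
  ext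
  simp [idx, thetaLift, theta, Nat.add_mod]

theorem idx_thetaLift_iterate (m i : ℕ) :
    idx hn ((O.thetaLift hn)^[m] i) = O.theta^[m] (idx hn i) :=
  (Function.Semiconj.iterate_right (f := idx hn) (fun i => O.idx_thetaLift hn i) m) i

theorem thetaLift_add (i : ℕ) :
    O.thetaLift hn (i + numSimples A) = O.thetaLift hn i + numSimples A := by
  simp only [thetaLift, idx, Nat.add_mod_right]
  lia

theorem thetaLift_iterate_add (m i : ℕ) :
    (O.thetaLift hn)^[m] (i + numSimples A) = (O.thetaLift hn)^[m] i + numSimples A :=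
  (Function.Semiconj.iterate_right (f := (· + numSimples A))
    (fun i => (O.thetaLift_add hn i).symm) m i).symm

end

section Nakayama

variable {R : Type u} [CommRing R] [IsArtinianRing R] [Algebra R A]
  (hA : IsConnectedNakayama R A)

include hA

theorem isChainModule (j : Fin (numSimples A)) : IsChainModule A (O.P j) :=
  have := O.isSimple j
  hA.isChainModule_of_cover (O.isCover j)

theorem length_eq (j : Fin (numSimples A)) : Module.length A (O.P j) = O.c j := by
  have := hA.isArtinianRing
  have := (O.isCover j).finite
  exact (ENat.natCast_toNat Module.length_ne_top).symm

/-- The submodule of colength `l` of the projective cover of the `i`-th simple module has top the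
`(i + l)`-th simple module. -/
theorem top_of_submodule (hn : 0 < numSimples A) (i l : ℕ) (U : Submodule A (O.P (idx hn i)))
    (hU : Module.length A (O.P (idx hn i)) = Module.length A U + l)
    (T : ModuleCat.{v} A) [hT : IsSimpleModule A T] (g : U →ₗ[A] T) (hg : g ≠ 0) :
    Nonempty (T ≃ₗ[A] O.S (idx hn (i + l))) := by
  have := hA.isArtinianRing
  have := (O.isCover (idx hn i)).finite
  have hc := O.isChainModule hA (idx hn i)
  induction l generalizing U T with
  | zero =>
    have hUt : U = ⊤ := by
      by_contra h
      have := Submodule.length_lt h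
      rw [hU, Nat.cast_zero, add_zero] at this
      exact lt_irrefl _ this
    subst hUt
    have := O.isSimple (idx hn i)
    have hs : (O.cover (idx hn i)) ≠ 0 := by
      intro h
      have := IsSimpleModule.nontrivial A (O.S (idx hn i))
      obtain ⟨s, hs⟩ := exists_ne (0 : O.S (idx hn i))
      obtain ⟨p, rfl⟩ := (O.isCover (idx hn i)).surjective s
      exact hs (by simp [h])
    refine hc.simple_quotient_unique (f := g ∘ₗ Submodule.topEquiv.symm.toLinearMap) ?_ hs
    intro h
    apply hg
    ext x
    exact LinearMap.congr_fun h x.1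
  | succ l ih =>
    have hUt : U ≠ ⊤ := by
      rintro rfl
      rw [Module.length_top] at hU
      have hfin : Module.length A (O.P (idx hn i)) ≠ ⊤ := Module.length_ne_top
      lift Module.length A (O.P (idx hn i)) to ℕ using hfin with a
      norm_cast at hU
      lia
    obtain ⟨U', hcov, -⟩ := exists_covBy_le_of_lt (lt_top_iff_ne_top.2 hUt)
    have hs := (covBy_iff_quot_is_simple hcov.le).1 hcov
    have hQ : (U.comap U'.subtype).mkQ ≠ 0 := fun h => by
      have h2 := (U.comap U'.subtype).ker_mkQ
      rw [h, LinearMap.ker_zero] at h2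
      exact (isSimpleModule_iff_isCoatom.1 hs).1 h2.symm
    obtain ⟨e⟩ := ih U' (by
      rw [hU, length_eq_of_covBy hcov, add_assoc]
      congr 1
      push_cast
      exact add_comm _ _) (ModuleCat.of A (U' ⧸ U.comap U'.subtype)) (U.comap U'.subtype).mkQ hQ
    obtain ⟨k, ⟨e'⟩⟩ := O.complete T hT
    have hne := hc.not_extZero_of_covBy hcov hg
    have hk := O.eq_succ_mod (j := idx hn (i + l)) (k := k)
      fun h0 => hne (h0.congr e.symm e'.toLinearEquiv.symm)
    have : k = idx hn (i + (l + 1)) := by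
      ext
      rw [hk]
      simp [idx, add_assoc]
    exact this ▸ ⟨e'.toLinearEquiv⟩

/-- The top of `U` is the simple module with index `i + l`, and `U` is a chain module, so a map from
the cover onto this top lifts to a surjection onto `U`. -/
theorem exists_surjective_of_submodule (hn : 0 < numSimples A) (i l : ℕ)
    (U : Submodule A (O.P (idx hn i)))
    (hU : Module.length A (O.P (idx hn i)) = Module.length A U + l) (hU0 : U ≠ ⊥) :
    ∃ h : O.P (idx hn (i + l)) →ₗ[A] U, Function.Surjective h := by
  have := hA.isArtinianRing
  have := (O.isCover (idx hn i)).finite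
  have : Nontrivial U := Submodule.nontrivial_iff_ne_bot.2 hU0
  obtain ⟨K, -, hK⟩ := exists_le_isSimpleModule_quotient (bot_ne_top : (⊥ : Submodule A U) ≠ ⊤)
  have hQ : K.mkQ ≠ 0 := fun h => by
    have h2 := K.ker_mkQ
    rw [h, LinearMap.ker_zero] at h2
    exact (isSimpleModule_iff_isCoatom.1 hK).1 h2.symm
  obtain ⟨e⟩ := O.top_of_submodule hA hn i l U hU (ModuleCat.of A (U ⧸ K)) K.mkQ hQ
  have hc : IsChainModule A U := (O.isChainModule hA _).of_injective _ U.injective_subtype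
  have := (O.isCover (idx hn (i + l))).projective
  obtain ⟨h, -, hs⟩ := (hc.isEssentialEpi (Submodule.mkQ_surjective K)).exists_surjective_lift
    (f := e.symm.toLinearMap ∘ₗ O.cover (idx hn (i + l)))
    (e.symm.surjective.comp (O.isCover (idx hn (i + l))).surjective)
  exact ⟨h, hs⟩

omit [CommRing R] [IsArtinianRing R] [Algebra R A] hA in
theorem length_ker_cover (j : Fin (numSimples A)) :
    Module.length A (O.P j) = Module.length A (LinearMap.ker (O.cover j)) + 1 := by
  have := O.isSimple j
  rw [Module.length_eq_add_of_exact (LinearMap.ker (O.cover j)).subtype (O.cover j)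
    (Submodule.injective_subtype _) (O.isCover j).surjective (LinearMap.exact_subtype_ker_map _),
    Module.length_eq_one A (O.S j)]

/-- The radical of `P_i` is zero or a quotient of `P_{i+1}`, so `c_i ≤ c_{i+1} + 1`. Monotonicity of
the lift is what allows the fibres of `θ^m` to be counted. -/
theorem thetaLift_le_succ (hn : 0 < numSimples A) (i : ℕ) :
    O.thetaLift hn i ≤ O.thetaLift hn (i + 1) := by
  suffices O.c (idx hn i) ≤ O.c (idx hn (i + 1)) + 1 by
    simp only [thetaLift]
    lia
  have hl := O.length_ker_cover (idx hn i)
  have h1 := O.length_eq hA (idx hn i)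
  have h2 := O.length_eq hA (idx hn (i + 1))
  by_cases h0 : LinearMap.ker (O.cover (idx hn i)) = ⊥
  · rw [h0, Module.length_bot, h1] at hl
    norm_cast at hl
    lia
  · obtain ⟨h, hs⟩ := O.exists_surjective_of_submodule hA hn i 1 _ (by simpa using hl) h0
    have h3 := Module.length_le_of_surjective h hs
    rw [h2] at h3
    have h4 : (O.c (idx hn i) : ℕ∞) ≤ O.c (idx hn (i + 1)) + 1 := by
      rw [← h1, hl]
      gcongr
    exact_mod_cast h4

/-- A quotient of `P_i` of length `l` corresponds to the interval `[i, i+l)`, and its second syzygy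
to `[θ i, θ(i+l))`. When `m` such double steps make the interval empty, the resolution has stopped.
-/
theorem finPD_of_iterate_eq (hn : 0 < numSimples A) (m : ℕ) :
    ∀ (i l : ℕ) (M : Type v) [AddCommGroup M] [Module A M] (f : O.P (idx hn i) →ₗ[A] M),
      Function.Surjective f → Module.length A M = l →
      (O.thetaLift hn)^[m] i = (O.thetaLift hn)^[m] (i + l) → FinPD A M := by
  have := hA.isArtinianRing
  induction m with
  | zero =>
    intro i l M _ _ f hf hl h
    have : l = 0 := by simpa using h
    rw [this, Nat.cast_zero, Module.length_eq_zero_iff] at hl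
    exact FinPD.of_subsingleton
  | succ m ih =>
    intro i l M _ _ f hf hl h
    have := (O.isCover (idx hn i)).finite
    have := (O.isCover (idx hn i)).projective
    have := (O.isCover (idx hn (i + l))).finite
    have := (O.isCover (idx hn (i + l))).projective
    set K := LinearMap.ker f with hK
    have hKl : Module.length A (O.P (idx hn i)) = Module.length A K + l := by
      rw [← hl]
      exact Module.length_eq_add_of_exact K.subtype f K.injective_subtype hf
        (LinearMap.exact_subtype_ker_map f)
    refine FinPD.right K.injective_subtype hf (LinearMap.exact_subtype_ker_map f) ?_
      FinPD.of_projective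
    by_cases hK0 : K = ⊥
    · have : Subsingleton K := Submodule.subsingleton_iff_eq_bot.2 hK0
      exact FinPD.of_subsingleton
    obtain ⟨g, hg⟩ := O.exists_surjective_of_submodule hA hn i l K hKl hK0
    obtain ⟨k, hk⟩ : ∃ k : ℕ, Module.length A K = k :=
      ⟨_, (ENat.natCast_toNat Module.length_ne_top).symm⟩
    set K' := LinearMap.ker g with hK'
    obtain ⟨l', hl'⟩ : ∃ k : ℕ, Module.length A K' = k :=
      ⟨_, (ENat.natCast_toNat Module.length_ne_top).symm⟩
    have hKl' : Module.length A (O.P (idx hn (i + l))) = Module.length A K' + k := by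
      rw [← hk]
      exact Module.length_eq_add_of_exact K'.subtype g K'.injective_subtype hg
        (LinearMap.exact_subtype_ker_map g)
    refine FinPD.right K'.injective_subtype hg (LinearMap.exact_subtype_ker_map g) ?_
      FinPD.of_projective
    by_cases hK0' : K' = ⊥
    · have : Subsingleton K' := Submodule.subsingleton_iff_eq_bot.2 hK0'
      exact FinPD.of_subsingleton
    obtain ⟨g', hg'⟩ := O.exists_surjective_of_submodule hA hn (i + l) k K' hKl' hK0'
    have h1 := hKl
    have h2 := hKl'
    rw [O.length_eq hA, hk] at h1
    rw [O.length_eq hA, hl'] at h2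
    norm_cast at h1 h2
    -- Since `c_i = k + l` and `c_{i+l} = l' + k`, the second syzygy starts at `i + l + k = θ i` and
    -- ends at `i + l + k + l' = θ(i+l)`.
    refine ih (i + l + k) l' K' g' hg' hl' ?_
    rw [Function.iterate_succ_apply, Function.iterate_succ_apply] at h
    convert! h using 2
    · simp only [thetaLift, h1]
      lia
    · simp only [thetaLift, h2]
      lia

end Nakayama
end SimpleOrdering

/-! ### Bounds for the depth and its independence of the ordering -/

namespace SimpleOrdering

variable {A : Type v} [Ring A] (O : SimpleOrdering A)

theorem range_theta_iterate_succ_subset (m : ℕ) :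
    Set.range O.theta^[m + 1] ⊆ Set.range O.theta^[m] := by
  rintro _ ⟨x, rfl⟩
  exact ⟨O.theta x, rfl⟩

theorem add_ncard_range_le (m : ℕ) (hm : m ≤ O.depth) :
    m + (Set.range O.theta^[m]).ncard ≤ numSimples A := by
  induction m with
  | zero => simp
  | succ m ih =>
    have h1 : Set.range O.theta^[m + 1] ⊂ Set.range O.theta^[m] := by
      refine lt_of_le_of_ne (O.range_theta_iterate_succ_subset m) fun h => ?_
      exact Nat.notMem_of_lt_sInf (show m < O.depth by lia) h.symm
    have := Set.ncard_lt_ncard h1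
    have := ih (by lia)
    lia

theorem depth_add_one_le (hn : 0 < numSimples A) : O.depth + 1 ≤ numSimples A := by
  have h1 := O.add_ncard_range_le O.depth le_rfl
  have h2 : 0 < (Set.range O.theta^[O.depth]).ncard := by
    rw [Set.ncard_pos]
    exact ⟨_, ⟨0, hn⟩, rfl⟩
  lia

theorem ncard_finPD_add_ncard :
    numSimplesFiniteProjDim A + {j | ¬ FinPD A (O.S j)}.ncard = numSimples A := by
  have h1 : numSimplesFiniteProjDim A = {j | FinPD A (O.S j)}.ncard := by
    have : {c : Quotient (isIsomorphicSetoid (ModuleCat.{v} A)) | ∃ S : ModuleCat.{v} A,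
        (IsSimpleModule A S ∧ projectiveDimension S < ⊤) ∧ Quotient.mk _ S = c} =
        (fun j => isoClass (O.S j)) '' {j | FinPD A (O.S j)} := by
      ext c
      constructor
      · rintro ⟨T, ⟨hT, hp⟩, rfl⟩
        obtain ⟨j, ⟨i⟩⟩ := O.complete T hT
        exact ⟨j, ((projectiveDimension_lt_top_iff T).1 hp).congr i.toLinearEquiv,
          isoClass_eq_iff.2 ⟨i.toLinearEquiv.symm⟩⟩
      · rintro ⟨j, hj, rfl⟩
        exact ⟨O.S j, ⟨O.isSimple j, (projectiveDimension_lt_top_iff _).2 hj⟩, rfl⟩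
    rw [numSimplesFiniteProjDim, this]
    refine Set.ncard_image_of_injective _ fun j k hjk => ?_
    obtain ⟨i⟩ := isoClass_eq_iff.1 hjk
    exact O.eq_of_iso j k ⟨i.toModuleIso⟩
  have h2 := Set.ncard_add_ncard_compl {j | FinPD A (O.S j)}
  rw [Nat.card_fin] at h2
  rw [h1]
  exact h2

section

variable {R : Type u} [CommRing R] [IsArtinianRing R] [Algebra R A]
  (hA : IsConnectedNakayama R A)
include hA

/-- If `S_j` has infinite projective dimension, the lifted `θ^m` is strictly larger at `j + 1` than
at `j`. These strict jumps, together with equivariance under translation by `n`, keep the values of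
`θ^m` at such `j` distinct modulo `n`. -/
theorem ncard_not_finPD_le (m : ℕ) :
    {j | ¬ FinPD A (O.S j)}.ncard ≤ (Set.range O.theta^[m]).ncard := by
  have hn := hA.numSimples_pos
  have hmono : Monotone (O.thetaLift hn)^[m] :=
    (monotone_nat_of_le_succ (O.thetaLift_le_succ hA hn)).iterate m
  have hjump : ∀ j : Fin (numSimples A), ¬ FinPD A (O.S j) →
      (O.thetaLift hn)^[m] j < (O.thetaLift hn)^[m] (j + 1) := by
    intro j hj
    refine lt_of_le_of_ne (hmono (Nat.le_succ _)) fun h => hj ?_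
    have hs := O.isSimple (idx hn j)
    have := O.finPD_of_iterate_eq hA hn m j 1 (O.S (idx hn j)) (O.cover _)
      (O.isCover _).surjective (by rw [Module.length_eq_one_iff.2 hs, Nat.cast_one]) h
    rwa [idx_val] at this
  have hlt : ∀ a ∈ {j | ¬ FinPD A (O.S j)}, ∀ b ∈ {j | ¬ FinPD A (O.S j)}, a < b →
      O.theta^[m] a ≠ O.theta^[m] b := by
    intro a ha b hb hab heq
    have h1 := hjump a ha
    have h2 := hjump b hb
    have h3 : (O.thetaLift hn)^[m] (a + 1) ≤ (O.thetaLift hn)^[m] b := hmono (by lia)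
    -- One full turn after `a`: the value at `b` now lies strictly between the value at `a` and that
    -- value plus `n`, so the two are not congruent.
    have h4 : (O.thetaLift hn)^[m] (b + 1) ≤ (O.thetaLift hn)^[m] (a + numSimples A) :=
      hmono (by have := b.2; lia)
    rw [O.thetaLift_iterate_add] at h4
    rw [← idx_val hn a, ← idx_val hn b, ← O.idx_thetaLift_iterate, ← O.idx_thetaLift_iterate] at heq
    have h5 : (O.thetaLift hn)^[m] a ≡ (O.thetaLift hn)^[m] b [MOD numSimples A] :=
      congrArg Fin.val heq
    have h6 := (Nat.modEq_iff_dvd' (by lia)).1 h5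
    have := Nat.le_of_dvd (by lia) h6
    lia
  refine Set.ncard_le_ncard_of_injOn O.theta^[m] (fun j _ => ⟨j, rfl⟩) (fun a ha b hb h => ?_)
  rcases lt_trichotomy a b with h1 | h1 | h1
  · exact absurd h (hlt a ha b hb h1)
  · exact h1
  · exact absurd h.symm (hlt b hb a ha h1)

/-- The image of `θ^d` has at most `n - d` elements, and at least as many as there are simples of
infinite projective dimension. -/
theorem depth_le_numSimplesFiniteProjDim : O.depth ≤ numSimplesFiniteProjDim A := by
  have h1 := O.add_ncard_range_le O.depth le_rfl
  have h2 := O.ncard_not_finPD_le hA O.depth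
  have h3 := O.ncard_finPD_add_ncard
  lia

/-- The bijection `τ` matching two orderings preserves arrows and lengths. Between lines it is the
identity and between cycles it commutes with the successor, so it conjugates one `θ` into the other.
A line cannot match a cycle, because its last vertex has no successor. -/
theorem depth_eq (O' : SimpleOrdering A) : O'.depth = O.depth := by
  have hn := hA.numSimples_pos
  choose τ hτ using fun j => O.complete (O'.S j) (O'.isSimple j)
  have hinj : Function.Injective τ := fun j k hjk => by
    obtain ⟨i⟩ := hτ j
    obtain ⟨i'⟩ := hτ k
    exact O'.eq_of_iso j k ⟨i ≪≫ eqToIso (congrArg O.S hjk) ≪≫ i'.symm⟩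
  have hsurj : Function.Surjective τ := Finite.surjective_of_injective hinj
  have hc : ∀ j, O'.c j = O.c (τ j) := by
    intro j
    obtain ⟨i⟩ := hτ j
    have := ((O'.isCover j).comp_linearEquiv i.toLinearEquiv).length_eq (O.isCover (τ j))
    rw [c, c, this]
  have hE : ∀ j k, Nontrivial (Abelian.Ext (O'.S j) (O'.S k) 1) ↔
      Nontrivial (Abelian.Ext (O.S (τ j)) (O.S (τ k)) 1) := by
    intro j k
    obtain ⟨i⟩ := hτ j
    obtain ⟨i'⟩ := hτ k
    rw [O'.ext_iff, O.ext_iff]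
    exact not_congr ⟨fun h => h.congr i.toLinearEquiv i'.toLinearEquiv,
      fun h => h.congr i.toLinearEquiv.symm i'.toLinearEquiv.symm⟩
  have hshift : ∀ (j : Fin (numSimples A)) (l : ℕ), τ (idx hn (j + l)) = idx hn (τ j + l) := by
    rcases O'.quiver with hq' | hq' <;> rcases O.quiver with hq | hq
    · have hid : ∀ i (hi : i < numSimples A), τ ⟨i, hi⟩ = ⟨i, hi⟩ := by
        intro i
        induction i with
        | zero =>
          intro hi
          by_contra h
          obtain ⟨j, hj⟩ := hsurj ⟨τ ⟨0, hi⟩ - 1, by have := (τ ⟨0, hi⟩).2; lia⟩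
          have h1 := (hq (τ j) (τ ⟨0, hi⟩)).2 (by
            rw [hj]
            have : (τ ⟨0, hi⟩ : ℕ) ≠ 0 := fun h' => h (Fin.ext h')
            simp only
            lia)
          have := (hq' _ _).1 ((hE _ _).2 h1)
          simp at this
        | succ i ih =>
          intro hi
          have h1 := (hq _ _).1 ((hE ⟨i, by lia⟩ ⟨i + 1, hi⟩).1 ((hq' _ _).2 rfl))
          rw [ih] at h1
          exact Fin.ext h1
      intro j l
      rw [hid, hid]
    · exfalso
      obtain ⟨k, hk⟩ := hsurj ⟨(τ ⟨numSimples A - 1, by lia⟩ + 1) % numSimples A, Nat.mod_lt _ hn⟩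
      have h1 := (hq' _ _).1 ((hE _ k).2 ((hq (τ ⟨numSimples A - 1, by lia⟩) (τ k)).2 (by rw [hk])))
      have := k.2
      simp only at h1
      lia
    · exfalso
      obtain ⟨j, hj⟩ := hsurj ⟨numSimples A - 1, by lia⟩
      have h1 := (hq _ _).1 ((hE j _).1 ((hq' j ⟨(j + 1) % numSimples A, Nat.mod_lt _ hn⟩).2 rfl))
      rw [hj] at h1
      have := (τ ⟨(j + 1) % numSimples A, Nat.mod_lt _ hn⟩).2
      simp only at h1
      lia
    · intro j l
      induction l with
      | zero => simp [idx_val]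
      | succ l ih =>
        have h1 := (hq _ _).1 ((hE (idx hn (j + l)) (idx hn (j + (l + 1)))).1 ((hq' _ _).2 (by
          simp [idx, add_assoc])))
        ext
        rw [h1, ih]
        simp [idx, add_assoc]
  have hθ : Function.Semiconj τ O'.theta O.theta := by
    intro j
    have h1 : O'.theta j = idx hn (j + O'.c j) := rfl
    rw [h1, hshift, hc]
    rfl
  have hr : ∀ m, Set.range O.theta^[m] = τ '' Set.range O'.theta^[m] := by
    intro m
    rw [← Set.range_comp, (hθ.iterate_right m).comp_eq, hsurj.range_comp]
  have : {m : ℕ | Set.range O'.theta^[m] = Set.range O'.theta^[m + 1]} =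
      {m : ℕ | Set.range O.theta^[m] = Set.range O.theta^[m + 1]} := by
    ext m
    rw [Set.mem_ofPred_eq, Set.mem_ofPred_eq, hr, hr, hinj.image_injective.eq_iff]
  rw [depth, depth, this]

end

end SimpleOrdering

/-! ### The idempotent of a localizable module -/

section Localizing

/-- `S` is a simple module with `proj.dim S ≤ 1`, and `e` is an idempotent which acts as zero on
`S` and as the identity on the simple modules that are not isomorphic to `S`. -/
structure IsLocalizingPair {A : Type v} [Ring A] (S : Type v) [AddCommGroup S] [Module A S]
    (e : A) : Prop where
  simple : IsSimpleModule A S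
  ext_add_two : ∀ (Y : Type v) [AddCommGroup Y] [Module A Y] (n : ℕ), ExtZero A S Y (n + 2)
  finPD : FinPD A S
  idem : IsIdempotentElem e
  smul_eq_zero : ∀ s : S, e • s = 0
  smul_eq_self : ∀ (T : Type v) [AddCommGroup T] [Module A T] [IsSimpleModule A T],
    ¬ Nonempty (T ≃ₗ[A] S) → ∀ t : T, e • t = t

variable {A : Type v} [Ring A] {S : Type v} [AddCommGroup S] [Module A S] {e : A}

theorem IsLocalizable.exists_isLocalizingPair [IsArtinianRing A] {S : ModuleCat.{v} A}
    (hS : IsLocalizable S) : ∃ e : A, IsLocalizingPair S e := by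
  obtain ⟨e, he, h⟩ := exists_idempotent_of_simple_class (A := A)
    (fun T => ¬ Nonempty (T ≃ₗ[A] S)) (fun T T' hT ⟨i⟩ ⟨i'⟩ => hT ⟨i.trans i'⟩)
  refine ⟨e, hS.simple, fun Y _ _ n => ?_, ?_, he, ?_, ?_⟩
  · have : HasProjectiveDimensionLE S 1 := (projectiveDimension_le_iff S 1).1 hS.projDim_le
    exact HasProjectiveDimensionLT.subsingleton S 2 (n + 2) (by lia) (ModuleCat.of A Y)
  · exact (projectiveDimension_lt_top_iff S).1 (lt_of_le_of_lt hS.projDim_le (by decide))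
  · exact (h S hS.simple).2 (not_not.2 ⟨LinearEquiv.refl A S⟩)
  · intro T _ _ hT hTS
    exact (h (ModuleCat.of A T) hT).1 hTS

namespace IsLocalizingPair

variable (hS : IsLocalizingPair S e)
include hS

theorem nonempty_linearEquiv {T : Type v} [AddCommGroup T] [Module A T] [IsSimpleModule A T]
    (h : ∀ t : T, e • t = 0) : Nonempty (T ≃ₗ[A] S) := by
  by_contra hT
  have := IsSimpleModule.nontrivial A T
  obtain ⟨t, ht⟩ := exists_ne (0 : T)
  exact ht ((hS.smul_eq_self T hT t).symm.trans (h t))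

/-- A simple module killed by `e` is isomorphic to `S`, so `M` is filtered by copies of `S` and both
properties pass along the filtration. -/
theorem finPD_and_extZero {M : Type v} [AddCommGroup M] [Module A M] (hM : IsFiniteLength A M)
    (h : ∀ m : M, e • m = 0) : FinPD A M ∧ ∀ (Y : Type v) [AddCommGroup Y] [Module A Y] (n : ℕ),
      ExtZero A S Y n → ExtZero A M Y n := by
  induction hM with
  | of_subsingleton => exact ⟨.of_subsingleton, fun Y _ _ n _ => .of_subsingleton⟩
  | @of_simple_quotient M _ _ N hN hNl ih =>
    obtain ⟨h1, h2⟩ := ih fun m => Subtype.ext (h m)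
    obtain ⟨i⟩ := hS.nonempty_linearEquiv (T := M ⧸ N) fun t => by
      obtain ⟨m, rfl⟩ := N.mkQ_surjective t
      rw [← map_smul, h, map_zero]
    have hex := LinearMap.exact_subtype_mkQ N
    refine ⟨FinPD.mid N.injective_subtype N.mkQ_surjective hex h1 (hS.finPD.congr i.symm),
      fun Y _ _ n hY => ?_⟩
    exact ExtZero.contra_mid N.injective_subtype N.mkQ_surjective hex (h2 Y n hY)
      (hY.congr i.symm (LinearEquiv.refl A Y))

variable [IsArtinianRing A]

theorem finPD_of_smul_eq_zero {M : Type v} [AddCommGroup M] [Module A M] [Module.Finite A M]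
    (h : ∀ m : M, e • m = 0) : FinPD A M :=
  (hS.finPD_and_extZero (isFiniteLength_iff_isNoetherian_isArtinian.2
    ⟨inferInstance, inferInstance⟩) h).1

theorem extZero_of_smul_eq_zero {M : Type v} [AddCommGroup M] [Module A M] [Module.Finite A M]
    (h : ∀ m : M, e • m = 0) {Y : Type v} [AddCommGroup Y] [Module A Y] {n : ℕ}
    (hY : ExtZero A S Y n) : ExtZero A M Y n :=
  (hS.finPD_and_extZero (isFiniteLength_iff_isNoetherian_isArtinian.2
    ⟨inferInstance, inferInstance⟩) h).2 Y n hY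

/-- If `eA` kills `y`, then `A y` is filtered by `S`, and so its inclusion into `Y` is zero. -/
theorem eq_zero_of_smul_smul {Y : Type v} [AddCommGroup Y] [Module A Y] (hY : ExtZero A S Y 0)
    {y : Y} (h : ∀ a : A, e • a • y = 0) : y = 0 := by
  have h1 := hS.extZero_of_smul_eq_zero (M := Submodule.span A {y}) (Y := Y) (fun m => by
    obtain ⟨a, ha⟩ := Submodule.mem_span_singleton.1 m.2
    ext
    rw [Submodule.coe_smul, ← ha, h]
    rfl) hY
  have := LinearMap.congr_fun (extZero_zero_iff.1 h1 (Submodule.subtype _))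
    ⟨y, Submodule.mem_span_singleton_self y⟩
  exact this

end IsLocalizingPair

theorem exists_extend_iff_extZero {P K : Type v} [AddCommGroup P] [Module A P] [AddCommGroup K]
    [Module A K] [Module.Projective A P] {f : P →ₗ[A] K} (hf : Function.Surjective f)
    {Y : Type v} [AddCommGroup Y] [Module A Y] :
    (∀ p : LinearMap.ker f →ₗ[A] Y, ∃ q : P →ₗ[A] Y, q ∘ₗ (LinearMap.ker f).subtype = p) ↔
      ExtZero A K Y 1 :=
  ⟨ExtZero.of_exists_extend (Submodule.injective_subtype _) hf
      (LinearMap.exact_subtype_ker_map f) inferInstance,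
    ExtZero.exists_extend (Submodule.injective_subtype _) hf (LinearMap.exact_subtype_ker_map f)⟩

/-- Over a free cover of `S`, vanishing of `Ext¹` is an extension problem, which can be solved one
coordinate at a time. -/
theorem ExtZero.pi_one {Y : Type v} [AddCommGroup Y] [Module A Y] (h : ExtZero A S Y 1) (m : ℕ) :
    ExtZero A S (Fin m → Y) 1 := by
  have hs : Function.Surjective (Finsupp.linearCombination A (id : S → S)) :=
    Finsupp.linearCombination_id_surjective A S
  refine (exists_extend_iff_extZero hs).1 fun p => ?_
  choose q hq using fun i => (exists_extend_iff_extZero hs).2 h (LinearMap.proj i ∘ₗ p)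
  refine ⟨LinearMap.pi q, ?_⟩
  ext x i
  exact LinearMap.congr_fun (hq i) x

theorem ExtZero.pi_zero {Y : Type v} [AddCommGroup Y] [Module A Y] (h : ExtZero A S Y 0) (m : ℕ) :
    ExtZero A S (Fin m → Y) 0 := by
  rw [extZero_zero_iff] at *
  intro f
  ext x i
  exact LinearMap.congr_fun (h (LinearMap.proj i ∘ₗ f)) x

theorem ExtZero.fin_pi {M Y : Type v} [AddCommGroup M] [Module A M] [AddCommGroup Y] [Module A Y]
    {n : ℕ} (h : ExtZero A M Y n) (m : ℕ) : ExtZero A (Fin m → M) Y n := by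
  induction m with
  | zero => exact .of_subsingleton
  | succ m ih =>
    refine ExtZero.congr (Fin.consLinearEquiv A fun _ => M) (LinearEquiv.refl A Y)
      (ExtZero.contra_mid (f := LinearMap.inl A M (Fin m → M)) (g := LinearMap.snd A M (Fin m → M))
        LinearMap.inl_injective LinearMap.snd_surjective .inl_snd h ih)

theorem FinPD.fin_pi {M : Type v} [AddCommGroup M] [Module A M] (h : FinPD A M) (m : ℕ) :
    FinPD A (Fin m → M) := by
  induction m with
  | zero => exact .of_subsingleton
  | succ m ih =>
    exact FinPD.congr (Fin.consLinearEquiv A fun _ => M)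
      (FinPD.mid (f := LinearMap.inl A M (Fin m → M)) (g := LinearMap.snd A M (Fin m → M))
        LinearMap.inl_injective LinearMap.snd_surjective .inl_snd h ih)

end Localizing

/-! ### Universal property and homological properties of a retraction -/

section Retraction

/-- For a ring homomorphism `A → B`, recorded as an `A`-module structure on `B`: the module `B`
lies in `S^⊥`, and the kernel and the cokernel of `A → B` are annihilated by `e`. -/
structure IsRetraction {A : Type v} [Ring A] (S : Type v) [AddCommGroup S] [Module A S] (e : A)
    (B : Type v) [Ring B] [Module A B] : Prop extends IsLocalizingPair S e where
  finite : Module.Finite A B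
  hom : ExtZero A S B 0
  ext : ExtZero A S B 1
  -- Together, `inj` and `surj` say that `A → B` restricts to a bijection from `eA` to `eB`.
  inj : ∀ a : A, (e * a) • (1 : B) = 0 → e * a = 0
  surj : ∀ b : B, ∃ a : A, e • b = (e * a) • (1 : B)

variable {A : Type v} [Ring A] {S : Type v} [AddCommGroup S] [Module A S] {e : A}
  {B : Type v} [Ring B] [Module A B]

/-- The homomorphism of `A`-modules from `A` to `B`. -/
abbrev unitMap (A B : Type v) [Ring A] [Ring B] [Module A B] : A →ₗ[A] B :=
  LinearMap.toSpanSingleton A B 1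

namespace IsRetraction

variable (h : IsRetraction S e B)
include h

theorem smul_ker (x : LinearMap.ker (unitMap A B)) : e • x = 0 := by
  refine Subtype.ext (h.inj x ?_)
  rw [mul_smul, show (x : A) • (1 : B) = 0 from x.2, smul_zero]

theorem smul_coker (x : B ⧸ LinearMap.range (unitMap A B)) : e • x = 0 := by
  obtain ⟨b, rfl⟩ := Submodule.mkQ_surjective _ x
  obtain ⟨a, ha⟩ := h.surj b
  rw [← map_smul, ha]
  exact (Submodule.Quotient.mk_eq_zero _).2 ⟨e * a, rfl⟩

theorem extZero_all {Y : Type v} [AddCommGroup Y] [Module A Y] (h0 : ExtZero A S Y 0)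
    (h1 : ExtZero A S Y 1) : ∀ n, ExtZero A S Y n
  | 0 => h0
  | 1 => h1
  | n + 2 => h.ext_add_two Y n

variable [IsArtinianRing A]

/-- Kernel and cokernel of `A → B` are filtered by `S`. So `f` vanishes on the kernel, the induced
map on the image extends to `B` because `Ext¹(coker, Z) = 0`, and the extension is unique because
`Hom(coker, Z) = 0`. -/
theorem existsUnique_lift {Z : Type v} [AddCommGroup Z] [Module A Z] (h0 : ExtZero A S Z 0)
    (h1 : ExtZero A S Z 1) (f : A →ₗ[A] Z) : ∃! g : B →ₗ[A] Z, g ∘ₗ unitMap A B = f := by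
  have := h.finite
  set u := unitMap A B
  have hk : LinearMap.ker u ≤ LinearMap.ker f := fun x hx => LinearMap.congr_fun
    (extZero_zero_iff.1 (h.extZero_of_smul_eq_zero h.smul_ker h0)
      (f ∘ₗ (LinearMap.ker u).subtype)) ⟨x, hx⟩
  obtain ⟨g, hg⟩ := (h.extZero_of_smul_eq_zero h.smul_coker h1).exists_extend
    (Submodule.injective_subtype _) (Submodule.mkQ_surjective _)
    (LinearMap.exact_subtype_mkQ (LinearMap.range u))
    ((LinearMap.ker u).liftQ f hk ∘ₗ u.quotKerEquivRange.symm.toLinearMap)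
  have hg' : g ∘ₗ u = f := by
    refine LinearMap.ext fun a => ?_
    have := LinearMap.congr_fun hg ⟨u a, a, rfl⟩
    simp only [LinearMap.comp_apply, Submodule.subtype_apply] at this
    rw [LinearMap.comp_apply, this]
    have h2 : u.quotKerEquivRange.symm ⟨u a, a, rfl⟩ = Submodule.Quotient.mk a :=
      u.quotKerEquivRange_symm_apply_image a _
    erw [h2]
    rfl
  refine ⟨g, hg', fun g' hg'' => ?_⟩
  have hz : LinearMap.range u ≤ LinearMap.ker (g' - g) := by
    rintro _ ⟨a, rfl⟩
    have := LinearMap.congr_fun (hg''.trans hg'.symm) a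
    simpa [sub_eq_zero] using this
  have := extZero_zero_iff.1 (h.extZero_of_smul_eq_zero h.smul_coker h0)
    ((LinearMap.range u).liftQ _ hz)
  refine LinearMap.ext fun b => sub_eq_zero.1 ?_
  exact LinearMap.congr_fun this (Submodule.Quotient.mk b)

theorem finPD_ring : FinPD A B := by
  have := h.finite
  set u := unitMap A B
  have h1 : FinPD A (LinearMap.range u) := FinPD.right (Submodule.injective_subtype _)
    u.surjective_rangeRestrict (f := (LinearMap.ker u).subtype) (by
      rw [← LinearMap.ker_rangeRestrict]
      exact LinearMap.exact_subtype_ker_map _)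
    (h.finPD_of_smul_eq_zero h.smul_ker) FinPD.of_projective
  exact FinPD.mid (Submodule.injective_subtype _) (Submodule.mkQ_surjective _)
    (LinearMap.exact_subtype_mkQ _) h1 (h.finPD_of_smul_eq_zero h.smul_coker)

/-- Kernel and cokernel of `A → B` have no extensions into `S^⊥`, so `B` behaves like a projective
`A`-module with respect to `S^⊥`. -/
theorem extZero_ring {Y : Type v} [AddCommGroup Y] [Module A Y] (h0 : ExtZero A S Y 0)
    (h1 : ExtZero A S Y 1) (n : ℕ) : ExtZero A B Y (n + 1) := by
  have := h.finite
  set u := unitMap A B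
  have h2 : ExtZero A (LinearMap.range u) Y (n + 1) :=
    ExtZero.contra_right (Submodule.injective_subtype _)
      u.surjective_rangeRestrict (f := (LinearMap.ker u).subtype) (by
        rw [← LinearMap.ker_rangeRestrict]
        exact LinearMap.exact_subtype_ker_map _)
      (h.extZero_of_smul_eq_zero h.smul_ker (h.extZero_all h0 h1 n)) .of_projective
  exact ExtZero.contra_mid (Submodule.injective_subtype _) (Submodule.mkQ_surjective _)
    (LinearMap.exact_subtype_mkQ _) h2
    (h.extZero_of_smul_eq_zero h.smul_coker (h.extZero_all h0 h1 _))

end IsRetraction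
end Retraction

/-! ### Comparing modules over `A` and over `B` -/

section RetractionModules

variable {A : Type v} [Ring A] [IsArtinianRing A] {S : Type v} [AddCommGroup S] [Module A S]
  {e : A} {B : Type v} [Ring B] [Module A B] [IsScalarTower A B B]

namespace IsRetraction

variable (h : IsRetraction S e B)
include h

theorem isArtinianRing : IsArtinianRing B :=
  have := h.finite
  isArtinian_of_tower A (inferInstance : IsArtinian A B)

theorem isNoetherianRing : IsNoetherianRing B :=
  have := h.isArtinianRing
  inferInstance

section

variable {X Y : Type v} [AddCommGroup X] [Module A X] [Module B X] [IsScalarTower A B X]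
  [AddCommGroup Y] [Module A Y] [Module B Y] [IsScalarTower A B Y]

omit [IsArtinianRing A] [IsScalarTower A B B] in
theorem finite_of_finite [Module.Finite B X] : Module.Finite A X :=
  have := h.finite
  Module.Finite.trans B X

/-- As `Ext²(S, -) = 0`, the vanishing of `Ext¹(S, -)` passes from `B^m` to its quotients. Applied
to the kernel of `B^m → X`, it then forces `Hom(S, X) = 0`. -/
theorem perp [Module.Finite B X] : ExtZero A S X 0 ∧ ExtZero A S X 1 := by
  have := h.isNoetherianRing
  have key : ∀ (X : Type v) [AddCommGroup X] [Module A X] [Module B X] [IsScalarTower A B X]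
      [Module.Finite B X], ExtZero A S X 1 := by
    intro X _ _ _ _ _
    obtain ⟨m, g, hg⟩ := Module.Finite.exists_fin' B X
    exact ExtZero.cov_right (f := (LinearMap.ker g).subtype.restrictScalars A)
      (g := g.restrictScalars A) (Submodule.injective_subtype _) hg
      (LinearMap.exact_subtype_ker_map g) (h.ext.pi_one m) (h.ext_add_two _ 0)
  refine ⟨?_, key X⟩
  obtain ⟨m, g, hg⟩ := Module.Finite.exists_fin' B X
  exact ExtZero.cov_right (f := (LinearMap.ker g).subtype.restrictScalars A)
    (g := g.restrictScalars A) (Submodule.injective_subtype _) hg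
    (LinearMap.exact_subtype_ker_map g) (h.hom.pi_zero m) (key _)

theorem eq_zero_of_smul [Module.Finite B X] {x : X} (hx : ∀ a : A, e • a • x = 0) : x = 0 :=
  h.eq_zero_of_smul_smul h.perp.1 hx

omit [IsArtinianRing A] [IsScalarTower A B B] in
theorem exists_smul_eq (b : B) : ∃ a : A, ∀ (X : Type v) [AddCommGroup X] [Module A X]
    [Module B X] [IsScalarTower A B X] (x : X), e • b • x = (e * a) • x := by
  obtain ⟨a, ha⟩ := h.surj b
  refine ⟨a, fun X _ _ _ _ x => ?_⟩
  rw [← smul_assoc, ha, smul_assoc, one_smul]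

/-- After multiplication by `e a`, the scalar `b` may be replaced by an element of `A`. Hence `g (b
x) - b g x` is killed by `eA`, and there is no such nonzero element in a module of `S^⊥`. -/
theorem map_smul_of_linearMap [Module.Finite B Y] (g : X →ₗ[A] Y) (b : B) (x : X) :
    g (b • x) = b • g x := by
  refine sub_eq_zero.1 (h.eq_zero_of_smul fun a => ?_)
  obtain ⟨c, hc⟩ := h.exists_smul_eq (a • b)
  have h1 := hc X x
  have h2 := hc Y (g x)
  rw [smul_assoc] at h1 h2
  rw [smul_sub, smul_sub, ← map_smul, ← map_smul, h1, h2, map_smul, sub_self]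

/-- Homomorphisms of `A`-modules between finitely generated `B`-modules are `B`-linear. -/
def extendScalars [Module.Finite B Y] (g : X →ₗ[A] Y) : X →ₗ[B] Y where
  toFun := g
  map_add' := g.map_add
  map_smul' := h.map_smul_of_linearMap g

/-- Free `B`-modules of finite rank have finite projective dimension over `A`, so a finite
resolution over `B` suffices. -/
theorem finPD_restrictScalars [Module.Finite B X] (hX : FinPD B X) : FinPD A X := by
  have := h.isNoetherianRing
  obtain ⟨n, hn⟩ := hX
  induction n generalizing X with
  | zero =>
    have : Subsingleton X := ModuleCat.subsingleton_of_isZero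
      ((hasProjectiveDimensionLT_zero_iff_isZero (ModuleCat.of B X)).1 hn)
    exact .of_subsingleton
  | succ n ih =>
    obtain ⟨m, g, hg⟩ := Module.Finite.exists_fin' B X
    have hfin : FinPD A (Fin m → B) := h.finPD_ring.fin_pi m
    rcases n with _ | n
    · have : Projective (ModuleCat.of B X) :=
        projective_iff_hasProjectiveDimensionLT_one.2 hn
      have : Module.Projective B X := (IsProjective.iff_projective X).2 this
      obtain ⟨s, hs⟩ := Module.projective_lifting_property g LinearMap.id hg
      exact hfin.of_retract (s.restrictScalars A) (g.restrictScalars A)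
        (LinearMap.ext fun x => LinearMap.congr_fun hs x)
    · have hse := shortExact_of_exact (Submodule.injective_subtype _) hg
        (LinearMap.exact_subtype_ker_map g)
      have : Projective (ModuleCat.of B (Fin m → B)) :=
        (IsProjective.iff_projective (Fin m → B)).1 inferInstance
      have hK := (hse.hasProjectiveDimensionLT_X₃_iff n this).1 hn
      exact FinPD.right (f := (LinearMap.ker g).subtype.restrictScalars A)
        (g := g.restrictScalars A) (Submodule.injective_subtype _) hg
        (LinearMap.exact_subtype_ker_map g) (ih hK) hfin

/-- Dimension shifting along free `B`-modules, which have no higher extensions over `A` into `S^⊥`.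
In degree one the kernel of the cover splits off `A`-linearly, and such a splitting is automatically
`B`-linear. -/
theorem finPD_of_extZero (n : ℕ) : ∀ (X : Type v) [AddCommGroup X] [Module A X] [Module B X]
    [IsScalarTower A B X] [Module.Finite B X],
    (∀ (Y : Type v) [AddCommGroup Y] [Module A Y] [Module B Y] [IsScalarTower A B Y]
      [Module.Finite B Y], ExtZero A X Y (n + 1)) → FinPD B X := by
  have := h.isNoetherianRing
  induction n with
  | zero =>
    intro X _ _ _ _ _ hX
    obtain ⟨m, g, hg⟩ := Module.Finite.exists_fin' B X
    obtain ⟨q, hq⟩ := (hX (LinearMap.ker g)).exists_extend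
      (f := (LinearMap.ker g).subtype.restrictScalars A)
      (g := g.restrictScalars A) (Submodule.injective_subtype _) hg
      (LinearMap.exact_subtype_ker_map g) LinearMap.id
    have hp : FinPD B (Fin m → B) := .of_projective
    refine FinPD.right (Submodule.injective_subtype _) hg (LinearMap.exact_subtype_ker_map g)
      (hp.of_retract (Submodule.subtype _) (h.extendScalars q) ?_) hp
    exact LinearMap.ext fun x => LinearMap.congr_fun hq x
  | succ n ih =>
    intro X _ _ _ _ _ hX
    obtain ⟨m, g, hg⟩ := Module.Finite.exists_fin' B X
    refine FinPD.right (Submodule.injective_subtype _) hg (LinearMap.exact_subtype_ker_map g)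
      (ih _ fun Y _ _ _ _ _ => ?_) .of_projective
    exact ExtZero.contra_left (f := (LinearMap.ker g).subtype.restrictScalars A)
      (g := g.restrictScalars A) (Submodule.injective_subtype _) hg
      (LinearMap.exact_subtype_ker_map g)
      ((h.extZero_ring h.perp.1 h.perp.2 n).fin_pi m) (hX Y)

theorem finPD_iff [Module.Finite B X] : FinPD A X ↔ FinPD B X := by
  refine ⟨fun hX => ?_, h.finPD_restrictScalars⟩
  obtain ⟨n, hn⟩ := hX
  exact h.finPD_of_extZero n X fun Y _ _ _ _ _ =>
    HasProjectiveDimensionLT.subsingleton _ n (n + 1) (by lia) (ModuleCat.of A Y)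

end
end IsRetraction
end RetractionModules

/-! ### Global dimension and the simple modules -/

section GlobalDim

variable {A : Type v} [Ring A]

theorem hasProjectiveDimensionLT_of_forall_simple {M : Type v} [AddCommGroup M] [Module A M] (hM : IsFiniteLength A M) (m : ℕ)
    (hm : ∀ T : ModuleCat.{v} A, IsSimpleModule A T → HasProjectiveDimensionLT T m) :
    HasProjectiveDimensionLT (ModuleCat.of A M) m := by
  induction hM with
  | @of_subsingleton M _ _ _ =>
    have := (hasProjectiveDimensionLT_zero_iff_isZero (ModuleCat.of A M)).2
      (ModuleCat.isZero_of_subsingleton _)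
    exact hasProjectiveDimensionLT_of_ge (ModuleCat.of A M) 0 m (by lia)
  | @of_simple_quotient M _ _ N hN hNl ih =>
    have hse := shortExact_of_exact N.injective_subtype N.mkQ_surjective
      (LinearMap.exact_subtype_mkQ N)
    exact hse.hasProjectiveDimensionLT_X₂ m ih (hm (ModuleCat.of A (M ⧸ N)) hN)

/-- Finitely many simple modules have a common bound on their projective dimensions, and the bound
passes to modules of finite length. -/
theorem globalDim_lt_top_iff [IsArtinianRing A] :
    globalDim A < ⊤ ↔ ∀ T : ModuleCat.{v} A, IsSimpleModule A T → FinPD A T := by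
  constructor
  · intro h T hT
    have : Module.Finite A T := inferInstance
    exact (projectiveDimension_lt_top_iff T).1
      (lt_of_le_of_lt (le_iSup (fun M : {M : ModuleCat.{v} A // Module.Finite A M} =>
        projectiveDimension M.1) ⟨T, this⟩) h)
  · intro h
    have hfin := finite_simpleClasses (A := A)
    have hb : ∀ c ∈ simpleClasses A, ∃ n : ℕ, ∀ T : ModuleCat.{v} A, isoClass T = c →
        HasProjectiveDimensionLT T n := by
      rintro c ⟨T, hT, rfl⟩
      obtain ⟨n, hn⟩ := h T hT
      refine ⟨n, fun T' hT' => ?_⟩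
      obtain ⟨i⟩ := isoClass_eq_iff.1 hT'
      exact hasProjectiveDimensionLT_of_iso (X := ModuleCat.of A T) (i.symm.toModuleIso) n
    choose! n hn using hb
    obtain ⟨m, hm⟩ := (hfin.image n).bddAbove
    have hm' : ∀ T : ModuleCat.{v} A, IsSimpleModule A T → HasProjectiveDimensionLT T m := by
      intro T hT
      have hc : isoClass T ∈ simpleClasses A := ⟨T, hT, rfl⟩
      have := hn _ hc T rfl
      exact hasProjectiveDimensionLT_of_ge T _ m (hm ⟨_, hc, rfl⟩)
    refine lt_of_le_of_lt (iSup_le fun M => ?_ : _ ≤ ((m : ℕ) : WithBot ℕ∞)) ?_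
    · have := M.2
      have hM := hasProjectiveDimensionLT_of_forall_simple (M := M.1) (isFiniteLength_iff_isNoetherian_isArtinian.2
        ⟨inferInstance, inferInstance⟩) m hm'
      have hM' : HasProjectiveDimensionLT M.1 (m + 1) :=
        hasProjectiveDimensionLT_of_ge M.1 m (m + 1) (by lia)
      exact (projectiveDimension_le_iff M.1 m).2 hM'
    · exact WithBot.coe_lt_coe.2 (ENat.natCast_lt_top m)

end GlobalDim

/-- The simples of `A` and of `B` are matched by a relation, embedding of one in the other, rather
than by a map. -/
theorem ncard_eq_of_rel {α β : Type*} {s : Set α} {t : Set β} (r : α → β → Prop)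
    (hs : ∀ a ∈ s, ∃ b ∈ t, r a b) (ht : ∀ b ∈ t, ∃ a ∈ s, r a b)
    (hf : ∀ a b b', r a b → r a b' → b = b') (hi : ∀ a a' b, r a b → r a' b → a = a') :
    s.ncard = t.ncard := by
  choose f hf1 hf2 using hs
  refine Set.ncard_congr f hf1 (fun a b ha hb hab => hi _ _ _ (hf2 a ha) (hab ▸ hf2 b hb))
    fun b hb => ?_
  obtain ⟨a, ha, hab⟩ := ht b hb
  exact ⟨a, ha, hf _ _ _ (hf2 a ha) hab⟩

/-! ### Simple modules of a retraction -/

section RetractionSimple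

variable {A : Type v} [Ring A] [IsArtinianRing A] {S : Type v} [AddCommGroup S] [Module A S]
  {e : A} {B : Type v} [Ring B] [Module A B] [IsScalarTower A B B]

namespace IsRetraction

variable (h : IsRetraction S e B)
include h

theorem not_iso_of_injective {X T : Type v} [AddCommGroup X] [Module A X] [Module B X]
    [IsScalarTower A B X] [Module.Finite B X] [AddCommGroup T] [Module A T] [IsSimpleModule A T]
    {i : T →ₗ[A] X} (hi : Function.Injective i) : ¬ Nonempty (T ≃ₗ[A] S) := by
  rintro ⟨j⟩
  have h1 := extZero_zero_iff.1 h.perp.1 (i ∘ₗ j.symm.toLinearMap)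
  have := IsSimpleModule.nontrivial A T
  obtain ⟨t, ht⟩ := exists_ne (0 : T)
  refine ht (hi ?_)
  simpa using LinearMap.congr_fun h1 (j t)

omit [IsArtinianRing A] [IsScalarTower A B B] in
/-- The image of `e` in the `B`-submodule generated by an `A`-submodule `U` is contained in `U`. -/
theorem smul_mem_of_mem_span {X : Type v} [AddCommGroup X] [Module A X] [Module B X]
    [IsScalarTower A B X] (U : Submodule A X) {x : X}
    (hx : x ∈ Submodule.span B (U : Set X)) : e • x ∈ U := by
  have key : ∀ a : A, e • a • x ∈ U := by
    induction hx using Submodule.span_induction with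
    | mem x hx => exact fun a => U.smul_mem _ (U.smul_mem _ hx)
    | zero => intro a; rw [smul_zero, smul_zero]; exact U.zero_mem
    | add x y _ _ hx hy => intro a; rw [smul_add, smul_add]; exact U.add_mem (hx a) (hy a)
    | smul b x _ hx =>
      intro a
      obtain ⟨c, hc⟩ := h.exists_smul_eq (a • b)
      rw [← smul_assoc a b x, hc, mul_smul]
      exact hx c
  simpa using key 1

section

variable {X X' T T' : Type v} [AddCommGroup X] [Module A X] [Module B X] [IsScalarTower A B X]
  [IsSimpleModule B X] [AddCommGroup X'] [Module A X'] [Module B X'] [IsScalarTower A B X']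
  [IsSimpleModule B X'] [AddCommGroup T] [Module A T] [IsSimpleModule A T] [AddCommGroup T']
  [Module A T'] [IsSimpleModule A T']

-- Simplicity gives `B U = X`, and `e B U ⊆ U`. Consequently `X` modulo a simple `A`-submodule is
-- killed by `e`.
omit [IsArtinianRing A] [IsScalarTower A B B] in
theorem smul_mem_of_ne_bot {U : Submodule A X} (hU : U ≠ ⊥) (x : X) : e • x ∈ U := by
  refine h.smul_mem_of_mem_span U ?_
  rcases eq_bot_or_eq_top (Submodule.span B (U : Set X)) with h1 | h1
  · exact absurd ((Submodule.eq_bot_iff _).2 fun u hu =>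
      (Submodule.mem_bot B).1 (h1 ▸ Submodule.subset_span hu)) hU
  · rw [h1]; trivial

omit [IsScalarTower A B B] in
theorem exists_simple_injective (X : Type v) [AddCommGroup X] [Module A X] [Module B X]
    [IsScalarTower A B X] [IsSimpleModule B X] :
    ∃ T : Submodule A X, IsSimpleModule A T :=
  have := h.finite_of_finite (X := X)
  have := IsSimpleModule.nontrivial B X
  exists_isSimpleModule_le X

omit [IsScalarTower A B B] [IsArtinianRing A] h in
theorem range_ne_bot {i : T →ₗ[A] X} (hi : Function.Injective i) : LinearMap.range i ≠ ⊥ := by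
  have := IsSimpleModule.nontrivial A T
  intro h0
  obtain ⟨t, ht⟩ := exists_ne (0 : T)
  exact ht (hi (by simpa using LinearMap.congr_fun (LinearMap.range_eq_bot.1 h0) t))

/-- As `T` is not `S`, it equals `e T`, so its image lies in every nonzero `A`-submodule of `X`, in
particular in that of `T'`. -/
theorem nonempty_linearEquiv_of_injective {i : T →ₗ[A] X} (hi : Function.Injective i)
    {i' : T' →ₗ[A] X} (hi' : Function.Injective i') : Nonempty (T ≃ₗ[A] T') := by
  have hT := h.not_iso_of_injective hi
  have hmem : ∀ t, i t ∈ LinearMap.range i' := fun t => by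
    rw [← h.smul_eq_self T hT t, map_smul]
    exact h.smul_mem_of_ne_bot (range_ne_bot hi') _
  let j : T →ₗ[A] LinearMap.range i' := i.codRestrict _ hmem
  have hj : Function.Injective j := fun a b hab => hi (congrArg Subtype.val hab)
  have := IsSimpleModule.congr (LinearEquiv.ofInjective i' hi').symm
  have := IsSimpleModule.nontrivial A T
  have hj0 : j ≠ 0 := by
    rintro h0
    obtain ⟨t, ht⟩ := exists_ne (0 : T)
    exact ht (hj (by simp [h0]))
  exact ⟨(LinearEquiv.ofBijective j (LinearMap.bijective_of_ne_zero hj0)).trans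
    (LinearEquiv.ofInjective i' hi').symm⟩

/-- The `B`-span `W` of the diagonal copy of `T` in `X × X'` is the graph of an isomorphism, because
`e W` stays inside that diagonal copy. -/
theorem nonempty_linearEquiv_ring_of_injective {i : T →ₗ[A] X} (hi : Function.Injective i)
    {i' : T →ₗ[A] X'} (hi' : Function.Injective i') : Nonempty (X ≃ₗ[B] X') := by
  have hT := h.not_iso_of_injective hi
  have := IsSimpleModule.nontrivial A T
  obtain ⟨t, ht⟩ := exists_ne (0 : T)
  have het := h.smul_eq_self T hT
  let G : Submodule A (X × X') := LinearMap.range (i.prod i')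
  let W : Submodule B (X × X') := Submodule.span B (G : Set (X × X'))
  have hW : ∀ w ∈ W, e • w ∈ G := fun w hw => h.smul_mem_of_mem_span G hw
  have htW : (i t, i' t) ∈ W := Submodule.subset_span ⟨t, rfl⟩
  let p : W →ₗ[B] X := LinearMap.fst B X X' ∘ₗ W.subtype
  let p' : W →ₗ[B] X' := LinearMap.snd B X X' ∘ₗ W.subtype
  have hp0 : p ≠ 0 := fun h0 => ht (hi ((LinearMap.congr_fun h0 ⟨_, htW⟩ : i t = 0).trans
    i.map_zero.symm))
  have hp0' : p' ≠ 0 := fun h0 => ht (hi' ((LinearMap.congr_fun h0 ⟨_, htW⟩ : i' t = 0).trans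
    i'.map_zero.symm))
  have hps := LinearMap.surjective_of_ne_zero hp0
  have hps' := LinearMap.surjective_of_ne_zero hp0'
  -- Otherwise `W` contains `(0, i' t)`. Applying `e` gives a point `(i s, i' s)` of the diagonal
  -- with `i s = 0`, so `s = 0` and `i' t = e i' t = 0`.
  have hk : LinearMap.ker p ≤ LinearMap.ker p' := by
    by_contra hle
    have hmap : (LinearMap.ker p).map p' = ⊤ := by
      refine (eq_bot_or_eq_top _).resolve_left fun h0 => hle fun w hw => ?_
      exact (Submodule.mem_bot B).1 (h0 ▸ Submodule.mem_map_of_mem hw)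
    obtain ⟨w, hw, hwt⟩ : i' t ∈ (LinearMap.ker p).map p' := hmap ▸ trivial
    obtain ⟨s, hs⟩ := hW w w.2
    have hw1 : (w : X × X').1 = 0 := hw
    have hw2 : (w : X × X').2 = i' t := hwt
    have h1 : i s = 0 := by
      have := congrArg Prod.fst hs
      simpa [hw1] using this
    have h2 : i' s = e • i' t := by
      have := congrArg Prod.snd hs
      simpa [hw2] using this
    rw [hi (h1.trans i.map_zero.symm), map_zero, ← map_smul, het] at h2
    exact ht (hi' (h2.symm.trans i'.map_zero.symm))
  have hk' : LinearMap.ker p' ≤ LinearMap.ker p := by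
    by_contra hle
    have hmap : (LinearMap.ker p').map p = ⊤ := by
      refine (eq_bot_or_eq_top _).resolve_left fun h0 => hle fun w hw => ?_
      exact (Submodule.mem_bot B).1 (h0 ▸ Submodule.mem_map_of_mem hw)
    obtain ⟨w, hw, hwt⟩ : i t ∈ (LinearMap.ker p').map p := hmap ▸ trivial
    obtain ⟨s, hs⟩ := hW w w.2
    have hw1 : (w : X × X').1 = i t := hwt
    have hw2 : (w : X × X').2 = 0 := hw
    have h1 : i s = e • i t := by
      have := congrArg Prod.fst hs
      simpa [hw1] using this
    have h2 : i' s = 0 := by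
      have := congrArg Prod.snd hs
      simpa [hw2] using this
    rw [hi' (h2.trans i'.map_zero.symm), map_zero, ← map_smul, het] at h1
    exact ht (hi (h1.symm.trans i.map_zero.symm))
  exact ⟨(p.quotKerEquivOfSurjective hps).symm.trans
    ((Submodule.quotEquivOfEq _ _ (le_antisymm hk hk')).trans
      (p'.quotKerEquivOfSurjective hps'))⟩

-- Let `U` be the image in `B` of the annihilator of `t`. If its `B`-span contained `1`, then `e •
-- 1` would come from some `m` with `m t = 0`, whence `e = e m` and `e t = 0`. A maximal left ideal
-- above the span receives the wanted embedding of `T` in its quotient.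
omit [IsArtinianRing A] in
theorem exists_simple_of_not_iso (hT : ¬ Nonempty (T ≃ₗ[A] S)) :
    ∃ N : Submodule B B, IsSimpleModule B (B ⧸ N) ∧
      ∃ i : T →ₗ[A] B ⧸ N, Function.Injective i := by
  have := IsSimpleModule.nontrivial A T
  obtain ⟨t, ht⟩ := exists_ne (0 : T)
  have hf := IsSimpleModule.toSpanSingleton_surjective A ht
  set f := LinearMap.toSpanSingleton A T t
  set U : Submodule A B := (LinearMap.ker f).map (unitMap A B)
  have hU : Submodule.span B (U : Set B) ≠ ⊤ := by
    intro h1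
    obtain ⟨m, hm, hm1⟩ := h.smul_mem_of_mem_span U (x := (1 : B)) (h1 ▸ trivial)
    have hm1' : m • (1 : B) = e • (1 : B) := hm1
    have h2 := h.inj (e - m) (by
      rw [mul_smul, sub_smul, hm1', sub_self, smul_zero])
    rw [mul_sub, h.idem.eq, sub_eq_zero] at h2
    have h3 : e • t = 0 := by
      rw [h2, mul_smul, show m • t = 0 from hm, smul_zero]
    exact ht ((h.smul_eq_self T hT t).symm.trans h3)
  obtain ⟨N, hN, hNs⟩ := exists_le_isSimpleModule_quotient hU
  refine ⟨N, hNs, ?_⟩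
  let g : A →ₗ[A] B ⧸ N := LinearMap.toSpanSingleton A (B ⧸ N) (Submodule.Quotient.mk 1)
  have hg : LinearMap.ker f ≤ LinearMap.ker g := by
    intro m hm
    have h1 : m • (1 : B) ∈ N := hN (Submodule.subset_span ⟨m, hm, rfl⟩)
    exact (Submodule.Quotient.mk_eq_zero N).2 h1
  refine ⟨(LinearMap.ker f).liftQ g hg ∘ₗ (f.quotKerEquivOfSurjective hf).symm.toLinearMap, ?_⟩
  refine LinearMap.injective_of_ne_zero fun h0 => ?_
  have := IsSimpleModule.nontrivial B (B ⧸ N)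
  have h1 := LinearMap.congr_fun h0 (f.quotKerEquivOfSurjective hf (Submodule.Quotient.mk 1))
  simp only [LinearMap.comp_apply, LinearEquiv.coe_coe, LinearEquiv.symm_apply_apply,
    Submodule.liftQ_apply, LinearMap.zero_apply] at h1
  have h2 : (Submodule.Quotient.mk 1 : B ⧸ N) = 0 := by simpa [g] using h1
  obtain ⟨x, hx⟩ := exists_ne (0 : B ⧸ N)
  obtain ⟨b, rfl⟩ := N.mkQ_surjective x
  refine hx ?_
  have : N.mkQ b = b • (Submodule.Quotient.mk 1 : B ⧸ N) := by
    rw [← Submodule.Quotient.mk_smul, smul_eq_mul, mul_one]; rfl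
  rw [this, h2, smul_zero]

/-- `X` modulo the image of `T` is killed by `e`, so it has finite projective dimension over `A`. -/
theorem finPD_iff_of_injective {i : T →ₗ[A] X} (hi : Function.Injective i) :
    FinPD A T ↔ FinPD B X := by
  have := h.finite_of_finite (X := X)
  rw [← h.finPD_iff]
  have hq : FinPD A (X ⧸ LinearMap.range i) := h.finPD_of_smul_eq_zero fun x => by
    obtain ⟨x, rfl⟩ := Submodule.mkQ_surjective _ x
    rw [← map_smul]
    exact (Submodule.Quotient.mk_eq_zero _).2 (h.smul_mem_of_ne_bot (range_ne_bot hi) x)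
  have hex : Function.Exact i (LinearMap.range i).mkQ := by
    rw [LinearMap.exact_iff, Submodule.ker_mkQ]
  exact ⟨fun hT => FinPD.mid hi (Submodule.mkQ_surjective _) hex hT hq,
    fun hX => FinPD.left hi (Submodule.mkQ_surjective _) hex hX hq⟩

end

end IsRetraction
end RetractionSimple

/-! ### Counting simple modules under a retraction -/

section RetractionCount

theorem exists_module_isScalarTower (A : Type v) [Ring A] {B : Type v} [Ring B] [Module A B]
    [IsScalarTower A B B] (X : Type v) [AddCommGroup X] [Module B X] :
    ∃ _ : Module A X, IsScalarTower A B X := by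
  let := Module.compHom X (RingHom.smulOneHom : A →+* B)
  refine ⟨inferInstance, ⟨fun a b x => ?_⟩⟩
  change (a • b) • x = (a • (1 : B)) • b • x
  rw [← mul_smul, smul_mul_assoc, one_mul]

/-- An additive map that is linear with respect to `A → B`, as a homomorphism of `A`-modules. -/
def linearMapOfSMulOne {A B : Type v} [Ring A] [Ring B] [Module A B] {T X : Type v}
    [AddCommGroup T] [Module A T] [AddCommGroup X] [Module A X] [Module B X] [IsScalarTower A B X]
    (i : T →+ X) (hi : ∀ (a : A) t, i (a • t) = (a • (1 : B)) • i t) : T →ₗ[A] X where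
  toFun := i
  map_add' := i.map_add
  map_smul' a t := by rw [hi, smul_assoc, one_smul, RingHom.id_apply]

variable {A : Type v} [Ring A] [IsArtinianRing A] {S : Type v} [AddCommGroup S] [Module A S]
  {e : A} {B : Type v} [Ring B] [Module A B] [IsScalarTower A B B]

namespace IsRetraction

variable (h : IsRetraction S e B)
include h

/-- Embedding of `T` in `X` is a one-to-one correspondence between the simples other than `S` and
the simple `B`-modules; the extra one on the left is `S`. The predicates serve to count all simples
and those of finite projective dimension at once. -/
theorem ncard_classes (pA : ModuleCat.{v} A → Prop) (pB : ModuleCat.{v} B → Prop)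
    (hS : pA (ModuleCat.of A S))
    (hAB : ∀ (T : ModuleCat.{v} A) (X : ModuleCat.{v} B) [Module A X] [IsScalarTower A B X]
      (_ : IsSimpleModule A T) (_ : IsSimpleModule B X) (i : T →ₗ[A] X),
      Function.Injective i → (pA T ↔ pB X)) :
    {c | ∃ T : ModuleCat.{v} A, (IsSimpleModule A T ∧ pA T) ∧ isoClass T = c}.ncard =
      {c | ∃ X : ModuleCat.{v} B, (IsSimpleModule B X ∧ pB X) ∧ isoClass X = c}.ncard + 1 := by
  set s := {c | ∃ T : ModuleCat.{v} A, (IsSimpleModule A T ∧ pA T) ∧ isoClass T = c}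
  set t := {c | ∃ X : ModuleCat.{v} B, (IsSimpleModule B X ∧ pB X) ∧ isoClass X = c}
  have hsS : isoClass (ModuleCat.of A S) ∈ s := ⟨ModuleCat.of A S, ⟨h.simple, hS⟩, rfl⟩
  have hsf : s.Finite := finite_simpleClasses.subset fun c ⟨T, hT, hc⟩ => ⟨T, hT.1, hc⟩
  rw [← Set.ncard_sdiff_singleton_add_one hsS hsf]
  congr 1
  -- The embedding is an additive map compatible with scalars, since a bare `B`-module has no chosen
  -- `A`-module structure.
  refine ncard_eq_of_rel (fun a b => ∃ (T : ModuleCat.{v} A) (X : ModuleCat.{v} B) (i : T →+ X),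
    IsSimpleModule A T ∧ IsSimpleModule B X ∧ (∀ (a : A) t, i (a • t) = (a • (1 : B)) • i t) ∧
      Function.Injective i ∧ isoClass T = a ∧ isoClass X = b) ?_ ?_ ?_ ?_
  · rintro _ ⟨⟨T, ⟨hT, hp⟩, rfl⟩, hTS⟩
    obtain ⟨N, hN, i, hi⟩ := h.exists_simple_of_not_iso (T := T) (fun h' => hTS
      (isoClass_eq_iff.2 h'))
    refine ⟨_, ⟨ModuleCat.of B (B ⧸ N), ⟨hN, ?_⟩, rfl⟩, T, ModuleCat.of B (B ⧸ N),
      i.toAddMonoidHom, hT, hN, fun a t => ?_, hi, rfl, rfl⟩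
    · let : Module A (ModuleCat.of B (B ⧸ N)) := inferInstanceAs (Module A (B ⧸ N))
      have : IsScalarTower A B (ModuleCat.of B (B ⧸ N)) :=
        inferInstanceAs (IsScalarTower A B (B ⧸ N))
      exact (hAB T (ModuleCat.of B (B ⧸ N)) hT hN i hi).1 hp
    · change i (a • t) = (a • (1 : B)) • i t
      rw [map_smul, smul_assoc, one_smul]
  · rintro _ ⟨X, ⟨hX, hp⟩, rfl⟩
    obtain ⟨_, _⟩ := exists_module_isScalarTower A (B := B) X
    obtain ⟨T, hT⟩ := h.exists_simple_injective X
    refine ⟨isoClass (ModuleCat.of A T), ⟨⟨ModuleCat.of A T, ⟨hT, ?_⟩, rfl⟩, fun hc => ?_⟩,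
      ModuleCat.of A T, X, T.subtype.toAddMonoidHom, hT, hX, fun a t => ?_,
      T.injective_subtype, rfl, rfl⟩
    · exact (hAB (ModuleCat.of A T) X hT hX T.subtype T.injective_subtype).2 hp
    · exact h.not_iso_of_injective T.injective_subtype (isoClass_eq_iff.1 hc)
    · change ((a • t : T) : X) = (a • (1 : B)) • (t : X)
      rw [smul_assoc, one_smul]
      rfl
  · rintro a b b' ⟨T, X, i, hT, hX, hi, hij, rfl, rfl⟩ ⟨T', X', i', hT', hX', hi', hij', hc, rfl⟩
    obtain ⟨j⟩ := isoClass_eq_iff.1 hc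
    obtain ⟨_, _⟩ := exists_module_isScalarTower A (B := B) X
    obtain ⟨_, _⟩ := exists_module_isScalarTower A (B := B) X'
    let k := linearMapOfSMulOne i hi
    let k' := linearMapOfSMulOne i' hi'
    exact isoClass_eq_iff.2 (h.nonempty_linearEquiv_ring_of_injective (i := k)
      (i' := k' ∘ₗ j.symm.toLinearMap) hij (hij'.comp j.symm.injective))
  · rintro a a' b ⟨T, X, i, hT, hX, hi, hij, rfl, rfl⟩ ⟨T', X', i', hT', hX', hi', hij', rfl, hc⟩
    obtain ⟨j⟩ := isoClass_eq_iff.1 hc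
    obtain ⟨_, _⟩ := exists_module_isScalarTower A (B := B) X
    obtain ⟨_, _⟩ := exists_module_isScalarTower A (B := B) X'
    let k := linearMapOfSMulOne i hi
    let k' := linearMapOfSMulOne i' hi'
    exact isoClass_eq_iff.2 (h.nonempty_linearEquiv_of_injective (i := k)
      (i' := j.toLinearMap.restrictScalars A ∘ₗ k') hij (j.injective.comp hij'))

theorem numSimples_eq : numSimples A = numSimples B + 1 := by
  have := h.ncard_classes (fun _ => True) (fun _ => True) trivial
    (fun _ _ _ _ _ _ _ _ => Iff.rfl)
  simpa only [and_true, numSimples, simpleClasses] using this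

theorem numSimplesFiniteProjDim_eq :
    numSimplesFiniteProjDim A = numSimplesFiniteProjDim B + 1 := by
  have := h.ncard_classes (fun T => FinPD A T) (fun X => FinPD B X)
    h.finPD
    (fun T X _ _ hT hX i hi => h.finPD_iff_of_injective hi)
  simpa only [numSimplesFiniteProjDim, projectiveDimension_lt_top_iff] using this

theorem globalDim_lt_top_iff_globalDim : globalDim A < ⊤ ↔ globalDim B < ⊤ := by
  have := h.isArtinianRing
  rw [globalDim_lt_top_iff, globalDim_lt_top_iff]
  constructor
  · intro hA X hX
    obtain ⟨_, _⟩ := exists_module_isScalarTower A (B := B) X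
    obtain ⟨T, hT⟩ := h.exists_simple_injective X
    exact (h.finPD_iff_of_injective T.injective_subtype).1 (hA (ModuleCat.of A T) hT)
  · intro hB T hT
    by_cases hTS : Nonempty (T ≃ₗ[A] S)
    · exact h.finPD.congr hTS.some.symm
    · obtain ⟨N, hN, i, hi⟩ := h.exists_simple_of_not_iso hTS
      exact (h.finPD_iff_of_injective hi).2 (hB (ModuleCat.of B (B ⧸ N)) hN)

end IsRetraction
end RetractionCount

/-! ### The retraction as an endomorphism algebra -/

section Localization

variable (R : Type u) [CommRing R] {A : Type v} [Ring A] [Algebra R A] (e : A)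

/-- The right ideal `eA`, for an idempotent `e`. -/
def rightIdeal : Submodule R A := LinearMap.eqLocus (LinearMap.mulLeft R e) LinearMap.id

variable {e} in
theorem mem_rightIdeal {x : A} : x ∈ rightIdeal R e ↔ e * x = x := Iff.rfl

/-- The endomorphisms of `eA` that commute with left multiplication by `eAe`. -/
def cornerCentralizer : Subalgebra R (Module.End R (rightIdeal R e)) where
  carrier := {φ | ∀ (c : A) (x y : rightIdeal R e), (y : A) = e * c * x → (φ y : A) = e * c * φ x}
  mul_mem' hφ hψ c x y h := hφ c _ _ (hψ c x y h)
  add_mem' hφ hψ c x y h := by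
    simp only [LinearMap.add_apply, Submodule.coe_add, mul_add, hφ c x y h, hψ c x y h]
  algebraMap_mem' r c x y h := by
    simp only [Module.algebraMap_end_apply, Submodule.coe_smul, h, mul_smul_comm]

instance : Ring (cornerCentralizer R e) :=
  @Subalgebra.toRing R (Module.End R (rightIdeal R e)) _ _ _ (cornerCentralizer R e)

/-- The opposite of the algebra of endomorphisms of the left `eAe`-module `eA`. -/
abbrev CornerEnd : Type v := (cornerCentralizer R e)ᵐᵒᵖ

variable {R e} in
theorem CornerEnd.ext {φ ψ : CornerEnd R e}
    (h : ∀ x : rightIdeal R e, (φ.unop.1 x : A) = ψ.unop.1 x) : φ = ψ :=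
  MulOpposite.unop_injective (Subtype.ext (LinearMap.ext fun x => Subtype.ext (h x)))

/-- The homomorphism `A → End_{eAe}(eA)ᵒᵖ` given by right multiplication. -/
def toCornerEnd : A →ₐ[R] CornerEnd R e where
  toFun a := MulOpposite.op ⟨LinearMap.restrict (LinearMap.mulRight R a) (p := rightIdeal R e)
      (q := rightIdeal R e) (fun x hx => by
        rw [mem_rightIdeal] at *
        rw [LinearMap.mulRight_apply, ← mul_assoc, hx]),
    fun c x y h => by
      simp only [LinearMap.coe_restrict_apply, LinearMap.mulRight_apply, h, mul_assoc]⟩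
  map_one' := CornerEnd.ext fun x => by simp
  map_mul' a b := CornerEnd.ext fun x => by simp [mul_assoc]
  map_zero' := CornerEnd.ext fun x => by simp
  map_add' a b := CornerEnd.ext fun x => by simp [mul_add]
  commutes' r := CornerEnd.ext fun x => by
    simp [Algebra.algebraMap_eq_smul_one]

variable {R e} in
@[simp] theorem toCornerEnd_apply (a : A) (x : rightIdeal R e) :
    ((toCornerEnd R e a).unop.1 x : A) = x * a := rfl

/-- The module structure on the target of a homomorphism. -/
abbrev moduleOfAlgHom {R : Type u} [CommRing R] {A B : Type v} [Ring A] [Algebra R A] [Ring B]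
    [Algebra R B] (η : A →ₐ[R] B) : Module A B :=
  Module.compHom B (η : A →+* B)

theorem isScalarTower_of_algHom {R : Type u} [CommRing R] {A B : Type v} [Ring A] [Algebra R A]
    [Ring B] [Algebra R B] (η : A →ₐ[R] B) :
    let _ := moduleOfAlgHom η
    IsScalarTower A B B :=
  let _ := moduleOfAlgHom η
  ⟨fun a b c => mul_assoc (η a) b c⟩

variable [IsArtinianRing R] [Module.Finite R A] {S : Type v} [AddCommGroup S] [Module A S]

variable {e}

theorem finite_cornerEnd : Module.Finite R (CornerEnd R e) := by
  have : Module.Finite R (rightIdeal R e) := inferInstance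
  have : Module.Finite R (Module.End R (rightIdeal R e)) := inferInstance
  have : Module.Finite R (cornerCentralizer R e) :=
    inferInstanceAs (Module.Finite R (cornerCentralizer R e).toSubmodule)
  exact Module.Finite.equiv (MulOpposite.opLinearEquiv R)

/-- Everything follows from `(a φ)(x) = φ(x a)`. For a map `S → B` with `B` this algebra, `eA` kills
the image, and evaluation at `e` gives zero. Injectivity on `eA` is evaluation at `e` as well. -/
theorem isRetraction_cornerEnd (h : IsLocalizingPair S e) :
    let _ := moduleOfAlgHom (toCornerEnd R e)
    IsRetraction S e (CornerEnd R e) := by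
  intro _
  have he := h.idem
  have hsmul : ∀ (a : A) (φ : CornerEnd R e) (x y : rightIdeal R e), (y : A) = x * a →
      ((a • φ).unop.1 x : A) = φ.unop.1 y := by
    intro a φ x y hy
    have : (toCornerEnd R e a).unop.1 x = y := Subtype.ext hy.symm
    change ((φ.unop.1 ((toCornerEnd R e a).unop.1 x) : _) : A) = _
    rw [this]
  have hmem : ∀ a, e * a ∈ rightIdeal R e := fun a => by
    rw [mem_rightIdeal, ← mul_assoc, he.eq]
  have hmem1 : e ∈ rightIdeal R e := he
  have hmul : ∀ (x : rightIdeal R e) (a : A), (x : A) * a ∈ rightIdeal R e := fun x a => by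
    rw [mem_rightIdeal, ← mul_assoc, (mem_rightIdeal R).1 x.2]
  have happ : ∀ (φ : CornerEnd R e) (x y : rightIdeal R e) (c : A), (y : A) = e * c * x →
    (φ.unop.1 y : A) = e * c * φ.unop.1 x := fun φ x y c hc => φ.unop.2 c x y hc
  have := h.simple
  refine { toIsLocalizingPair := h, finite := ?_, hom := ?_, ext := ?_, inj := ?_, surj := ?_ }
  · have := finite_cornerEnd R (e := e)
    have : IsScalarTower R A (CornerEnd R e) := ⟨fun r a φ => by
      change toCornerEnd R e (r • a) * φ = r • (toCornerEnd R e a * φ)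
      rw [map_smul, smul_mul_assoc]⟩
    exact Module.Finite.of_restrictScalars_finite R A (CornerEnd R e)
  · refine extZero_zero_iff.2 fun f => LinearMap.ext fun s => CornerEnd.ext fun x => ?_
    have h1 : e • (x : A) • f s = 0 := by
      rw [← map_smul, ← map_smul, h.smul_eq_zero, map_zero]
    rw [← mul_smul] at h1
    have h2 := hsmul (e * x) (f s) ⟨e, hmem1⟩ x (by
      rw [(mem_rightIdeal R).1 x.2]; exact ((mem_rightIdeal R).1 x.2).symm)
    rw [← h2, h1]
    rfl
  · have := IsSimpleModule.nontrivial A S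
    obtain ⟨s, hs⟩ := exists_ne (0 : S)
    have hf := IsSimpleModule.toSpanSingleton_surjective A hs
    set f := LinearMap.toSpanSingleton A S s
    refine (exists_extend_iff_extZero hf).1 fun p => ?_
    have hK : ∀ x : rightIdeal R e, (x : A) ∈ LinearMap.ker f := fun x => by
      change (x : A) • s = 0
      rw [← (mem_rightIdeal R).1 x.2, mul_smul, h.smul_eq_zero]
    -- A map `p` from the annihilator of `s`, which contains `eA`, has to be `x ↦ x φ`; evaluating
    -- at `e` forces `φ(x) = p(x)(e)`.
    let φ : CornerEnd R e := MulOpposite.op ⟨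
      { toFun := fun x => (p ⟨x, hK x⟩).unop.1 ⟨e, hmem1⟩
        map_add' := fun x y => by
          have : (⟨((x + y : rightIdeal R e) : A), hK (x + y)⟩ : LinearMap.ker f) =
            ⟨x, hK x⟩ + ⟨y, hK y⟩ := rfl
          rw [this, map_add]
          rfl
        map_smul' := fun r x => by
          have h1 : (⟨((r • x : rightIdeal R e) : A), hK (r • x)⟩ : LinearMap.ker f) =
            (algebraMap R A r) • ⟨x, hK x⟩ := by
            ext
            simp [Algebra.smul_def]
          rw [h1, map_smul]
          refine Subtype.ext ?_
          rw [hsmul _ _ _ ⟨e * algebraMap R A r, hmem _⟩ rfl]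
          have h2 : (⟨e * algebraMap R A r, hmem _⟩ : rightIdeal R e) = r • ⟨e, hmem1⟩ := by
            refine Subtype.ext ?_
            change e * algebraMap R A r = r • e
            rw [← Algebra.commutes, Algebra.smul_def]
          rw [h2, map_smul]
          rfl }, by
      intro c x y hy
      change ((p ⟨y, hK y⟩).unop.1 ⟨e, hmem1⟩ : A) = e * c * (p ⟨x, hK x⟩).unop.1 ⟨e, hmem1⟩
      have h1 : (⟨y, hK y⟩ : LinearMap.ker f) = (e * c) • ⟨x, hK x⟩ := Subtype.ext hy
      have h2 : (⟨x, hK x⟩ : LinearMap.ker f) = e • ⟨x, hK x⟩ :=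
        Subtype.ext ((mem_rightIdeal R).1 x.2).symm
      rw [h1, map_smul, hsmul _ _ _ ⟨e * c, hmem c⟩ (by simp only [← mul_assoc, he.eq]), h2,
        map_smul, hsmul _ _ _ ⟨e * c * e, by rw [mul_assoc]; exact hmem _⟩ rfl,
        hsmul _ _ _ ⟨e, hmem1⟩ he.eq.symm]
      exact happ _ ⟨e, hmem1⟩ _ c rfl⟩
    refine ⟨LinearMap.toSpanSingleton A _ φ, ?_⟩
    ext x
    refine CornerEnd.ext fun v => ?_
    change (((x : A) • φ).unop.1 v : A) = (p x).unop.1 v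
    rw [hsmul _ _ _ ⟨v * x, hmul v x⟩ rfl]
    change ((p ⟨v * x, _⟩).unop.1 ⟨e, hmem1⟩ : A) = _
    have h1 : ∀ hh, (⟨v * x, hh⟩ : LinearMap.ker f) = (v : A) • x := fun _ => rfl
    rw [h1, map_smul, hsmul _ _ _ v ((mem_rightIdeal R).1 v.2).symm]
  · intro a ha
    have h1 := hsmul (e * a) 1 ⟨e, hmem1⟩ ⟨e * a, hmem a⟩ (by simp only [← mul_assoc, he.eq])
    rw [ha] at h1
    exact h1.symm
  · intro φ
    -- By linearity over `eAe`, `e φ` is right multiplication by `φ(e)`.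
    refine ⟨φ.unop.1 ⟨e, hmem1⟩, CornerEnd.ext fun x => ?_⟩
    have h1 : e * (φ.unop.1 ⟨e, hmem1⟩ : A) = φ.unop.1 ⟨e, hmem1⟩ :=
      (mem_rightIdeal R).1 (φ.unop.1 ⟨e, hmem1⟩).2
    rw [h1, hsmul _ _ _ ⟨x * e, hmul x e⟩ rfl, hsmul _ _ _ ⟨_, hmul x _⟩ rfl]
    have hx := (mem_rightIdeal R).1 x.2
    rw [happ φ ⟨e, hmem1⟩ _ x (by rw [hx]), hx]
    rfl

/-- Both `B` and the endomorphism algebra are universal for `S^⊥`. The comparison maps under `A`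
transfer the bijectivity on `eA` from the model to `B`. -/
theorem IsLeftRetraction.exists_isRetraction {B : Type v} [Ring B] [Algebra R B]
    {S : ModuleCat.{v} A} {η : A →ₐ[R] B} (h : IsLeftRetraction S η) :
    let _ := moduleOfAlgHom η
    ∃ e : A, IsRetraction S e B := by
  intro _
  have : IsArtinianRing A := IsArtinianRing.of_finite R A
  obtain ⟨e, he⟩ := h.localizable.exists_isLocalizingPair
  refine ⟨e, ?_⟩
  let _ := moduleOfAlgHom (toCornerEnd R e)
  have h0 := isRetraction_cornerEnd R he
  have hp := h.universal.perp
  have hfin : Module.Finite A B := hp.finite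
  have hB0 : ExtZero A S B 0 := extZero_zero_iff.2 fun f => by
    have := hp.hom.elim (ModuleCat.ofHom (Y := restrictedModule η) f) 0
    exact congrArg ModuleCat.Hom.hom this
  have hB1 : ExtZero A S B 1 := hp.ext
  have hperp : Perp S (ModuleCat.of A (CornerEnd R e)) :=
    ⟨h0.finite, ⟨fun f g => by
      have := extZero_zero_iff.1 h0.hom
      ext1
      rw [this f.hom, this g.hom]⟩, h0.ext⟩
  obtain ⟨g, hg, -⟩ := h.universal.existsUnique_lift (ModuleCat.of A (CornerEnd R e)) hperp
    (ModuleCat.ofHom (unitMap A (CornerEnd R e)))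
  obtain ⟨g', hg', -⟩ := h0.existsUnique_lift hB0 hB1 (unitMap A B)
  let γ : B →ₗ[A] CornerEnd R e := g.hom
  have hgg : ∀ a, γ (η a) = toCornerEnd R e a := fun a => by
    have : γ (η a * 1) = toCornerEnd R e a * 1 := congrArg (fun k => k.hom a) hg
    rwa [mul_one, mul_one] at this
  have hgg' : ∀ a, g' (toCornerEnd R e a) = η a := fun a => by
    have : g' (toCornerEnd R e a * 1) = η a * 1 := LinearMap.congr_fun hg' a
    rwa [mul_one, mul_one] at this
  have hid : g' ∘ₗ γ = LinearMap.id := by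
    obtain ⟨k, -, hk⟩ := h.universal.existsUnique_lift _ hp (rightMul η 1)
    have h1 := hk (g ≫ ModuleCat.ofHom (Y := restrictedModule η) g')
      (ModuleCat.hom_ext (LinearMap.ext fun a => by
        exact (congrArg g' ((congrArg γ (mul_one (η a))).trans (hgg a))).trans
          ((hgg' a).trans (mul_one _).symm)))
    have h2 := hk (𝟙 _) (Category.comp_id _)
    exact congrArg ModuleCat.Hom.hom (h1.trans h2.symm)
  refine { toIsLocalizingPair := he, finite := hfin, hom := hB0, ext := hB1, inj := ?_, surj := ?_ }
  · intro a ha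
    have ha' : η (e * a) * 1 = 0 := ha
    refine h0.inj a ?_
    change toCornerEnd R e (e * a) * 1 = 0
    rw [mul_one] at *
    rw [← hgg, ha']
    exact map_zero γ
  · intro b
    obtain ⟨a, ha⟩ := h0.surj (γ b)
    refine ⟨a, ?_⟩
    have h1 := congrArg g' ha
    rw [map_smul, map_smul] at h1
    have h2 : g' (γ b) = b := LinearMap.congr_fun hid b
    rw [h2] at h1
    rw [h1]
    have := hgg' 1
    rw [map_one (toCornerEnd R e), map_one η] at this
    rw [this]

/-- Right multiplication by `y` is `A`-linear and sends `η a` to `a y`, so uniqueness of the lift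
identifies it with `g_y`. -/
theorem isLeftRetraction_of_isRetraction {B : Type v} [Ring B] [Algebra R B]
    {S : ModuleCat.{v} A} (hS : IsLocalizable S) {η : A →ₐ[R] B}
    (h : let _ := moduleOfAlgHom η
      IsRetraction S e B) : IsLeftRetraction S η := by
  have : IsArtinianRing A := IsArtinianRing.of_finite R A
  let _ := moduleOfAlgHom η
  have hu : IsUniversalToPerp S (rightMul η 1) := by
    refine ⟨⟨h.finite, ⟨fun f g => ?_⟩, h.ext⟩, fun Z hZ f => ?_⟩
    · have := extZero_zero_iff.1 h.hom
      ext1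
      exact (this f.hom).trans (this g.hom).symm
    · have hZ0 : ExtZero A S Z 0 := extZero_zero_iff.2 fun f =>
        congrArg ModuleCat.Hom.hom (hZ.hom.elim (ModuleCat.ofHom f) 0)
      obtain ⟨g, hg, hg'⟩ := h.existsUnique_lift hZ0 hZ.ext f.hom
      refine ⟨ModuleCat.ofHom (X := restrictedModule η) g, ?_, fun k hk => ?_⟩
      · ext1
        exact hg
      · ext1
        exact hg' k.hom (congrArg ModuleCat.Hom.hom hk)
  refine ⟨hS, hu, fun x y g hg => ?_⟩
  obtain ⟨k, -, hk⟩ := hu.existsUnique_lift _ hu.perp (rightMul η y)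
  let m : B →ₗ[A] B :=
    { toFun := fun x => x * y
      map_add' := fun a b => add_mul a b y
      map_smul' := fun a b => mul_assoc (η a) b y }
  have h1 := hk (ModuleCat.ofHom (X := restrictedModule η) (Y := restrictedModule η) m)
    (ModuleCat.hom_ext (LinearMap.ext fun a => by
      change η a * 1 * y = η a * y
      rw [mul_one]))
  have h2 := hk g hg
  have := congrArg (fun k => k.hom x) (h1.trans h2.symm)
  exact this

end Localization

/-! ### Recovering an algebra from a corner -/

section Corner

variable {R : Type u} [CommRing R] {A B : Type v} [Ring A] [Algebra R A] [Ring B] [Algebra R B]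

/-- The homomorphism `f` restricts to a bijection from `eA` to `f(e)B`. -/
structure IsCornerBijective (f : A →ₐ[R] B) (e : A) : Prop where
  idem : IsIdempotentElem e
  inj : ∀ a : A, f (e * a) = 0 → e * a = 0
  surj : ∀ b : B, ∃ a : A, f e * b = f (e * a)

namespace IsCornerBijective

variable {f : A →ₐ[R] B} {e : A} (h : IsCornerBijective f e)
include h

theorem injective {x y : rightIdeal R e} (hxy : f x = f y) : x = y := by
  refine sub_eq_zero.1 (Subtype.ext ?_)
  rw [← (mem_rightIdeal R).1 (x - y).2]
  refine h.inj _ ?_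
  rw [(mem_rightIdeal R).1 (x - y).2, Submodule.coe_sub, map_sub, hxy, sub_self]

theorem exists_eq {b : B} (hb : f e * b = b) : ∃ x : rightIdeal R e, f x = b := by
  obtain ⟨a, ha⟩ := h.surj b
  refine ⟨⟨e * a, ?_⟩, ?_⟩
  · rw [mem_rightIdeal, ← mul_assoc, h.idem.eq]
  · rw [← ha, hb]

theorem exists_mul_eq (x : rightIdeal R e) (b : B) : ∃ y : rightIdeal R e, f y = f x * b :=
  h.exists_eq (by rw [← mul_assoc, ← map_mul, (mem_rightIdeal R).1 x.2])

/-- Right multiplication by an element of `B`, as an endomorphism of `eA`. -/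
def mulRightMap (b : B) : rightIdeal R e →ₗ[R] rightIdeal R e where
  toFun x := (h.exists_mul_eq x b).choose
  map_add' x y := h.injective <| (h.exists_mul_eq (x + y) b).choose_spec.trans <| by
    simp only [Submodule.coe_add, map_add, (h.exists_mul_eq x b).choose_spec,
      (h.exists_mul_eq y b).choose_spec, add_mul]
  map_smul' r x := h.injective <| (h.exists_mul_eq (r • x) b).choose_spec.trans <| by
    simp only [RingHom.id_apply, Submodule.coe_smul, map_smul,
      (h.exists_mul_eq x b).choose_spec, smul_mul_assoc]

theorem map_mulRightMap (b : B) (x : rightIdeal R e) : f (h.mulRightMap b x) = f x * b :=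
  (h.exists_mul_eq x b).choose_spec

/-- The homomorphism `B → End_{eAe}(eA)ᵒᵖ` given by right multiplication. -/
def toCornerEnd : B →ₐ[R] CornerEnd R e where
  toFun b := MulOpposite.op ⟨h.mulRightMap b, fun c x y hy => by
    have h1 : e * c * (h.mulRightMap b x : A) ∈ rightIdeal R e := by
      rw [mem_rightIdeal, ← mul_assoc, ← mul_assoc, h.idem.eq]
    refine congrArg Subtype.val (h.injective (y := ⟨_, h1⟩) ?_)
    change f (h.mulRightMap b y) = f (e * c * (h.mulRightMap b x : A))
    rw [map_mulRightMap, hy, map_mul, map_mul _ (e * c), map_mulRightMap, mul_assoc]⟩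
  map_one' := CornerEnd.ext fun x => congrArg Subtype.val <| h.injective <|
    (h.map_mulRightMap _ _).trans (mul_one _)
  map_mul' a b := CornerEnd.ext fun x => congrArg Subtype.val <| h.injective <| by
    change f (h.mulRightMap _ _) = f (h.mulRightMap _ (h.mulRightMap _ _))
    simp only [map_mulRightMap, mul_assoc]
  map_zero' := CornerEnd.ext fun x => congrArg Subtype.val <| h.injective <|
    (h.map_mulRightMap _ _).trans (by simp)
  map_add' a b := CornerEnd.ext fun x => congrArg Subtype.val <| h.injective <| by
    change f (h.mulRightMap _ _) = f (h.mulRightMap _ _ + h.mulRightMap _ _ : rightIdeal R e)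
    rw [Submodule.coe_add, map_add]
    simp only [map_mulRightMap, mul_add]
  commutes' r := CornerEnd.ext fun x => congrArg Subtype.val <| h.injective <|
    (h.map_mulRightMap _ _).trans (by
      change f x * algebraMap R B r = f (r • x : rightIdeal R e)
      rw [Submodule.coe_smul, map_smul, ← Algebra.commutes, Algebra.smul_def])

theorem toCornerEnd_map (a : A) : h.toCornerEnd (f a) = NakayamaRetraction.toCornerEnd R e a :=
  CornerEnd.ext fun x => congrArg Subtype.val <| h.injective <|
    (h.map_mulRightMap _ _).trans (by rw [toCornerEnd_apply, map_mul])

/-- As `f e` kills no simple module, the left ideal generated by `f(e)B` is all of `B`. Statements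
about `1` therefore reduce to elements of `f(e)B`, that is, to images of elements of `eA`. -/
theorem bijective_toCornerEnd
    (hfull : ∀ X : ModuleCat.{v} B, IsSimpleModule B X → ∃ x : X, f e • x ≠ 0) :
    Function.Bijective h.toCornerEnd := by
  have htop : Submodule.span B {b : B | f e * b = b} = ⊤ := by
    by_contra hne
    obtain ⟨N, hN, hNs⟩ := exists_le_isSimpleModule_quotient hne
    obtain ⟨x, hx⟩ := hfull (ModuleCat.of B (B ⧸ N)) hNs
    obtain ⟨b, rfl⟩ := N.mkQ_surjective x
    refine hx ?_
    have : f e * b ∈ N := hN (Submodule.subset_span (by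
      rw [Set.mem_ofPred_eq, ← mul_assoc, ← map_mul, h.idem.eq]))
    exact (Submodule.Quotient.mk_eq_zero N).2 this
  have h1 : (1 : B) ∈ Submodule.span B {b : B | f e * b = b} := htop ▸ trivial
  constructor
  · refine (injective_iff_map_eq_zero _).2 fun b hb => ?_
    have key : ∀ u ∈ Submodule.span B {b : B | f e * b = b}, u * b = 0 := by
      intro u hu
      induction hu using Submodule.span_induction with
      | mem u hu =>
        obtain ⟨x, rfl⟩ := h.exists_eq hu
        rw [← h.map_mulRightMap]
        have : h.mulRightMap b = 0 := congrArg (fun φ : CornerEnd R e => φ.unop.1) hb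
        rw [this]
        exact map_zero f
      | zero => exact zero_mul b
      | add u v _ _ hu hv => rw [add_mul, hu, hv, add_zero]
      | smul c u _ hu => rw [smul_eq_mul, mul_assoc, hu, mul_zero]
    simpa using key 1 h1
  · intro φ
    -- The claim for `u` says that right multiplication by `u` followed by `φ` is right
    -- multiplication by some `b`. It holds on `f(e)B` by linearity over `eAe`, is stable under sums
    -- and left multiples, and is wanted for `u = 1`.
    have key : ∀ u ∈ Submodule.span B {b : B | f e * b = b}, ∃ b : B, ∀ (x : B)
        (y : rightIdeal R e), f e * x = x → f y = x * u → f (φ.unop.1 y) = x * b := by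
      intro u hu
      induction hu using Submodule.span_induction with
      | mem u hu =>
        obtain ⟨z, rfl⟩ := h.exists_eq hu
        refine ⟨f (φ.unop.1 z), fun x y hx hy => ?_⟩
        obtain ⟨x, rfl⟩ := h.exists_eq hx
        have h2 : e * x * (z : A) ∈ rightIdeal R e := by
          rw [mem_rightIdeal, ← mul_assoc, ← mul_assoc, h.idem.eq]
        have h3 : y = ⟨e * x * z, h2⟩ := h.injective (by
          change f y = f (e * x * z)
          rw [hy, (mem_rightIdeal R).1 x.2, map_mul])
        rw [φ.unop.2 x z y (congrArg Subtype.val h3), (mem_rightIdeal R).1 x.2, map_mul]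
      | zero =>
        refine ⟨0, fun x y _ hy => ?_⟩
        have : y = 0 := h.injective (by rw [hy, mul_zero]; exact (map_zero f).symm)
        rw [this, map_zero, mul_zero]
        exact map_zero f
      | add u v _ _ hu hv =>
        obtain ⟨b, hb⟩ := hu
        obtain ⟨c, hc⟩ := hv
        refine ⟨b + c, fun x y hx hy => ?_⟩
        obtain ⟨y₁, hy₁⟩ := h.exists_eq (b := x * u) (by rw [← mul_assoc, hx])
        obtain ⟨y₂, hy₂⟩ := h.exists_eq (b := x * v) (by rw [← mul_assoc, hx])
        have : y = y₁ + y₂ := h.injective (by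
          rw [hy, Submodule.coe_add, map_add, hy₁, hy₂, mul_add])
        rw [this, map_add, Submodule.coe_add, map_add, hb x y₁ hx hy₁, hc x y₂ hx hy₂, mul_add]
      | smul c u _ hu =>
        obtain ⟨b, hb⟩ := hu
        refine ⟨c * b, fun x y hx hy => ?_⟩
        rw [hb (x * c) y (by rw [← mul_assoc, hx]) (by rw [hy, smul_eq_mul, mul_assoc]), mul_assoc]
    obtain ⟨b, hb⟩ := key 1 h1
    refine ⟨b, CornerEnd.ext fun y => congrArg Subtype.val <| h.injective <|
      (h.map_mulRightMap _ _).trans ?_⟩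
    exact (hb (f y) y (by rw [← map_mul, (mem_rightIdeal R).1 y.2]) (mul_one _).symm).symm

end IsCornerBijective

theorem IsCornerBijective.exists_algEquiv {B' : Type v} [Ring B'] [Algebra R B'] {e : A}
    {f : A →ₐ[R] B} {f' : A →ₐ[R] B'} (h : IsCornerBijective f e) (h' : IsCornerBijective f' e)
    (hfull : ∀ X : ModuleCat.{v} B, IsSimpleModule B X → ∃ x : X, f e • x ≠ 0)
    (hfull' : ∀ X : ModuleCat.{v} B', IsSimpleModule B' X → ∃ x : X, f' e • x ≠ 0) :
    ∃ ψ : B ≃ₐ[R] B', (ψ : B →ₐ[R] B').comp f = f' := by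
  refine ⟨(AlgEquiv.ofBijective _ (h.bijective_toCornerEnd hfull)).trans
    (AlgEquiv.ofBijective _ (h'.bijective_toCornerEnd hfull')).symm, AlgHom.ext fun a => ?_⟩
  change (AlgEquiv.ofBijective _ (h'.bijective_toCornerEnd hfull')).symm (h.toCornerEnd (f a)) = _
  rw [AlgEquiv.symm_apply_eq, h.toCornerEnd_map]
  exact (h'.toCornerEnd_map a).symm

end Corner

/-! ### Persistence of the corner along a retraction -/

section CornerStep

theorem IsLocalizingPair.idempotent_smul_eq_zero {A : Type v} [Ring A] {S : Type v}
    [AddCommGroup S] [Module A S] {e : A} (hS : IsLocalizingPair S e) {g : A}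
    (hg : IsIdempotentElem g) (hgS : ∀ s : S, g • s = 0) {M : Type v} [AddCommGroup M] [Module A M]
    (hM : IsFiniteLength A M) (h : ∀ m : M, e • m = 0) (m : M) : g • m = 0 := by
  induction hM with
  | of_subsingleton => exact Subsingleton.elim _ _
  | @of_simple_quotient M _ _ N hN hNl ih =>
    obtain ⟨i⟩ := hS.nonempty_linearEquiv (T := M ⧸ N) fun t => by
      obtain ⟨m, rfl⟩ := N.mkQ_surjective t
      rw [← map_smul, h, map_zero]
    have h1 : g • N.mkQ m = 0 := i.injective (by rw [map_smul, hgS, map_zero])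
    rw [← map_smul] at h1
    have h2 : g • m ∈ N := (Submodule.Quotient.mk_eq_zero N).1 h1
    have h3 := ih (fun m => Subtype.ext (h m)) ⟨_, h2⟩
    rw [← hg.eq, mul_smul]
    exact congrArg Subtype.val h3

variable {R : Type u} [CommRing R] {A B C : Type v} [Ring A] [Algebra R A] [Ring B]
  [Algebra R B] [Ring C] [Algebra R C]

/-- The idempotent `e` detects the simple modules of infinite projective dimension. -/
def DetectsFinPD (f : A →ₐ[R] B) (e : A) : Prop :=
  ∀ X : ModuleCat.{v} B, IsSimpleModule B X → (FinPD B X ↔ ∀ x : X, f e • x = 0)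

variable [IsArtinianRing B] {f : A →ₐ[R] B} {e : A} {η : B →ₐ[R] C} {S : Type v} [AddCommGroup S]
  [Module B S] {e' : B}

/-- `S` has finite projective dimension, so `f e` kills it, and then also the kernel and cokernel of
`η`, which are filtered by `S`. Similarly `f e` kills `X` modulo its socle `T`, and `T` and `X` have
finite projective dimension simultaneously. -/
theorem IsCornerBijective.step (h : IsCornerBijective f e) (hd : DetectsFinPD f e)
    (hη : let _ := moduleOfAlgHom η
      IsRetraction S e' C) :
    IsCornerBijective (η.comp f) e ∧ DetectsFinPD (η.comp f) e := by
  let _ := moduleOfAlgHom η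
  have := isScalarTower_of_algHom η
  have hη : IsRetraction S e' C := hη
  have hfi : IsIdempotentElem (f e) := by
    rw [IsIdempotentElem, ← map_mul, h.idem.eq]
  have hS := (hd (ModuleCat.of B S) hη.simple).1 hη.finPD
  have hkill : ∀ (M : Type v) [AddCommGroup M] [Module B M] [Module.Finite B M],
      (∀ m : M, e' • m = 0) → ∀ m : M, f e • m = 0 := fun M _ _ _ hM =>
    hη.idempotent_smul_eq_zero hfi hS (isFiniteLength_iff_isNoetherian_isArtinian.2
      ⟨inferInstance, inferInstance⟩) hM
  have := hη.finite
  refine ⟨⟨h.idem, fun a ha => h.inj a ?_, fun c => ?_⟩, fun X hX => ?_⟩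
  · have h1 := hkill _ hη.smul_ker ⟨f (e * a), by
      change η (f (e * a)) * 1 = 0
      rw [mul_one]
      exact ha⟩
    have h2 : f e * f (e * a) = 0 := congrArg Subtype.val h1
    rwa [← map_mul, ← mul_assoc, h.idem.eq] at h2
  · have h1 := hkill _ hη.smul_coker (Submodule.Quotient.mk c)
    obtain ⟨b, hb⟩ := (Submodule.Quotient.mk_eq_zero _).1 h1
    have hb' : η b * 1 = η (f e) * c := hb
    rw [mul_one] at hb'
    obtain ⟨a, ha⟩ := h.surj b
    refine ⟨a, ?_⟩
    change η (f e) * c = η (f (e * a))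
    rw [← ha, map_mul, hb', ← mul_assoc, ← map_mul, hfi.eq]
  · obtain ⟨_, _⟩ := exists_module_isScalarTower B (B := C) X
    obtain ⟨T, hT⟩ := hη.exists_simple_injective X
    have hTX := hη.finPD_iff_of_injective T.injective_subtype
    have := hη.finite_of_finite (X := X)
    have hsm : ∀ x : X, η (f e) • x = f e • x := fun x => by
      have : (f e • (1 : C)) = η (f e) := mul_one _
      rw [← this, smul_assoc, one_smul]
    have hq := hkill (X ⧸ T) fun x => by
      obtain ⟨x, rfl⟩ := T.mkQ_surjective x
      rw [← map_smul]
      refine (Submodule.Quotient.mk_eq_zero _).2 (hη.smul_mem_of_ne_bot ?_ x)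
      exact (Submodule.nontrivial_iff_ne_bot).1 (IsSimpleModule.nontrivial B T)
    rw [← hTX, hd (ModuleCat.of B T) hT]
    constructor
    · intro h1 x
      change η (f e) • x = 0
      have h2 := hq (Submodule.Quotient.mk x)
      have h3 : f e • x ∈ T := (Submodule.Quotient.mk_eq_zero T).1 h2
      have h4 : f e • f e • x = 0 := congrArg Subtype.val (h1 ⟨_, h3⟩)
      rw [hsm]
      rwa [← mul_smul, hfi.eq] at h4
    · intro h1 t
      refine Subtype.ext ?_
      have h2 : η (f e) • (t : X) = 0 := h1 t
      rw [hsm] at h2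
      exact h2

end CornerStep

/-! ### Self-injective connected Nakayama algebras -/

section SelfInjective

variable {B : Type v} [Ring B]

/-- By induction the first syzygy is projective, hence a summand of a free module of finite rank and
injective. So it splits off. -/
theorem projective_of_finPD [IsNoetherianRing B] (hI : IsSelfInjective B) {X : Type v}
    [AddCommGroup X] [Module B X] [Module.Finite B X] (hX : FinPD B X) : Module.Projective B X := by
  have hI' : Module.Injective B B := hI
  obtain ⟨n, hn⟩ := hX
  induction n generalizing X with
  | zero =>
    have : Subsingleton X := ModuleCat.subsingleton_of_isZero
      ((hasProjectiveDimensionLT_zero_iff_isZero (ModuleCat.of B X)).1 hn)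
    infer_instance
  | succ n ih =>
    rcases n with _ | n
    · have : Projective (ModuleCat.of B X) := projective_iff_hasProjectiveDimensionLT_one.2 hn
      exact (IsProjective.iff_projective X).2 this
    · obtain ⟨m, g, hg⟩ := Module.Finite.exists_fin' B X
      have hse := shortExact_of_exact (Submodule.injective_subtype _) hg
        (LinearMap.exact_subtype_ker_map g)
      have : Projective (ModuleCat.of B (Fin m → B)) :=
        (IsProjective.iff_projective (Fin m → B)).1 inferInstance
      have hK : Module.Projective B (LinearMap.ker g) :=
        ih ((hse.hasProjectiveDimensionLT_X₃_iff n this).1 hn)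
      obtain ⟨k, p, hp⟩ := Module.Finite.exists_fin' B (LinearMap.ker g)
      obtain ⟨s, hs⟩ := Module.projective_lifting_property p LinearMap.id hp
      have hKI : Module.Injective B (LinearMap.ker g) :=
        injective_of_retract (M := Fin k → B) inferInstance s p hs
      obtain ⟨r, hr⟩ := hKI.out (LinearMap.ker g).subtype (Submodule.injective_subtype _)
        LinearMap.id
      have hc : IsCompl (LinearMap.ker g) (LinearMap.ker r) :=
        LinearMap.isCompl_of_proj hr
      have hP := projective_of_isCompl hc.symm
      exact Module.Projective.of_equiv ((Submodule.quotientEquivOfIsCompl _ _ hc).symm.trans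
        (g.quotKerEquivOfSurjective hg))

theorem isSemisimpleModule_of_projective_simples
    (h : ∀ T : ModuleCat.{v} B, IsSimpleModule B T → Module.Projective B T) {M : Type v}
    [AddCommGroup M] [Module B M] (hM : IsFiniteLength B M) : IsSemisimpleModule B M := by
  induction hM with
  | @of_subsingleton M _ _ _ =>
    exact { exists_isCompl := fun U => ⟨U, disjoint_iff.2 (Subsingleton.elim _ _),
      codisjoint_iff.2 (Subsingleton.elim _ _)⟩ }
  | @of_simple_quotient M _ _ N hN hNl ih =>
    have := h (ModuleCat.of B (M ⧸ N)) hN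
    obtain ⟨s, hs⟩ := Module.projective_lifting_property (P := M ⧸ N) N.mkQ LinearMap.id
      N.mkQ_surjective
    have hinj : Function.Injective s := Function.LeftInverse.injective (LinearMap.congr_fun hs)
    have h1 : IsSimpleModule B (LinearMap.range s) :=
      IsSimpleModule.congr (LinearEquiv.ofInjective s hinj).symm
    have h2 : N ⊔ LinearMap.range s = ⊤ := by
      refine eq_top_iff.2 fun m _ => ?_
      rw [← sub_add_cancel m (s (N.mkQ m))]
      refine Submodule.add_mem_sup ((Submodule.Quotient.mk_eq_zero N).1 ?_) ⟨_, rfl⟩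
      have := LinearMap.congr_fun hs (N.mkQ m)
      change N.mkQ (m - s (N.mkQ m)) = 0
      rw [map_sub, sub_eq_zero]
      exact this.symm
    have h3 : IsSemisimpleModule B (N ⊔ LinearMap.range s : Submodule B M) :=
      .sup ih inferInstance
    rw [h2] at h3
    exact IsSemisimpleModule.congr Submodule.topEquiv.symm

theorem globalDim_lt_top_of_isSemisimpleRing [IsSemisimpleRing B] : globalDim B < ⊤ :=
  globalDim_lt_top_iff.2 fun T _ =>
    have := Module.projective_of_isSemisimpleRing B T
    FinPD.of_projective

variable {R : Type u} [CommRing R] [IsArtinianRing R] [Algebra R B]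

/-- `T` is both projective and injective, so no arrow starts or ends there. By connectedness it is
the only simple module; being projective, it makes `B` semisimple. -/
theorem IsConnectedNakayama.isSimpleRing_of_finPD (hB : IsConnectedNakayama R B)
    (hI : IsSelfInjective B) {T : Type v} [AddCommGroup T] [Module B T] [IsSimpleModule B T]
    (hT : FinPD B T) : IsSimpleRing B ∧ numSimples B = 1 := by
  have := hB.isArtinianRing
  have hP : Module.Projective B T := projective_of_finPD hI hT
  have hTI : Module.Injective B T := by
    have hI' : Module.Injective B B := hI
    obtain ⟨k, p, hp⟩ := Module.Finite.exists_fin' B T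
    obtain ⟨s, hs⟩ := Module.projective_lifting_property p LinearMap.id hp
    exact injective_of_retract (M := Fin k → B) inferInstance s p hs
  have hall : ∀ X : ModuleCat.{v} B, IsSimpleModule B X → Nonempty (X ≃ₗ[B] T) := by
    refine (hB.all_or_none (fun X => Nonempty (X ≃ₗ[B] T)) (fun X X' ⟨i⟩ ⟨j⟩ => ⟨j.symm.trans i⟩)
      fun X X' _ _ hX => ?_).resolve_right fun h =>
        h (ModuleCat.of B T) inferInstance ⟨LinearEquiv.refl B T⟩
    refine ⟨fun ⟨i⟩ => absurd ?_ hX, fun ⟨i⟩ => absurd ?_ hX⟩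
    · exact ExtZero.congr i.symm (LinearEquiv.refl B X') .of_projective
    · exact ExtZero.congr (LinearEquiv.refl B X) i.symm (.of_injective hTI)
  have hss : IsSemisimpleRing B := isSemisimpleModule_of_projective_simples
    (fun X hX => Module.Projective.of_equiv (hall X hX).some.symm)
    (isFiniteLength_iff_isNoetherian_isArtinian.2 ⟨inferInstance, inferInstance⟩)
  constructor
  · refine (isSimpleRing_isArtinianRing_iff.2 ⟨hss, fun m _ m' _ => ?_, hB.connected.1⟩).1
    exact ⟨(hall (ModuleCat.of B m') inferInstance).some.trans
      (hall (ModuleCat.of B m) inferInstance).some.symm⟩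
  · rw [numSimples, Set.ncard_eq_one]
    refine ⟨isoClass (ModuleCat.of B T), Set.eq_singleton_iff_unique_mem.2
      ⟨⟨_, inferInstanceAs (IsSimpleModule B T), rfl⟩, ?_⟩⟩
    rintro _ ⟨X, hX, rfl⟩
    exact isoClass_eq_iff.2 (hall X hX)

theorem IsConnectedNakayama.exists_isSimpleModule (hB : IsConnectedNakayama R B) :
    ∃ T : ModuleCat.{v} B, IsSimpleModule B T := by
  have := hB.isArtinianRing
  have := hB.connected.1
  obtain ⟨T, hT⟩ := exists_isSimpleModule_le (A := B) B
  exact ⟨ModuleCat.of B T, hT⟩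

theorem IsConnectedNakayama.isSimpleRing_iff (hB : IsConnectedNakayama R B)
    (hI : IsSelfInjective B) : IsSimpleRing B ↔ globalDim B < ⊤ := by
  have := hB.isArtinianRing
  constructor
  · intro _
    have : IsSemisimpleRing B := (isSimpleRing_isArtinianRing_iff.1 ⟨‹_›, ‹_›⟩).1
    exact globalDim_lt_top_of_isSemisimpleRing
  · intro h
    obtain ⟨T, hT⟩ := hB.exists_isSimpleModule
    exact (hB.isSimpleRing_of_finPD hI (globalDim_lt_top_iff.1 h T hT)).1

theorem IsConnectedNakayama.numSimples_eq_one (hB : IsConnectedNakayama R B)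
    (hI : IsSelfInjective B) (h : globalDim B < ⊤) : numSimples B = 1 := by
  have := hB.isArtinianRing
  obtain ⟨T, hT⟩ := hB.exists_isSimpleModule
  exact (hB.isSimpleRing_of_finPD hI (globalDim_lt_top_iff.1 h T hT)).2

theorem IsConnectedNakayama.not_finPD (hB : IsConnectedNakayama R B)
    (hI : IsSelfInjective B) (h : ¬ globalDim B < ⊤) {T : Type v} [AddCommGroup T] [Module B T]
    [IsSimpleModule B T] : ¬ FinPD B T := fun hT =>
  h ((hB.isSimpleRing_iff hI).1 (hB.isSimpleRing_of_finPD hI hT).1)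

theorem IsConnectedNakayama.numSimplesFiniteProjDim_eq_zero (hB : IsConnectedNakayama R B)
    (hI : IsSelfInjective B) (h : ¬ globalDim B < ⊤) : numSimplesFiniteProjDim B = 0 := by
  rw [numSimplesFiniteProjDim]
  refine (congrArg Set.ncard (Set.eq_empty_of_forall_notMem ?_)).trans (Set.ncard_empty _)
  rintro _ ⟨T, ⟨hT, hp⟩, rfl⟩
  exact hB.not_finPD hI h ((projectiveDimension_lt_top_iff T).1 hp)

end SelfInjective

/-! ### Invariants along a sequence of retractions -/

section Sequence

variable {R : Type u} [CommRing R] [IsArtinianRing R] {A : Type v} [Ring A] [Algebra R A]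

omit [IsArtinianRing R] in
theorem IsLeftRetractionSequence.isConnectedNakayama {r : ℕ} {B : Type v} [Ring B] [Algebra R B]
    {f : A →ₐ[R] B} (h : IsLeftRetractionSequence R A r B f) :
    IsConnectedNakayama R A ∧ IsConnectedNakayama R B := by
  induction h with
  | refl h => exact ⟨h, h⟩
  | step η S _ hC _ ih => exact ⟨ih.1, hC⟩

theorem IsLeftRetractionSequence.numSimples_eq {r : ℕ} {B : Type v} [Ring B] [Algebra R B]
    {f : A →ₐ[R] B} (h : IsLeftRetractionSequence R A r B f) :
    numSimples A = r + numSimples B ∧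
      numSimplesFiniteProjDim A = r + numSimplesFiniteProjDim B ∧
      (globalDim A < ⊤ ↔ globalDim B < ⊤) := by
  induction h with
  | refl h => exact ⟨(zero_add _).symm, (zero_add _).symm, Iff.rfl⟩
  | @step r B C _ _ _ _ f η S hf hC hη ih =>
    have := hf.isConnectedNakayama.2.isArtinianRing
    have := hf.isConnectedNakayama.2.finite
    obtain ⟨e, he⟩ := hη.exists_isRetraction
    let _ := moduleOfAlgHom η
    have := isScalarTower_of_algHom η
    have he : IsRetraction S e C := he
    have h1 := he.numSimples_eq
    have h2 := he.numSimplesFiniteProjDim_eq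
    exact ⟨by lia, by lia, ih.2.2.trans he.globalDim_lt_top_iff_globalDim⟩

theorem IsLeftRetractionSequence.isCornerBijective {r : ℕ} {B : Type v} [Ring B] [Algebra R B]
    {f : A →ₐ[R] B} (h : IsLeftRetractionSequence R A r B f) {e : A} (he : IsIdempotentElem e)
    (hd : DetectsFinPD (AlgHom.id R A) e) : IsCornerBijective f e ∧ DetectsFinPD f e := by
  induction h with
  | refl h => exact ⟨⟨he, fun a ha => ha, fun b => ⟨b, rfl⟩⟩, hd⟩
  | @step r B C _ _ _ _ f η S hf hC hη ih =>
    have := hf.isConnectedNakayama.2.isArtinianRing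
    have := hf.isConnectedNakayama.2.finite
    obtain ⟨e', he'⟩ := hη.exists_isRetraction
    exact ih.1.step ih.2 he'

omit [IsArtinianRing R] in
theorem exists_detectsFinPD [IsArtinianRing A] :
    ∃ e : A, IsIdempotentElem e ∧ DetectsFinPD (AlgHom.id R A) e := by
  obtain ⟨e, he, h⟩ := exists_idempotent_of_simple_class (A := A) (fun T => ¬ FinPD A T)
    (fun T T' hT ⟨i⟩ hT' => hT (hT'.congr i.symm))
  refine ⟨e, he, fun X hX => ⟨fun hX' => (h X hX).2 (not_not.2 hX'), fun hX' => ?_⟩⟩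
  by_contra hX''
  have := IsSimpleModule.nontrivial A X
  obtain ⟨x, hx⟩ := exists_ne (0 : X)
  exact hx (((h X hX).1 hX'' x).symm.trans (hX' x))

/-- One idempotent `e` of `A`, that of the simples of infinite projective dimension, serves both
sequences. At both ends no simple has finite projective dimension, so the image of `e` kills none.
-/
theorem IsLeftRetractionSequence.exists_algEquiv {r r' : ℕ} {B B' : Type v} [Ring B] [Algebra R B]
    [Ring B'] [Algebra R B'] {f : A →ₐ[R] B} {f' : A →ₐ[R] B'}
    (h : IsLeftRetractionSequence R A r B f) (h' : IsLeftRetractionSequence R A r' B' f')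
    (hI : IsSelfInjective B) (hI' : IsSelfInjective B') (hA : ¬ globalDim A < ⊤) :
    ∃ ψ : B ≃ₐ[R] B', (ψ : B →ₐ[R] B').comp f = f' := by
  have := h.isConnectedNakayama.1.isArtinianRing
  obtain ⟨e, he, hd⟩ := exists_detectsFinPD (R := R) (A := A)
  obtain ⟨h1, h2⟩ := h.isCornerBijective he hd
  obtain ⟨h1', h2'⟩ := h'.isCornerBijective he hd
  refine h1.exists_algEquiv h1' (fun X hX => ?_) (fun X hX => ?_)
  · by_contra! hx
    exact h.isConnectedNakayama.2.not_finPD hI (mt h.numSimples_eq.2.2.2 hA) ((h2 X hX).2 hx)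
  · by_contra! hx
    exact h'.isConnectedNakayama.2.not_finPD hI' (mt h'.numSimples_eq.2.2.2 hA) ((h2' X hX).2 hx)

end Sequence

/-! ### Uniseriality passes to the retraction -/

section Uniserial

theorem isCompl_range_ker {A : Type v} [Ring A] {M N : Type v} [AddCommGroup M] [Module A M]
    [AddCommGroup N] [Module A N] {s : N →ₗ[A] M} {r : M →ₗ[A] N} (h : r ∘ₗ s = LinearMap.id) :
    IsCompl (LinearMap.range s) (LinearMap.ker r) := by
  have h' : ∀ x, r (s x) = x := LinearMap.congr_fun h
  refine ⟨disjoint_iff_inf_le.2 ?_, codisjoint_iff_le_sup.2 fun m _ => ?_⟩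
  · rintro _ ⟨⟨n, rfl⟩, hn⟩
    have hn' : r (s n) = 0 := hn
    rw [h'] at hn'
    rw [hn', map_zero]
    exact Submodule.zero_mem _
  · rw [← add_sub_cancel (s (r m)) m]
    exact Submodule.add_mem_sup ⟨_, rfl⟩ (by
      rw [LinearMap.mem_ker, map_sub, h', sub_self])

variable {R : Type u} [CommRing R] [IsArtinianRing R] {A : Type v} [Ring A] [Algebra R A]
  {S : Type v} [AddCommGroup S] [Module A S] {e : A} {B : Type v} [Ring B] [Algebra R B]
  [Module A B] [IsScalarTower A B B]

namespace IsRetraction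

variable (h : IsRetraction S e B) (hA : IsConnectedNakayama R A)
include h hA

-- The image of `N` in `X ⧸ N'` is killed by `eA`, and `X ⧸ N'` lies in `S^⊥`.
omit [Algebra R B] in
theorem le_of_forall_smul_mem {X : Type v} [AddCommGroup X] [Module A X] [Module B X]
    [IsScalarTower A B X] [Module.Finite B X] {N N' : Submodule B X}
    (hN : ∀ x ∈ N, e • x ∈ N') : N ≤ N' := by
  have := hA.isArtinianRing
  intro x hx
  refine (Submodule.Quotient.mk_eq_zero N').1 (h.eq_zero_of_smul (X := X ⧸ N') fun a => ?_)
  have h1 : a • x ∈ N := by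
    rw [← one_smul B x, ← smul_assoc]
    exact N.smul_mem _ hx
  exact (Submodule.Quotient.mk_eq_zero N').2 (hN _ h1)

-- Lift the cover over `A` of a simple `A`-submodule of the top of `Q` to a map `l` into `Q`. The
-- image of `l` is a chain module and generates `Q` over `B`, so it contains `e Q`. A `B`-submodule
-- is therefore determined by its intersection with this image.
omit [Algebra R B] in
theorem isChainModule_of_projective {Q : Type v} [AddCommGroup Q] [Module B Q]
    [Module.Finite B Q] [Module.Projective B Q] (hQ : IsIndecomposableModule B Q) :
    IsChainModule B Q := by
  have := hA.isArtinianRing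
  have := h.isArtinianRing
  have := hQ.1
  obtain ⟨N, -, hN⟩ := exists_le_isSimpleModule_quotient (A := B) (M := Q) (N := ⊥) bot_ne_top
  obtain ⟨P, _, _, f, hf⟩ := exists_isProjectiveCover (A := B) (Q ⧸ N)
  obtain ⟨g, hg, hgs⟩ := hf.isEssentialEpi.exists_surjective_lift (f := N.mkQ) N.mkQ_surjective
  have := hf.projective
  obtain ⟨s, hs⟩ := Module.projective_lifting_property g LinearMap.id hgs
  have hc : IsCompl (LinearMap.range s) (LinearMap.ker g) := isCompl_range_ker hs
  have hess : IsEssentialEpi N.mkQ := by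
    have hgi : LinearMap.ker g = ⊥ := by
      refine (hQ.2 _ _ hc).resolve_left fun h0 => ?_
      have := IsSimpleModule.nontrivial B (Q ⧸ N)
      obtain ⟨x, hx⟩ := exists_ne (0 : Q ⧸ N)
      obtain ⟨p, rfl⟩ := hf.surjective x
      refine hx ?_
      rw [← LinearMap.id_apply (R := B) p, ← hs, LinearMap.range_eq_bot.1 h0, LinearMap.comp_zero,
        LinearMap.zero_apply, map_zero]
    refine isEssentialEpi_of_forall_le_ker N.mkQ_surjective (IsSimpleModule.nontrivial B _)
      fun U hU x hx => ?_
    have h1 : U.map g ≠ ⊤ := fun h1 => hU (by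
      rw [← Submodule.comap_map_eq_of_injective (LinearMap.ker_eq_bot.1 hgi) U, h1,
        Submodule.comap_top])
    have h2 : f (g x) = 0 := hf.isEssentialEpi.le_ker h1 (Submodule.mem_map_of_mem hx)
    exact (LinearMap.congr_fun hg x).symm.trans h2
  obtain ⟨_, _⟩ := exists_module_isScalarTower A (B := B) Q
  obtain ⟨T, hT⟩ := h.exists_simple_injective (Q ⧸ N)
  obtain ⟨P', _, _, f', hf'⟩ := exists_isProjectiveCover (A := A) T
  have := hf'.projective
  obtain ⟨l, hl⟩ := Module.projective_lifting_property (N.mkQ.restrictScalars A)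
    (T.subtype ∘ₗ f') N.mkQ_surjective
  have hchain : IsChainModule A (LinearMap.range l) :=
    (hA.isChainModule_of_cover hf').of_surjective _ l.surjective_rangeRestrict
  have hspan : Submodule.span B (LinearMap.range l : Set Q) = ⊤ := by
    by_contra hne
    have h1 := hess.le_ker hne
    have := IsSimpleModule.nontrivial A T
    obtain ⟨t, ht⟩ := exists_ne (0 : T)
    obtain ⟨p, rfl⟩ := hf'.surjective t
    have h2 : N.mkQ (l p) = 0 := h1 (Submodule.subset_span ⟨p, rfl⟩)
    exact ht (Subtype.ext ((LinearMap.congr_fun hl p).symm.trans h2))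
  have hmem : ∀ x : Q, e • x ∈ LinearMap.range l := fun x =>
    h.smul_mem_of_mem_span _ (hspan ▸ trivial)
  have key : ∀ U W : Submodule B Q, (U.restrictScalars A).comap (LinearMap.range l).subtype ≤
      (W.restrictScalars A).comap (LinearMap.range l).subtype → U ≤ W := fun U W hUW =>
    h.le_of_forall_smul_mem hA fun x hx => by
      have h1 : e • x ∈ U := by
        rw [← one_smul B x, ← smul_assoc]
        exact U.smul_mem _ hx
      exact hUW (x := ⟨e • x, hmem x⟩) h1
  intro U W
  exact (hchain _ _).imp (key U W) (key W U)

/-- `Y` is isomorphic to the injective hull `I` over `B` of a simple submodule. Over `A`, `I` has a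
least nonzero submodule `T`: the `B`-span of a nonzero `U` contains `T`, and then `T = e T ⊆ U`. So
`I` is a chain module over `A`. -/
theorem isChainModule_of_injective [Module.Finite R B] {Y : Type v} [AddCommGroup Y] [Module B Y]
    [Module.Finite B Y] (hI : Module.Injective B Y) (hY : IsIndecomposableModule B Y) :
    IsChainModule B Y := by
  have := hA.isArtinianRing
  have := h.isArtinianRing
  have := hY.1
  obtain ⟨X, hX⟩ := exists_isSimpleModule_le (A := B) Y
  obtain ⟨I, _, _, i, hfin, hinj, hi, hleast⟩ := exists_injective_hull (A := B) R X
  have hchain : IsChainModule B I := by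
    obtain ⟨_, _⟩ := exists_module_isScalarTower A (B := B) I
    have hXs := hleast.1
    obtain ⟨T, hT⟩ := h.exists_simple_injective (LinearMap.range i)
    let k : T →ₗ[A] I := (LinearMap.range i).subtype.restrictScalars A ∘ₗ T.subtype
    have hk : Function.Injective k := (LinearMap.range i).injective_subtype.comp
      T.injective_subtype
    have hl : IsLeastNonzero (LinearMap.range k) := by
      refine ⟨IsSimpleModule.congr (LinearEquiv.ofInjective k hk).symm, fun U hU => ?_⟩
      have h1 : Submodule.span B (U : Set I) ≠ ⊥ := fun h0 => hU ((Submodule.eq_bot_iff _).2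
        fun u hu => (Submodule.mem_bot B).1 (h0 ▸ Submodule.subset_span hu))
      have h2 := hleast.2 _ h1
      rintro _ ⟨t, rfl⟩
      rw [← h.smul_eq_self T (h.not_iso_of_injective hk) t, map_smul]
      exact h.smul_mem_of_mem_span U (h2 (t : LinearMap.range i).2)
    have := h.finite_of_finite (X := I)
    have hc := hA.isChainModule_of_isLeastNonzero hl
    exact fun U W => hc (U.restrictScalars A) (W.restrictScalars A)
  obtain ⟨j, hj⟩ := hI.out i hi X.subtype
  have hji : Function.Injective j := hleast.injective_of_ne_zero fun h0 => by
    have := IsSimpleModule.nontrivial B X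
    obtain ⟨x, hx⟩ := exists_ne (0 : X)
    have h1 : j (i x) = 0 := LinearMap.congr_fun h0 ⟨i x, x, rfl⟩
    rw [hj] at h1
    exact hx (Subtype.ext h1)
  obtain ⟨r, hr⟩ := hinj.out j hji LinearMap.id
  have hc : IsCompl (LinearMap.range j) (LinearMap.ker r) :=
    isCompl_range_ker (LinearMap.ext hr)
  rcases hY.2 _ _ hc with h0 | h0
  · have := IsSimpleModule.nontrivial B X
    obtain ⟨x, hx⟩ := exists_ne (0 : X)
    have h1 := hj x
    rw [LinearMap.range_eq_bot.1 h0, LinearMap.zero_apply] at h1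
    exact absurd (Subtype.ext h1.symm) hx
  · exact hchain.of_injective r (LinearMap.ker_eq_bot.1 h0)

end IsRetraction
end Uniserial

/-! ### Connectedness passes to the retraction -/

section Connected

/-- The simple modules other than `S` are connected by extensions. -/
structure IsNonCut {A : Type v} [Ring A] (S : Type v) [AddCommGroup S] [Module A S] : Prop where
  exists_ne : ∃ T : ModuleCat.{v} A, IsSimpleModule A T ∧ ¬ Nonempty (T ≃ₗ[A] S)
  all_or_none : ∀ V : ModuleCat.{v} A → Prop,
    (∀ T T' : ModuleCat.{v} A, V T → Nonempty (T ≃ₗ[A] T') → V T') →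
    (∀ T T' : ModuleCat.{v} A, IsSimpleModule A T → IsSimpleModule A T' →
      ¬ Nonempty (T ≃ₗ[A] S) → ¬ Nonempty (T' ≃ₗ[A] S) → ¬ ExtZero A T T' 1 → (V T ↔ V T')) →
    (∀ T : ModuleCat.{v} A, IsSimpleModule A T → ¬ Nonempty (T ≃ₗ[A] S) → V T) ∨
      ∀ T : ModuleCat.{v} A, IsSimpleModule A T → ¬ Nonempty (T ≃ₗ[A] S) → ¬ V T

variable {A : Type v} [Ring A]

theorem smul_eq_zero_of_idempotent {g : A} (hg : IsIdempotentElem g)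
    (hgT : ∀ T : ModuleCat.{v} A, IsSimpleModule A T → ∀ t : T, g • t = 0) {M : Type v}
    [AddCommGroup M] [Module A M] (hM : IsFiniteLength A M) (m : M) : g • m = 0 := by
  induction hM with
  | of_subsingleton => exact Subsingleton.elim _ _
  | @of_simple_quotient M _ _ N hN hNl ih =>
    have h1 : g • N.mkQ m = 0 := hgT (ModuleCat.of A (M ⧸ N)) hN _
    rw [← map_smul] at h1
    have h3 := ih ⟨_, (Submodule.Quotient.mk_eq_zero N).1 h1⟩
    rw [← hg.eq, mul_smul]
    exact congrArg Subtype.val h3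

theorem idempotent_eq_zero [IsArtinianRing A] {g : A} (hg : IsIdempotentElem g)
    (hgT : ∀ T : ModuleCat.{v} A, IsSimpleModule A T → ∀ t : T, g • t = 0) : g = 0 := by
  have := smul_eq_zero_of_idempotent hg hgT (M := A)
    (isFiniteLength_iff_isNoetherian_isArtinian.2 ⟨inferInstance, inferInstance⟩) 1
  simpa using this

/-- Extensions between simple modules on which a central idempotent `u` of `eAe` acts differently
vanish. -/
theorem extZero_of_corner {e u : A} (he : IsIdempotentElem e) (heu : e * u = u)
    (hcomm : ∀ c, u * (e * c * e) = e * c * e * u) {T T' : Type v} [AddCommGroup T] [Module A T]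
    [AddCommGroup T'] [Module A T'] [IsSimpleModule A T] (heT : ∀ t : T, e • t = t)
    (heT' : ∀ t : T', e • t = t) (huT : ∀ t : T, u • t = 0) (huT' : ∀ t : T', u • t = t) :
    ExtZero A T T' 1 := by
  have := IsSimpleModule.nontrivial A T
  obtain ⟨t, ht⟩ := exists_ne (0 : T)
  have hf := IsSimpleModule.toSpanSingleton_surjective A ht
  set f := LinearMap.toSpanSingleton A T t
  refine (exists_extend_iff_extZero hf).1 fun p => ?_
  have hu : u ∈ LinearMap.ker f := huT t
  have he1 : 1 - e ∈ LinearMap.ker f := by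
    change (1 - e) • t = 0
    rw [sub_smul, one_smul, heT, sub_self]
  -- The extension of `p` is `a ↦ a p(u)`: as `u` is the identity on `T'` and commutes with `e x e`,
  -- one gets `p(x) = p(u (e x e)) = p(e x u) = x p(u)`.
  refine ⟨LinearMap.toSpanSingleton A T' (p ⟨u, hu⟩), LinearMap.ext fun x => ?_⟩
  change (x : A) • p ⟨u, hu⟩ = p x
  have h1 : p ⟨1 - e, he1⟩ = 0 := by
    rw [← heT' (p ⟨1 - e, he1⟩), ← map_smul]
    have : e • (⟨1 - e, he1⟩ : LinearMap.ker f) = 0 := Subtype.ext (by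
      change e * (1 - e) = 0
      rw [mul_sub, mul_one, he.eq, sub_self])
    rw [this, map_zero]
  have h2 : e * x * e ∈ LinearMap.ker f := by
    change (e * x * e) • t = 0
    rw [mul_smul, mul_smul, heT t, show (x : A) • t = 0 from x.2, smul_zero]
  have h3 : p x = p ⟨e * x * e, h2⟩ := by
    have : e • x = ⟨e * x * e, h2⟩ + (e * x) • (⟨1 - e, he1⟩ : LinearMap.ker f) :=
      Subtype.ext (by
        change e * (x : A) = e * x * e + e * x * (1 - e)
        rw [mul_sub, mul_one, add_sub_cancel])
    rw [← heT' (p x), ← map_smul, this, map_add, map_smul, h1, smul_zero, add_zero]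
  have h4 : u • (⟨e * x * e, h2⟩ : LinearMap.ker f) = e • (x : A) • ⟨u, hu⟩ := Subtype.ext (by
    change u * (e * x * e) = e * (x * u)
    rw [hcomm, mul_assoc, heu, mul_assoc])
  calc (x : A) • p ⟨u, hu⟩ = p (e • (x : A) • ⟨u, hu⟩) := by rw [map_smul, map_smul, heT']
    _ = p x := by rw [← h4, map_smul, huT', h3]

variable {R : Type u} [CommRing R] [IsArtinianRing R] [Algebra R A]
  {S : Type v} [AddCommGroup S] [Module A S] {e : A} {B : Type v} [Ring B] [Algebra R B]
  [Module A B] [IsScalarTower A B B]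

/-- A central idempotent `z` of `B` comes from a central idempotent `w` of `eAe`. On each simple
other than `S` it acts as `0` or `1`; simples with different values have no extensions, so the value
is constant. Then `w` is `0` or `e`, and `z` is `0` or `1`. -/
theorem IsRetraction.central_idempotent_eq [IsArtinianRing A] (h : IsRetraction S e B)
    (hS : IsNonCut (A := A) S) {z : B} (hz : IsIdempotentElem z) (hzc : ∀ b, z * b = b * z) :
    z = 0 ∨ z = 1 := by
  have he := h.idem
  let η : A →+* B := RingHom.smulOneHom
  have hη : ∀ (a : A) (b : B), a • b = η a * b := fun a b => by
    change a • b = (a • (1 : B)) * b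
    rw [smul_mul_assoc, one_mul]
  have hinj : ∀ a c : A, η (e * a) = η (e * c) → e * a = e * c := fun a c hac => by
    rw [← sub_eq_zero, ← mul_sub]
    refine h.inj _ ?_
    rw [hη, mul_one, mul_sub, map_sub, hac, sub_self]
  -- This yields `w = e a` with `η w = η e * z`. Identities for `w` are checked in `B`, where `η` is
  -- injective on `eA`.
  obtain ⟨a, ha⟩ := h.surj z
  rw [hη, hη, mul_one] at ha
  obtain ⟨w, hw⟩ : ∃ w, w = e * a := ⟨_, rfl⟩
  rw [← hw] at ha
  have hew : e * w = w := by rw [hw, ← mul_assoc, he.eq]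
  have hee : η e * η e = η e := by rw [← map_mul, he.eq]
  have hwe : w * e = w := by
    rw [hw, mul_assoc]
    refine hinj _ _ ?_
    rw [← mul_assoc, map_mul, ← hw, ← ha, mul_assoc, hzc, ← mul_assoc, hee]
  have hwc : ∀ c, w * (e * c * e) = e * c * e * w := fun c => by
    have h1 : w * (e * c * e) = e * (a * (e * c * e)) := by rw [hw, mul_assoc]
    have h2 : e * c * e * w = e * (c * e * w) := by simp only [mul_assoc]
    rw [h1, h2]
    refine hinj _ _ ?_
    rw [← h1, ← h2, map_mul, map_mul _ (e * c * e), ← ha, mul_assoc, hzc, ← mul_assoc,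
      ← mul_assoc (η (e * c * e)), ← map_mul, ← map_mul]
    simp only [mul_assoc, he.eq]
    simp only [← mul_assoc, he.eq]
  have hww : w * w = w := by
    have h1 : w * w = e * (a * w) := by rw [← mul_assoc, ← hw]
    rw [h1, hw]
    refine hinj _ _ ?_
    rw [← hw, ← h1, map_mul, ← ha, mul_assoc, hzc, mul_assoc, hz.eq, ← mul_assoc, hee]
  have hdich : ∀ T : ModuleCat.{v} A, IsSimpleModule A T → ¬ Nonempty (T ≃ₗ[A] S) →
      (∀ t : T, w • t = t) ∨ ∀ t : T, w • t = 0 := by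
    intro T hT hTS
    have heT := h.smul_eq_self T hTS
    let k : T →ₗ[A] T :=
      { toFun := fun t => w • t
        map_add' := smul_add w
        map_smul' := fun c t => by
          change w • c • t = c • w • t
          have h1 : w • c • t = (w * (e * c * e)) • t := by
            rw [mul_smul, mul_smul, mul_smul, heT, heT]
          rw [h1, hwc, mul_smul, mul_smul, mul_smul, heT (w • t), heT] }
    by_cases hk : k = 0
    · exact Or.inr fun t => LinearMap.congr_fun hk t
    · refine Or.inl fun t => ?_
      obtain ⟨s, rfl⟩ := LinearMap.surjective_of_ne_zero hk t
      change w • w • s = w • s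
      rw [← mul_smul, hww]
  have hwS : ∀ s : S, w • s = 0 := fun s => by
    rw [← hwe, mul_smul, h.smul_eq_zero, smul_zero]
  have hsub : e * (e - w) = e - w ∧ (e - w) * e = e - w ∧
      (∀ c, (e - w) * (e * c * e) = e * c * e * (e - w)) ∧ IsIdempotentElem (e - w) := by
    refine ⟨by rw [mul_sub, he.eq, hew], by rw [sub_mul, he.eq, hwe], fun c => ?_, ?_⟩
    · rw [sub_mul, mul_sub, hwc, mul_assoc (e * c) e e, he.eq, ← mul_assoc, ← mul_assoc, he.eq]
    · rw [IsIdempotentElem, mul_sub, sub_mul, sub_mul, he.eq, hwe, hew, hww, sub_self, sub_zero]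
  have hzero : ∀ y : B, (∀ b, y * b = b * y) → η e * y = 0 → y = 0 := fun y hy hy0 => by
    have := h.finite
    refine h.eq_zero_of_smul (X := B) fun c => ?_
    rw [hη, hη, ← hy, ← mul_assoc, hy0, zero_mul]
  rcases hS.all_or_none (fun T => ∀ t : T, w • t = t) (fun T T' hT ⟨i⟩ t => by
      rw [← i.apply_symm_apply t, ← map_smul, hT]) (fun T T' hT hT' hTS hTS' hext => by
        have heT := h.smul_eq_self T hTS
        have heT' := h.smul_eq_self T' hTS'
        rcases hdich T hT hTS with h1 | h1 <;> rcases hdich T' hT' hTS' with h2 | h2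
        · exact ⟨fun _ => h2, fun _ => h1⟩
        · refine absurd (extZero_of_corner he hsub.1 hsub.2.2.1 heT heT' ?_ ?_) hext
          · intro t; rw [sub_smul, heT, h1, sub_self]
          · intro t; rw [sub_smul, heT', h2, sub_zero]
        · exact absurd (extZero_of_corner he hew hwc heT heT' h1 h2) hext
        · have := IsSimpleModule.nontrivial A T
          have := IsSimpleModule.nontrivial A T'
          obtain ⟨t, ht⟩ := exists_ne (0 : T)
          obtain ⟨t', ht'⟩ := exists_ne (0 : T')
          exact ⟨fun h3 => absurd ((h3 t).symm.trans (h1 t)) ht,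
            fun h3 => absurd ((h3 t').symm.trans (h2 t')) ht'⟩) with hV | hV
  · right
    have h0 : e - w = 0 := idempotent_eq_zero hsub.2.2.2 fun T hT t => by
      by_cases hTS : Nonempty (T ≃ₗ[A] S)
      · obtain ⟨i⟩ := hTS
        exact i.injective (by
          rw [map_smul, sub_smul, hwS, h.smul_eq_zero, sub_self, map_zero])
      · rw [sub_smul, hV T hT hTS, h.smul_eq_self T hTS, sub_self]
    refine (sub_eq_zero.1 (hzero (1 - z) (fun b => ?_) ?_)).symm
    · rw [sub_mul, mul_sub, hzc, one_mul, mul_one]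
    · rw [mul_sub, mul_one, ha, ← map_sub, h0, map_zero]
  · left
    have h0 : w = 0 := idempotent_eq_zero hww fun T hT t => by
      by_cases hTS : Nonempty (T ≃ₗ[A] S)
      · obtain ⟨i⟩ := hTS
        exact i.injective (by rw [map_smul, hwS, map_zero])
      · exact (hdich T hT hTS).resolve_left (hV T hT hTS) t
    exact hzero z hzc (by rw [ha, h0, map_zero])

theorem IsRetraction.isConnectedAlgebra [IsArtinianRing A] (h : IsRetraction S e B)
    (hS : IsNonCut (A := A) S) : IsConnectedAlgebra B := by
  constructor
  · obtain ⟨T, hT, hTS⟩ := hS.exists_ne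
    obtain ⟨N, hN, -⟩ := h.exists_simple_of_not_iso (T := T) hTS
    have := IsSimpleModule.nontrivial B (B ⧸ N)
    exact N.mkQ_surjective.nontrivial
  · rintro ⟨I, J, hI, hJ, hIJ⟩
    have h1 : (1 : B) ∈ I ⊔ J := by rw [hIJ.sup_eq_top]; trivial
    obtain ⟨z, hz, z', hz', hzz⟩ := TwoSidedIdeal.mem_sup.1 h1
    have hmul : ∀ x ∈ I, ∀ y ∈ J, x * y = 0 ∧ y * x = 0 := by
      intro x hx y hy
      have h2 : x * y ∈ I ⊓ J := ⟨I.mul_mem_right _ _ hx, J.mul_mem_left _ _ hy⟩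
      have h3 : y * x ∈ I ⊓ J := ⟨I.mul_mem_left _ _ hx, J.mul_mem_right _ _ hy⟩
      rw [hIJ.inf_eq_bot] at h2 h3
      exact ⟨h2, h3⟩
    have hzI : ∀ x ∈ I, z * x = x ∧ x * z = x := by
      intro x hx
      constructor
      · conv_rhs => rw [← one_mul x, ← hzz, add_mul, (hmul x hx z' hz').2, add_zero]
      · conv_rhs => rw [← mul_one x, ← hzz, mul_add, (hmul x hx z' hz').1, add_zero]
    have hzc : ∀ b, z * b = b * z := fun b => by
      rw [← (hzI _ (I.mul_mem_right z b hz)).2, ← (hzI _ (I.mul_mem_left b z hz)).1, mul_assoc]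
    rcases h.central_idempotent_eq hS (hzI z hz).1 hzc with h0 | h0
    · refine hJ (eq_top_iff.2 fun x _ => ?_)
      rw [h0, zero_add] at hzz
      rw [← mul_one x, ← hzz]
      exact J.mul_mem_left _ _ hz'
    · refine hI (eq_top_iff.2 fun x _ => ?_)
      rw [← mul_one x, ← h0]
      exact I.mul_mem_left _ _ hz

theorem IsRetraction.isConnectedNakayama (h : IsRetraction S e B) (hA : IsConnectedNakayama R A)
    (hS : IsNonCut (A := A) S) [Module.Finite R B] : IsConnectedNakayama R B := by
  have := hA.isArtinianRing
  have := h.isArtinianRing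
  refine ⟨inferInstance, h.isConnectedAlgebra hS, fun M hM hP hi => ?_, fun M hM hI hi => ?_⟩
  · exact (h.isChainModule_of_projective hA hi).isUniserial
  · exact (h.isChainModule_of_injective hA hI hi).isUniserial

end Connected

/-! ### Finding a localizable module whose removal keeps the quiver connected -/

section ExistsLocalizable

variable {A : Type v} [Ring A]

/-- The projective cover of a simple quotient of `M` splits off `M`, and the complement is shorter.
-/
theorem injective_of_forall_simple_cover [IsArtinianRing A]
    (h : ∀ (P S : Type v) [AddCommGroup P] [Module A P] [AddCommGroup S] [Module A S]
      [IsSimpleModule A S] (f : P →ₗ[A] S), IsProjectiveCover f → Module.Injective A P) (n : ℕ) :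
    ∀ (M : Type v) [AddCommGroup M] [Module A M] [Module.Finite A M] [Module.Projective A M],
      Module.length A M ≤ n → Module.Injective A M := by
  induction n with
  | zero =>
    intro M _ _ _ _ hM
    have : Subsingleton M := Module.length_eq_zero_iff.1 (le_antisymm (by simpa using hM) bot_le)
    exact ⟨fun X Y _ _ _ _ f hf g => ⟨0, fun x => Subsingleton.elim _ _⟩⟩
  | succ n ih =>
    intro M _ _ _ _ hM
    rcases subsingleton_or_nontrivial M with hs | hs
    · exact ⟨fun X Y _ _ _ _ f hf g => ⟨0, fun x => Subsingleton.elim _ _⟩⟩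
    obtain ⟨N, -, hN⟩ := exists_le_isSimpleModule_quotient (A := A) (M := M) (N := ⊥) bot_ne_top
    obtain ⟨P, _, _, f, hf⟩ := exists_isProjectiveCover (A := A) (M ⧸ N)
    obtain ⟨g, -, hgs⟩ := hf.isEssentialEpi.exists_surjective_lift (f := N.mkQ) N.mkQ_surjective
    have := hf.projective
    have := hf.finite
    obtain ⟨s, hs⟩ := Module.projective_lifting_property g LinearMap.id hgs
    have hc : IsCompl (LinearMap.range s) (LinearMap.ker g) := isCompl_range_ker hs
    have hP := h P (M ⧸ N) f hf
    have hK := projective_of_isCompl hc.symm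
    have hPpos : 1 ≤ Module.length A P := by
      have h1 := Module.length_le_of_surjective f hf.surjective
      rwa [Module.length_eq_one A (M ⧸ N)] at h1
    have hl : Module.length A (LinearMap.ker g) ≤ n := by
      have h1 := Module.length_eq_add_of_exact (LinearMap.ker g).subtype g
        (Submodule.injective_subtype _) hgs (LinearMap.exact_subtype_ker_map g)
      have h2 : Module.length A (LinearMap.ker g) + 1 ≤ (n + 1 : ℕ) :=
        (add_le_add le_rfl hPpos).trans (h1 ▸ hM)
      push_cast at h2
      exact (ENat.add_le_add_iff_right ENat.one_ne_top).1 h2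
    have hKI := ih (LinearMap.ker g) hl
    obtain ⟨r, hr⟩ := exists_retraction_of_isCompl hc.symm
    have hr' : ∀ x : LinearMap.ker g, r x = x := LinearMap.congr_fun hr
    refine ⟨fun X Y _ _ _ _ i hi k => ?_⟩
    obtain ⟨k₁, hk₁⟩ := hKI.out i hi (r ∘ₗ (LinearMap.id - s ∘ₗ g) ∘ₗ k)
    obtain ⟨k₂, hk₂⟩ := hP.out i hi (g ∘ₗ k)
    refine ⟨(LinearMap.ker g).subtype ∘ₗ k₁ + s ∘ₗ k₂, fun x => ?_⟩
    have h1 : k x - s (g (k x)) ∈ LinearMap.ker g := by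
      have := LinearMap.congr_fun hs (g (k x))
      rw [LinearMap.mem_ker, map_sub, sub_eq_zero]
      exact this.symm
    simp only [LinearMap.add_apply, LinearMap.comp_apply, hk₁, hk₂]
    have h2 := congrArg Subtype.val (hr' ⟨_, h1⟩)
    simp only at h2
    change (r (k x - s (g (k x))) : M) + s (g (k x)) = k x
    rw [h2, sub_add_cancel]

namespace SimpleOrdering

variable (O : SimpleOrdering A) {R : Type u} [CommRing R] [IsArtinianRing R] [Algebra R A]
  (hA : IsConnectedNakayama R A)
include hA

-- Removing `S_j` leaves the path from `S_{j+1}` to `S_{j+n-1}`, with indices modulo `n`.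
omit hA in
omit [CommRing R] [IsArtinianRing R] [Algebra R A] in
theorem isNonCut_of_links (hn : 2 ≤ numSimples A) (hn' : 0 < numSimples A) (j : ℕ)
    (hlink : ∀ k, k + 2 < numSimples A →
      ¬ ExtZero A (O.S (idx hn' (j + 1 + k))) (O.S (idx hn' (j + 1 + k + 1))) 1) :
    IsNonCut (A := A) (O.S (idx hn' j)) := by
  have hne : ∀ k, k + 1 < numSimples A →
      ¬ Nonempty (O.S (idx hn' (j + 1 + k)) ≃ₗ[A] O.S (idx hn' j)) := by
    rintro k hk ⟨i⟩
    have h1 : (j + 1 + k) % numSimples A = j % numSimples A :=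
      congrArg Fin.val (O.eq_of_iso _ _ ⟨i.toModuleIso⟩)
    have h2 : j ≡ j + 1 + k [MOD numSimples A] := h1.symm
    have h3 := (Nat.modEq_iff_dvd' (by lia)).1 h2
    have := Nat.le_of_dvd (by lia) h3
    lia
  refine ⟨⟨O.S (idx hn' (j + 1)), O.isSimple _, hne 0 (by lia)⟩, fun V hV hext => ?_⟩
  have hind : ∀ k, k + 1 < numSimples A →
      (V (O.S (idx hn' (j + 1 + k))) ↔ V (O.S (idx hn' (j + 1)))) := by
    intro k
    induction k with
    | zero => exact fun _ => Iff.rfl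
    | succ k ih =>
      intro hk
      rw [← ih (by lia)]
      exact (hext _ _ (O.isSimple _) (O.isSimple _) (hne k (by lia)) (hne (k + 1) hk)
        (hlink k hk)).symm
  have hall : ∀ T : ModuleCat.{v} A, IsSimpleModule A T → ¬ Nonempty (T ≃ₗ[A] O.S (idx hn' j)) →
      (V T ↔ V (O.S (idx hn' (j + 1)))) := by
    intro T hT hTS
    obtain ⟨m, ⟨i⟩⟩ := O.complete T hT
    obtain ⟨k, hk, hkm⟩ : ∃ k < numSimples A, idx hn' (j + 1 + k) = m := by
      -- `k` is `m - (j + 1)` modulo `n`, with `(n - 1)(j + 1)` in place of the negative term.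
      refine ⟨(m + (numSimples A - 1) * (j + 1)) % numSimples A, Nat.mod_lt _ hn', Fin.ext ?_⟩
      change (j + 1 + (m + (numSimples A - 1) * (j + 1)) % numSimples A) % numSimples A = m
      rw [Nat.add_mod_mod]
      have h1 : ∀ N l : ℕ, 0 < N → j + 1 + (l + (N - 1) * (j + 1)) = l + N * (j + 1) := by
        rintro (_ | N) l hN
        · exact absurd hN (lt_irrefl 0)
        · rw [Nat.add_sub_cancel]
          ring
      rw [h1 _ _ hn', Nat.add_mul_mod_self_left, Nat.mod_eq_of_lt m.2]
    have hk' : k + 1 < numSimples A := by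
      by_contra hlt
      have h1 : idx hn' (j + 1 + k) = idx hn' j := Fin.ext (by
        have : j + 1 + k = j + numSimples A := by lia
        simp [idx, this])
      exact hTS ⟨i.toLinearEquiv.trans (eqToIso (congrArg O.S (hkm.symm.trans h1))).toLinearEquiv⟩
    rw [← hind k hk', hkm]
    exact ⟨fun h => hV _ _ h ⟨i.toLinearEquiv⟩, fun h => hV _ _ h ⟨i.toLinearEquiv.symm⟩⟩
  by_cases h : V (O.S (idx hn' (j + 1)))
  · exact Or.inl fun T hT hTS => (hall T hT hTS).2 h
  · exact Or.inr fun T hT hTS => mt (hall T hT hTS).1 h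

theorem length_le_of_forall_eq {l : ℕ} (hl : ∀ j, O.c j = l) {I : Type v} [AddCommGroup I]
    [Module A I] [Module.Finite A I] [Nontrivial I] (hI : IsChainModule A I) :
    Module.length A I ≤ l := by
  have := hA.isArtinianRing
  obtain ⟨N, -, hN⟩ := exists_le_isSimpleModule_quotient (A := A) (M := I) (N := ⊥) bot_ne_top
  obtain ⟨j, ⟨i⟩⟩ := O.complete (ModuleCat.of A (I ⧸ N)) hN
  have := (O.isCover j).projective
  obtain ⟨h, -, hs⟩ := (hI.isEssentialEpi N.mkQ_surjective).exists_surjective_lift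
    (f := i.toLinearEquiv.symm.toLinearMap ∘ₗ O.cover j)
    (i.toLinearEquiv.symm.surjective.comp (O.isCover j).surjective)
  rw [← hl j, ← O.length_eq hA]
  exact Module.length_le_of_surjective h hs

/-- The injective hull of the socle of `P` is uniserial, hence a quotient of some `P_j`, hence of
length at most `l`. It contains `P`, which has length `l`, so they are equal. -/
theorem isSelfInjective_of_forall_eq {l : ℕ} (hl : ∀ j, O.c j = l) : IsSelfInjective A := by
  have := hA.isArtinianRing
  have := hA.finite
  have key : ∀ (P S : Type v) [AddCommGroup P] [Module A P] [AddCommGroup S] [Module A S]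
      [IsSimpleModule A S] (f : P →ₗ[A] S), IsProjectiveCover f → Module.Injective A P := by
    intro P S _ _ _ _ _ f hf
    have := hf.finite
    have := IsSimpleModule.nontrivial A S
    have := hf.surjective.nontrivial
    obtain ⟨j, ⟨i⟩⟩ := O.complete (ModuleCat.of A S) inferInstance
    have hPl : Module.length A P = l := by
      rw [← hl j, ← O.length_eq hA]
      exact (hf.comp_linearEquiv i.toLinearEquiv).length_eq (O.isCover j)
    obtain ⟨T, hT⟩ := exists_isSimpleModule_le (A := A) P
    have hTl := (hA.isChainModule_of_cover hf).isLeastNonzero hT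
    obtain ⟨I, _, _, k, hfin, hinj, hk, hleast⟩ := exists_injective_hull (A := A) R T
    have hIc := hA.isChainModule_of_isLeastNonzero hleast
    have := IsSimpleModule.nontrivial A T
    obtain ⟨t, ht⟩ := exists_ne (0 : T)
    obtain ⟨g, hg⟩ := hinj.out T.subtype T.injective_subtype k
    have hgi : Function.Injective g := hTl.injective_of_ne_zero fun h0 => by
      have h5 : k t = 0 := (hg t).symm.trans (LinearMap.congr_fun h0 t)
      exact ht (hk (by rw [h5, map_zero]))
    have := hgi.nontrivial
    have hIl := O.length_le_of_forall_eq hA hl hIc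
    have htop : LinearMap.range g = ⊤ := by
      by_contra hne
      have h1 := Submodule.length_lt hne
      rw [← (LinearEquiv.ofInjective g hgi).length_eq, hPl] at h1
      exact absurd (h1.trans_le hIl) (lt_irrefl _)
    let E := LinearEquiv.ofBijective g ⟨hgi, LinearMap.range_eq_top.1 htop⟩
    exact injective_of_retract hinj E.toLinearMap E.symm.toLinearMap
      (LinearMap.ext E.symm_apply_apply)
  obtain ⟨n, hn⟩ : ∃ k : ℕ, Module.length A A = k :=
    ⟨_, (ENat.natCast_toNat Module.length_ne_top).symm⟩
  exact injective_of_forall_simple_cover key n A hn.le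

theorem c_le_succ (hn : 0 < numSimples A) (i : ℕ) : O.c (idx hn i) ≤ O.c (idx hn (i + 1)) + 1 := by
  have := O.thetaLift_le_succ hA hn i
  simp only [thetaLift] at this
  lia

/-- Since `c_i ≤ c_{i+1} + 1`, absence of equality makes `c` nondecreasing around a full turn, hence
constant, and `A` self-injective. -/
theorem exists_c_eq (hn : 0 < numSimples A) (hI : ¬ IsSelfInjective A) :
    ∃ i, O.c (idx hn i) = O.c (idx hn (i + 1)) + 1 := by
  by_contra! hne
  have hmono : Monotone fun i => O.c (idx hn i) := monotone_nat_of_le_succ fun i => by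
    have := O.c_le_succ hA hn i
    have := hne i
    lia
  refine hI (O.isSelfInjective_of_forall_eq hA (l := O.c (idx hn 0)) fun j => ?_)
  rw [← idx_val hn j]
  refine le_antisymm ?_ (hmono (Nat.zero_le _))
  have h1 := hmono j.2.le
  have h2 : idx hn (numSimples A) = idx hn 0 := Fin.ext (by simp [idx])
  simp only [h2] at h1
  exact h1

/-- The surjection from `P_{i+1}` onto the radical of `P_i` is between modules of equal length. -/
theorem projective_ker_cover_of_c_eq (hn : 0 < numSimples A) {i : ℕ}
    (hi : O.c (idx hn i) = O.c (idx hn (i + 1)) + 1) :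
    Module.Projective A (LinearMap.ker (O.cover (idx hn i))) := by
  have := hA.isArtinianRing
  have := (O.isCover (idx hn i)).finite
  have := (O.isCover (idx hn (i + 1))).finite
  have := (O.isCover (idx hn (i + 1))).projective
  have hl := O.length_ker_cover (idx hn i)
  have hk : Module.length A (LinearMap.ker (O.cover (idx hn i))) = O.c (idx hn (i + 1)) := by
    obtain ⟨k, hk⟩ : ∃ k : ℕ, Module.length A (LinearMap.ker (O.cover (idx hn i))) = k :=
      ⟨_, (ENat.natCast_toNat Module.length_ne_top).symm⟩
    rw [O.length_eq hA, hi, hk] at hl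
    rw [hk]
    norm_cast at hl ⊢
    lia
  have hpos : O.c (idx hn (i + 1)) ≠ 0 := fun h0 => by
    have h1 := O.length_ker_cover (idx hn (i + 1))
    rw [O.length_eq hA, h0] at h1
    exact absurd h1.symm (by simp)
  have h0 : LinearMap.ker (O.cover (idx hn i)) ≠ ⊥ := fun h0 => by
    rw [h0, Module.length_bot] at hk
    exact hpos (by exact_mod_cast hk.symm)
  obtain ⟨h, hs⟩ := O.exists_surjective_of_submodule hA hn i 1 _ (by simpa using hl) h0
  have hinj : Function.Injective h := by
    have h1 := Module.length_eq_add_of_exact (LinearMap.ker h).subtype h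
      (Submodule.injective_subtype _) hs (LinearMap.exact_subtype_ker_map h)
    rw [O.length_eq hA, hk] at h1
    have h2 : Module.length A (LinearMap.ker h) = 0 := by
      obtain ⟨k, hk'⟩ : ∃ k : ℕ, Module.length A (LinearMap.ker h) = k :=
        ⟨_, (ENat.natCast_toNat Module.length_ne_top).symm⟩
      rw [hk'] at h1 ⊢
      norm_cast at h1 ⊢
      lia
    rw [Module.length_eq_zero_iff, Submodule.subsingleton_iff_eq_bot] at h2
    exact LinearMap.ker_eq_bot.1 h2
  exact Module.Projective.of_equiv (LinearEquiv.ofBijective h ⟨hinj, hs⟩)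

/-- If the cover `f` had a kernel, a simple quotient of it would extend to a nonzero `q` on `P` with
`ker f ⊔ ker q = ⊤`, although `ker f` is superfluous. -/
theorem projective_of_forall_extZero {S : Type v} [AddCommGroup S] [Module A S]
    [IsSimpleModule A S] (hS : ∀ T : ModuleCat.{v} A, IsSimpleModule A T → ExtZero A S T 1) :
    Module.Projective A S := by
  have := hA.isArtinianRing
  obtain ⟨P, _, _, f, hf⟩ := exists_isProjectiveCover (A := A) S
  have := hf.projective
  have := hf.finite
  have hchain := hA.isChainModule_of_cover hf
  have hker : LinearMap.ker f = ⊥ := by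
    by_contra h0
    have : Nontrivial (LinearMap.ker f) := Submodule.nontrivial_iff_ne_bot.2 h0
    obtain ⟨K, -, hK⟩ := exists_le_isSimpleModule_quotient
      (bot_ne_top : (⊥ : Submodule A (LinearMap.ker f)) ≠ ⊤)
    obtain ⟨q, hq⟩ := (exists_extend_iff_extZero hf.surjective).2
      (hS (ModuleCat.of A (LinearMap.ker f ⧸ K)) hK) K.mkQ
    have hqs : Function.Surjective q := fun y => by
      obtain ⟨x, rfl⟩ := K.mkQ_surjective y
      exact ⟨x, LinearMap.congr_fun hq x⟩
    have hne : LinearMap.ker f ⊔ LinearMap.ker q = ⊤ := by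
      refine eq_top_iff.2 fun x _ => ?_
      obtain ⟨y, hy⟩ := K.mkQ_surjective (q x)
      have h1 : q y = q x := (LinearMap.congr_fun hq y).trans hy
      rw [← add_sub_cancel (y : P) x]
      exact Submodule.add_mem_sup y.2 (by rw [LinearMap.mem_ker, map_sub, h1, sub_self])
    have h2 := hf.superfluous (LinearMap.ker q) (by rw [sup_comm, hne])
    have := IsSimpleModule.nontrivial A (LinearMap.ker f ⧸ K)
    obtain ⟨y, hy⟩ := exists_ne (0 : LinearMap.ker f ⧸ K)
    obtain ⟨x, rfl⟩ := hqs y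
    exact hy (LinearMap.mem_ker.1 (h2 ▸ trivial : x ∈ LinearMap.ker q))
  exact Module.Projective.of_equiv
    (LinearEquiv.ofBijective f ⟨LinearMap.ker_eq_bot.1 hker, hf.surjective⟩)

end SimpleOrdering

/-- On a line the last simple is projective, and removing an end leaves a path. On a cycle the drop
`c_i = c_{i+1} + 1` gives `S_i` a projective first syzygy. A drop forces `n ≥ 2`, which also
excludes a loop at `S_i`. -/
theorem IsConnectedNakayama.exists_isLocalizable {R : Type u} [CommRing R] [IsArtinianRing R]
    [Algebra R A] (hA : IsConnectedNakayama R A) (hI : ¬ IsSelfInjective A) :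
    ∃ S : ModuleCat.{v} A, IsLocalizable S ∧ IsNonCut (A := A) S := by
  obtain ⟨O⟩ := hA.nonempty_simpleOrdering
  have hn := hA.numSimples_pos
  obtain ⟨i, hi⟩ := O.exists_c_eq hA hn hI
  have hn2 : 2 ≤ numSimples A := by
    by_contra hlt
    have h1 : SimpleOrdering.idx hn (i + 1) = SimpleOrdering.idx hn i := Fin.ext (by
      have := (SimpleOrdering.idx hn (i + 1)).2
      have := (SimpleOrdering.idx hn i).2
      lia)
    rw [h1] at hi
    lia
  rcases O.quiver with hq | hq
  · have hS := O.isSimple (SimpleOrdering.idx hn (numSimples A - 1))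
    have hP : Module.Projective A (O.S (SimpleOrdering.idx hn (numSimples A - 1))) := by
      refine SimpleOrdering.projective_of_forall_extZero hA fun T hT => ?_
      obtain ⟨k, ⟨e⟩⟩ := O.complete T hT
      refine ExtZero.congr (LinearEquiv.refl A _) e.toLinearEquiv.symm (not_not.1 fun hne => ?_)
      have h1 := (hq _ _).1 ((O.ext_iff _ k).2 hne)
      have h2 : ((SimpleOrdering.idx hn (numSimples A - 1) : Fin _) : ℕ) = numSimples A - 1 :=
        Nat.mod_eq_of_lt (by lia)
      have := k.2
      lia
    refine ⟨_, ⟨hS, ?_, ExtZero.of_projective (n := 0)⟩,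
      O.isNonCut_of_links hn2 hn _ fun k hk => (O.ext_iff _ _).1 ((hq _ _).2 ?_)⟩
    · have : Projective (O.S (SimpleOrdering.idx hn (numSimples A - 1))) :=
        (IsProjective.iff_projective _).1 hP
      exact (projectiveDimension_le_iff _ 1).2 inferInstance
    · have h1 : numSimples A - 1 + 1 + k = numSimples A + k := by lia
      simp only [SimpleOrdering.idx, h1, add_assoc, Nat.add_mod_left]
      rw [Nat.mod_eq_of_lt (by lia), Nat.mod_eq_of_lt (by lia)]
  · refine ⟨O.S (SimpleOrdering.idx hn i), ⟨O.isSimple _, ?_, ?_⟩,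
      O.isNonCut_of_links hn2 hn i fun k hk => (O.ext_iff _ _).1 ((hq _ _).2 ?_)⟩
    · have hK := O.projective_ker_cover_of_c_eq hA hn hi
      have hc := O.isCover (SimpleOrdering.idx hn i)
      have hse := shortExact_of_exact (Submodule.injective_subtype _) hc.surjective
        (LinearMap.exact_subtype_ker_map _)
      have := hc.projective
      have hP : Projective (ModuleCat.of A (O.P (SimpleOrdering.idx hn i))) :=
        (IsProjective.iff_projective _).1 hc.projective
      have hKP : Projective (ModuleCat.of A (LinearMap.ker (O.cover (SimpleOrdering.idx hn i)))) :=
        (IsProjective.iff_projective _).1 hK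
      exact (projectiveDimension_le_iff _ 1).2 ((hse.hasProjectiveDimensionLT_X₃_iff 0 hP).2
        (projective_iff_hasProjectiveDimensionLT_one.1 hKP))
    · by_contra hne
      have h1 := O.eq_succ_mod (j := SimpleOrdering.idx hn i) (k := SimpleOrdering.idx hn i) hne
      have h2 := (SimpleOrdering.idx hn i).2
      rcases Nat.lt_or_ge (SimpleOrdering.idx hn i + 1) (numSimples A) with h3 | h3
      · rw [Nat.mod_eq_of_lt h3] at h1
        lia
      · have h4 : (SimpleOrdering.idx hn i : ℕ) + 1 = numSimples A := by lia
        rw [h4, Nat.mod_self] at h1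
        lia
    · simp [SimpleOrdering.idx, add_assoc]

theorem IsConnectedNakayama.exists_isLeftRetraction {R : Type u} [CommRing R] [IsArtinianRing R]
    [Algebra R A] (hA : IsConnectedNakayama R A) (hI : ¬ IsSelfInjective A) :
    ∃ (B : Type v) (_ : Ring B) (_ : Algebra R B) (η : A →ₐ[R] B) (S : ModuleCat.{v} A),
      IsLeftRetraction S η ∧ IsConnectedNakayama R B := by
  have := hA.isArtinianRing
  have := hA.finite
  obtain ⟨S, hS, hcut⟩ := hA.exists_isLocalizable hI
  obtain ⟨e, he⟩ := hS.exists_isLocalizingPair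
  have h := isRetraction_cornerEnd R he
  refine ⟨CornerEnd R e, _, _, toCornerEnd R e, S, isLeftRetraction_of_isRetraction R hS h, ?_⟩
  let _ := moduleOfAlgHom (toCornerEnd R e)
  have := isScalarTower_of_algHom (toCornerEnd R e)
  have := finite_cornerEnd R (e := e)
  have h : IsRetraction S e (CornerEnd R e) := h
  exact h.isConnectedNakayama hA hcut

/-- Each further retraction lowers the number of simples, so extending a sequence must end at a
self-injective algebra. -/
theorem IsLeftRetractionSequence.exists_isSelfInjective {R : Type u} [CommRing R]
    [IsArtinianRing R] [Algebra R A] (n : ℕ) : ∀ (r : ℕ) (B : Type v) [Ring B] [Algebra R B]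
    (f : A →ₐ[R] B), IsLeftRetractionSequence R A r B f → numSimples B ≤ n →
    ∃ (r' : ℕ) (B' : Type v) (_ : Ring B') (_ : Algebra R B') (f' : A →ₐ[R] B'),
      IsLeftRetractionSequence R A r' B' f' ∧ IsSelfInjective B' := by
  induction n with
  | zero =>
    intro r B _ _ f hf hB
    have := hf.isConnectedNakayama.2.numSimples_pos
    lia
  | succ n ih =>
    intro r B _ _ f hf hB
    by_cases hI : IsSelfInjective B
    · exact ⟨r, B, _, _, f, hf, hI⟩
    · obtain ⟨C, _, _, η, S, hη, hC⟩ := hf.isConnectedNakayama.2.exists_isLeftRetraction hI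
      have hf' := hf.step η S hC hη
      refine ih (r + 1) C _ hf' ?_
      have h1 := hf.numSimples_eq.1
      have h2 := hf'.numSimples_eq.1
      lia

end ExistsLocalizable
end
end NakayamaRetraction

/-! ### The theorem -/

open NakayamaRetraction in
theorem mainTheorem1 {R : Type u} [CommRing R] [IsArtinianRing R]
    {A : Type v} [Ring A] [Algebra R A] (hA : IsConnectedNakayama R A) :
    ∃ d : ℕ, HasDepth A d ∧
      (∃ (r : ℕ) (B : Type v) (_ : Ring B) (_ : Algebra R B) (f : A →ₐ[R] B),
        IsLeftRetractionSequence R A r B f ∧ IsSelfInjective B ∧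
          d ≤ r ∧ r + 1 ≤ numSimples A) ∧
      (∀ (r : ℕ) (B : Type v) [Ring B] [Algebra R B] (f : A →ₐ[R] B),
        IsLeftRetractionSequence R A r B f → IsSelfInjective B →
          d ≤ r ∧ r + 1 ≤ numSimples A ∧
          (IsSimpleRing B ↔ globalDim A < ⊤) ∧
          (globalDim A < ⊤ → r + 1 = numSimples A) ∧
          (globalDim A = ⊤ → r = numSimplesFiniteProjDim A ∧
            ∀ (r' : ℕ) (B' : Type v) [Ring B'] [Algebra R B'] (f' : A →ₐ[R] B'),
              IsLeftRetractionSequence R A r' B' f' → IsSelfInjective B' →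
                ∃ ψ : B ≃ₐ[R] B', (ψ : B →ₐ[R] B').comp f = f')) := by
  obtain ⟨O⟩ := hA.nonempty_simpleOrdering
  have main : ∀ (r : ℕ) (B : Type v) [Ring B] [Algebra R B] (f : A →ₐ[R] B),
      IsLeftRetractionSequence R A r B f → IsSelfInjective B →
        O.depth ≤ r ∧ r + 1 ≤ numSimples A ∧ (IsSimpleRing B ↔ globalDim A < ⊤) ∧
          (globalDim A < ⊤ → r + 1 = numSimples A) ∧
          (globalDim A = ⊤ → r = numSimplesFiniteProjDim A) := by
    intro r B _ _ f hf hI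
    have hB := hf.isConnectedNakayama.2
    obtain ⟨h1, h2, h3⟩ := hf.numSimples_eq
    have h4 := hB.numSimples_pos
    have h5 : globalDim A < ⊤ → r + 1 = numSimples A := fun h => by
      rw [h1, hB.numSimples_eq_one hI (h3.1 h)]
    have h6 : globalDim A = ⊤ → r = numSimplesFiniteProjDim A := fun h => by
      have h7 : ¬ globalDim A < ⊤ := h ▸ lt_irrefl _
      rw [h2, hB.numSimplesFiniteProjDim_eq_zero hI (mt h3.2 h7), add_zero]
    refine ⟨?_, by lia, (hB.isSimpleRing_iff hI).trans h3.symm, h5, h6⟩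
    -- In finite global dimension `r = n - 1`, which bounds the depth trivially; otherwise `r`
    -- counts the simples of finite projective dimension, and the estimate through `θ` applies.
    rcases lt_or_eq_of_le (le_top : globalDim A ≤ ⊤) with h | h
    · have := O.depth_add_one_le hA.numSimples_pos
      have := h5 h
      lia
    · rw [h6 h]
      exact O.depth_le_numSimplesFiniteProjDim hA
  refine ⟨O.depth, ⟨⟨O⟩, O.depth_eq hA⟩, ?_, fun r B _ _ f hf hI => ?_⟩
  · obtain ⟨r, B, _, _, f, hf, hI⟩ :=
      IsLeftRetractionSequence.exists_isSelfInjective _ 0 A _ (.refl hA) le_rfl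
    exact ⟨r, B, _, _, f, hf, hI, (main r B f hf hI).1, (main r B f hf hI).2.1⟩
  · obtain ⟨h1, h2, h3, h4, h5⟩ := main r B f hf hI
    refine ⟨h1, h2, h3, h4, fun h => ⟨h5 h, fun r' B' _ _ f' hf' hI' => ?_⟩⟩
    exact hf.exists_algEquiv hf' hI hI' (h ▸ lt_irrefl _)
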